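/- Let $d\ge 1$ and let $\widehat{S_d}$ be the extended affine symmetric group, i.e. the group of permutations $w$ of $\mathbb{Z}$ with $w(k+d)=w(k)+d$ for all $k$. Put $a(w)=\frac1d\sum_{k=1}^d (w(k)-k)$, let $\tau\in\widehat{S_d}$ be the shift $k\mapsto k+1$, and let $\widetilde{S_d}=\{w : a(w)=0\}$ be the affine symmetric group, a Coxeter group with its usual generators $s_k$ $(k\in\mathbb{Z}/d)$ if $d\ge 2$, and trivial if $d=1$. The length $\ell$, the Bruhat order $\le$ and the Kazhdan–Lusztig polynomials $P_{u,v}\in\mathbb{Z}[q]$ of $\widetilde{S_d}$ are extended to $\widehat{S_d}$ by $\ell(w)=\ell(\tau^{-a(w)}w)$; $u\le v$ if and only if $a(u)=a(v)$ and $\tau^{-a(u)}u\le\tau^{-a(v)}v$; $P_{u,v}=P_{\tau^{-a(u)}u,\,\tau^{-a(v)}v}$ if $a(u)=a(v)$, and $P_{u,v}=0$ otherwise. Write $[y,w]=\{x\in\widehat{S_d} : y\le x\le w\}$, and for $w\in\widehat{S_d}$, $i\in\mathbb{Z}$ put $$\mathrm{inv}_i(w)=|\{i'<i : w(i')>w(i)\}|,\qquad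 \mathrm{Inv}_i(w)=|\{i'>i : w(i')<w(i)\}|.$$ If $y\le w$, call $i\in\mathbb{Z}$ cancellable for $[y,w]$ if $y(i)=w(i)$, $\mathrm{inv}_i(y)=\mathrm{inv}_i(w)$ and $\mathrm{Inv}_i(y)=\mathrm{Inv}_i(w)$ (any two of these imply the third). Suppose that $i$ is cancellable for $[y,w]$. Then: 1. For every $x\in[y,w]$, $x(i)=y(i)$ and $\mathrm{inv}_i(x)=\mathrm{inv}_i(y)$. Moreover, $i$ is cancellable for $[u,v]$ for all $u\le v$ in $[y,w]$. Suppose further that order-preserving bijections $\sigma_{c}:\mathbb{Z}\setminus c\to\mathbb{Z}$ have been chosen for all congruence classes $c$ mod $d$ (this is possible exactly when $d\ge 2$), and for $x\in\widehat{S_d}$ let $x^{\hat i}=\sigma_{\overline{x(i)}}\circ x\circ\sigma_{\bar i}^{-1}\in\widehat{S_{d-1}}$, where $\bar k$ is the class of $k$ mod $d$. Then, for every such choice: 2. The map $x\mapsto x^{\hat i}$ is an isomorphism of posets from $[y,w]$ to $[y^{\hat i},w^{\hat i}]$, and it reduces all lengths by the same amount: there is an integer $c\ge 0$ such that $\ell(x)=\ell(x^{\hat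 i})+c$ for all $x\in[y,w]$. 3. For all $u,v\in[y,w]$, $P_{u,v}=P_{u^{\hat i},v^{\hat i}}$. -/

import Mathlib

open scoped Polynomial LaurentPolynomial

noncomputable section

/-! ### Length, Bruhat order, Hecke algebra and Kazhdan-Lusztig polynomials

All notions are attached to a group `W` with a distinguished set `S` of generators; when `(W, S)` is
a Coxeter system they are the standard ones. -/

namespace CoxeterPair

variable {W : Type*} [Group W] (S : Set W)

/-- The length of `w`: the least number of factors in an expression of `w` as a product of
elements of `S`. -/
def length (w : W) : ℕ :=
  sInf {n | ∃ l : List W, (∀ s ∈ l, s ∈ S) ∧ l.prod = w ∧ l.length = n}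

/-- The reflections: the conjugates of the elements of `S`. -/
def IsReflection (t : W) : Prop :=
  ∃ s ∈ S, ∃ g : W, t = g * s * g⁻¹

/-- The Bruhat order: `u ≤ v` if `v` is reached from `u` by successive multiplication by
reflections, the length increasing at every step. -/
def BruhatLE (u v : W) : Prop :=
  Relation.ReflTransGen
    (fun x z => ∃ t, IsReflection S t ∧ z = x * t ∧ length S x < length S z) u v

/-- The indeterminate `q` of the ring `ℤ[q, q⁻¹]`. -/
abbrev q : ℤ[T;T⁻¹] := LaurentPolynomial.T 1

/-- The defining relations of the Hecke algebra, with generators `T_w` for `w` in `W`: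
`T_1 = 1`, `T_u T_v = T_{uv}` if `ℓ(uv) = ℓ(u) + ℓ(v)`, and `(T_s + 1)(T_s - q) = 0` for `s` in `S`. -/
inductive HeckeRel : FreeAlgebra ℤ[T;T⁻¹] W → FreeAlgebra ℤ[T;T⁻¹] W → Prop
  | one : HeckeRel (FreeAlgebra.ι ℤ[T;T⁻¹] 1) 1
  | mul (u v : W) (h : length S (u * v) = length S u + length S v) :
      HeckeRel (FreeAlgebra.ι ℤ[T;T⁻¹] u * FreeAlgebra.ι ℤ[T;T⁻¹] v)
        (FreeAlgebra.ι ℤ[T;T⁻¹] (u * v))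
  | quad (s : W) (hs : s ∈ S) :
      HeckeRel ((FreeAlgebra.ι ℤ[T;T⁻¹] s + 1) *
        (FreeAlgebra.ι ℤ[T;T⁻¹] s - algebraMap ℤ[T;T⁻¹] (FreeAlgebra ℤ[T;T⁻¹] W) q)) 0

/-- The Hecke algebra of `(W, S)` over `ℤ[q, q⁻¹]`. -/
abbrev Hecke : Type _ := RingQuot (HeckeRel S)

/-- The standard basis element `T_w` of the Hecke algebra. -/
def heckeT (w : W) : Hecke S :=
  RingQuot.mkAlgHom ℤ[T;T⁻¹] (HeckeRel S) (FreeAlgebra.ι ℤ[T;T⁻¹] w)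

/-- The family `p` is the family `y ↦ P_{y,w}` of Kazhdan-Lusztig polynomials: `P_{w,w} = 1`,
`P_{y,w} = 0` unless `y ≤ w`, `deg P_{y,w} ≤ (ℓ(w) - ℓ(y) - 1) / 2` if `y < w`, and
`q^{-ℓ(w)/2} ∑ P_{y,w} T_y` is fixed by the bar involution
`∑ a_y(q) T_y ↦ ∑ a_y(q⁻¹) (T_{y⁻¹})⁻¹` (both sides are multiplied by `q^{ℓ(w)/2}` below). -/
structure IsKLFamily (w : W) (p : W →₀ ℤ[X]) : Prop where
  self : p w = 1
  support : ∀ y, ¬ BruhatLE S y w → p y = 0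
  degree : ∀ y, BruhatLE S y w → y ≠ w → length S y + (2 * (p y).natDegree + 1) ≤ length S w
  bar_invariant :
    q ^ length S w •
        p.sum (fun y f => LaurentPolynomial.invert (Polynomial.toLaurent f) •
          Ring.inverse (heckeT S y⁻¹)) =
      p.sum (fun y f => Polynomial.toLaurent f • heckeT S y)

open Classical in
/-- The Kazhdan-Lusztig polynomial `P_{y,w}`: the value at `y` of the family above, which exists
and is unique for every `w` when `(W, S)` is a Coxeter system. -/
def klPoly (y w : W) : ℤ[X] :=
  if h : ∃ p : W →₀ ℤ[X], IsKLFamily S w p then h.choose y else 0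

end CoxeterPair

/-! ### The extended affine symmetric group -/

/-- The extended affine symmetric group: permutations `w` of `ℤ` with `w (i + d) = w i + d`. -/
def ExtAffSymm (d : ℕ) : Subgroup (Equiv.Perm ℤ) where
  carrier := {w | ∀ i : ℤ, w (i + d) = w i + d}
  mul_mem' := by
    intro u v hu hv i
    simp only [Set.mem_ofPred_eq] at hu hv
    simp [Equiv.Perm.mul_apply, hv i, hu (v i)]
  one_mem' := by intro i; simp
  inv_mem' := by
    intro w hw i
    simp only [Set.mem_ofPred_eq] at hw
    apply w.injective
    simp [hw]

namespace ExtAffSymm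

variable {d : ℕ}

theorem apply_add (w : ExtAffSymm d) (i : ℤ) : w.1 (i + d) = w.1 i + d := w.2 i

theorem apply_add_mul (w : ExtAffSymm d) (i k : ℤ) : w.1 (i + k * d) = w.1 i + k * d := by
  induction k using Int.induction_on with
  | zero => simp
  | succ k ih =>
    have := apply_add w (i + k * d)
    rw [ih] at this
    rw [show i + ((k : ℤ) + 1) * d = i + k * d + d by ring, this]; ring
  | pred k ih =>
    have := apply_add w (i + (-(k : ℤ) - 1) * d)
    rw [show i + (-(k : ℤ) - 1) * d + d = i + -(k : ℤ) * d by ring, ih] at this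
    linarith

theorem cast_apply_eq_iff (w : ExtAffSymm d) (i j : ℤ) :
    (w.1 i : ZMod d) = (w.1 j : ZMod d) ↔ (i : ZMod d) = (j : ZMod d) := by
  have key : ∀ (v : ExtAffSymm d) (i j : ℤ), (i : ZMod d) = (j : ZMod d) →
      (v.1 i : ZMod d) = (v.1 j : ZMod d) := by
    intro v i j h
    rw [ZMod.intCast_eq_intCast_iff_dvd_sub] at h
    obtain ⟨k, hk⟩ := h
    have : j = i + k * d := by linarith [mul_comm k (d : ℤ)]
    rw [this, apply_add_mul]; simp
  refine ⟨fun h => ?_, key w i j⟩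
  have := key w⁻¹ _ _ h
  simpa using this

theorem sum_cast_Icc [NeZero d] {M : Type*} [AddCommMonoid M] (g : ZMod d → M) :
    ∑ i ∈ Finset.Icc (1 : ℤ) d, g (i : ZMod d) = ∑ c : ZMod d, g c := by
  refine Finset.sum_bij (fun i _ => (i : ZMod d)) (by simp) ?_ ?_ (by simp)
  · intro i hi j hj h
    rw [ZMod.intCast_eq_intCast_iff_dvd_sub] at h
    rw [Finset.mem_Icc] at hi hj
    have := Int.eq_zero_of_abs_lt_dvd h (by rw [abs_lt]; constructor <;> linarith)
    linarith
  · intro c _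
    have hd : (0 : ℤ) < d := by exact_mod_cast Nat.pos_of_ne_zero (NeZero.ne d)
    refine ⟨((c.val : ℤ) - 1) % d + 1, ?_, ?_⟩
    · rw [Finset.mem_Icc]
      have h1 := Int.emod_nonneg ((c.val : ℤ) - 1) hd.ne'
      have h2 := Int.emod_lt_of_pos ((c.val : ℤ) - 1) hd
      constructor <;> linarith
    · rw [Int.cast_add, ZMod.intCast_mod]
      simp

theorem sum_window_apply {M : Type*} [AddCommMonoid M] (w : ExtAffSymm d) (g : ZMod d → M) :
    ∑ i ∈ Finset.Icc (1 : ℤ) d, g (w.1 i : ZMod d) =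
      ∑ i ∈ Finset.Icc (1 : ℤ) d, g (i : ZMod d) := by
  rcases Nat.eq_zero_or_pos d with rfl | hd
  · simp
  have : NeZero d := ⟨hd.ne'⟩
  have hc : ∀ i : ℤ, (((i : ZMod d).val : ℤ) : ZMod d) = (i : ZMod d) := by simp
  let f : ZMod d → ZMod d := fun c => (w.1 (c.val : ℤ) : ZMod d)
  have hf : ∀ i : ℤ, (w.1 i : ZMod d) = f (i : ZMod d) := fun i =>
    (cast_apply_eq_iff w _ _).2 (hc i).symm
  have hinj : Function.Injective f := by
    intro a b h
    have := (cast_apply_eq_iff w _ _).1 h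
    simpa using this
  calc ∑ i ∈ Finset.Icc (1 : ℤ) d, g (w.1 i : ZMod d)
      = ∑ i ∈ Finset.Icc (1 : ℤ) d, g (f (i : ZMod d)) := by simp only [hf]
    _ = ∑ c : ZMod d, g (f c) := sum_cast_Icc (fun c => g (f c))
    _ = ∑ c : ZMod d, g c := Function.Bijective.sum_comp (Finite.injective_iff_bijective.1 hinj) g
    _ = _ := (sum_cast_Icc g).symm

/-- `∑_{i=1}^d w(i) - ∑_{i=1}^d i`. -/
def excess (w : ExtAffSymm d) : ℤ :=
  ∑ i ∈ Finset.Icc (1 : ℤ) d, w.1 i - ∑ i ∈ Finset.Icc (1 : ℤ) d, i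

theorem excess_mul (u v : ExtAffSymm d) : excess (u * v) = excess u + excess v := by
  rcases Nat.eq_zero_or_pos d with rfl | hd
  · simp [excess]
  have : NeZero d := ⟨hd.ne'⟩
  have hper : ∀ i : ℤ, u.1 i - i = u.1 ((i : ZMod d).val : ℤ) - ((i : ZMod d).val : ℤ) := by
    intro i
    have h : (((i : ZMod d).val : ℤ) : ZMod d) = (i : ZMod d) := by simp
    rw [ZMod.intCast_eq_intCast_iff_dvd_sub] at h
    obtain ⟨k, hk⟩ := h
    have hi : i = ((i : ZMod d).val : ℤ) + k * d := by linarith [mul_comm k (d : ℤ)]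
    have := apply_add_mul u ((i : ZMod d).val : ℤ) k
    rw [← hi] at this
    linarith
  have h := sum_window_apply v (fun c : ZMod d => u.1 (c.val : ℤ) - (c.val : ℤ))
  simp only [← hper] at h
  simp only [Finset.sum_sub_distrib] at h
  have e : ∀ i, (u * v).1 i = u.1 (v.1 i) := fun i => rfl
  simp only [excess, e]
  linarith

theorem dvd_excess (w : ExtAffSymm d) : (d : ℤ) ∣ excess w := by
  refine (CharP.intCast_eq_zero_iff (ZMod d) d (excess w)).1 ?_
  have := sum_window_apply w (fun c : ZMod d => c)
  simp only [excess]
  push_cast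
  rw [this, sub_self]

/-- The integer `a(w) = (∑_{i=1}^d w(i) - ∑_{i=1}^d i) / d` (the division is exact). -/
def a (w : ExtAffSymm d) : ℤ := excess w / d

/-- The shift `τ`, sending `i` to `i + 1`. -/
def tau (d : ℕ) : ExtAffSymm d :=
  ⟨Equiv.addRight 1, fun i => by simp [add_right_comm]⟩

theorem excess_tau : excess (tau d) = d := by
  simp [excess, tau, Finset.sum_add_distrib]

theorem excess_tau_zpow (k : ℤ) : excess (tau d ^ k) = k * d := by
  let φ : ExtAffSymm d →* Multiplicative ℤ :=
    MonoidHom.mk' (fun w => Multiplicative.ofAdd (excess w)) (fun u v => by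
      rw [excess_mul]; rfl)
  have h := map_zpow φ (tau d) k
  have h2 : excess (tau d ^ k) = k • excess (tau d) := congrArg Multiplicative.toAdd h
  rw [h2, excess_tau]; simp

end ExtAffSymm

/-- The affine symmetric group: the `w` in the extended affine symmetric group with
`∑_{i=1}^d w(i) = ∑_{i=1}^d i`. -/
def AffSymm (d : ℕ) : Subgroup (ExtAffSymm d) where
  carrier := {w | ∑ i ∈ Finset.Icc (1 : ℤ) d, w.1 i = ∑ i ∈ Finset.Icc (1 : ℤ) d, i}
  mul_mem' := by
    intro u v hu hv
    have := ExtAffSymm.excess_mul u v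
    simp only [Set.mem_ofPred_eq, ExtAffSymm.excess] at *
    linarith
  one_mem' := by simp
  inv_mem' := by
    intro u hu
    have := ExtAffSymm.excess_mul u u⁻¹
    simp only [mul_inv_cancel, Set.mem_ofPred_eq, ExtAffSymm.excess, OneMemClass.coe_one,
      Equiv.Perm.coe_one, id_eq] at *
    linarith

namespace AffSymm

variable {d : ℕ}

/-- The underlying function of `s_i`. -/
def simpleFun (d : ℕ) (i j : ℤ) : ℤ :=
  if j ≡ i [ZMOD d] then j + 1 else if j ≡ i + 1 [ZMOD d] then j - 1 else j

theorem simpleFun_simpleFun (hd : 2 ≤ d) (i j : ℤ) :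
    simpleFun d i (simpleFun d i j) = j := by
  have hne : ∀ x : ℤ, x ≡ i [ZMOD d] → ¬ x ≡ i + 1 [ZMOD d] := by
    intro x h1 h2
    have h3 := h1.symm.trans h2
    have h4 : (d : ℤ) ∣ 1 := by simpa using (Int.modEq_iff_dvd.1 h3)
    have := Int.le_of_dvd one_pos h4
    omega
  unfold simpleFun
  by_cases h1 : j ≡ i [ZMOD d]
  · have h2 : j + 1 ≡ i + 1 [ZMOD d] := h1.add_right 1
    have h3 : ¬ j + 1 ≡ i [ZMOD d] := fun h => hne _ h h2
    simp [h1, h2, h3]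
  · by_cases h2 : j ≡ i + 1 [ZMOD d]
    · have h3 : j - 1 ≡ i [ZMOD d] := by simpa using h2.sub_right 1
      simp [h1, h2, h3]
    · simp [h1, h2]

theorem simpleFun_add (i j : ℤ) : simpleFun d i (j + d) = simpleFun d i j + d := by
  have h : ∀ x : ℤ, j + d ≡ x [ZMOD d] ↔ j ≡ x [ZMOD d] := fun x => by
    simp [Int.ModEq]
  unfold simpleFun
  simp only [h]
  split_ifs <;> ring

/-- `s_i` as an element of the extended affine symmetric group. -/
def simpleExt (hd : 2 ≤ d) (i : ℤ) : ExtAffSymm d :=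
  ⟨⟨simpleFun d i, simpleFun d i, simpleFun_simpleFun hd i, simpleFun_simpleFun hd i⟩,
    simpleFun_add i⟩

theorem excess_simpleExt (hd : 2 ≤ d) (i : ℤ) : ExtAffSymm.excess (simpleExt hd i) = 0 := by
  have h : simpleExt hd i * simpleExt hd i = 1 :=
    Subtype.ext (Equiv.ext (simpleFun_simpleFun hd i))
  have h1 := ExtAffSymm.excess_mul (simpleExt hd i) (simpleExt hd i)
  rw [h] at h1
  have h2 : ExtAffSymm.excess (1 : ExtAffSymm d) = 0 := by simp [ExtAffSymm.excess]
  omega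

/-- The simple reflection `s_i`, which adds `1` to the integers congruent to `i` mod `d`, subtracts
`1` from those congruent to `i + 1`, and fixes the others (it is defined for `d ≥ 2`). -/
def simple (hd : 2 ≤ d) (i : ℤ) : AffSymm d :=
  ⟨simpleExt hd i, by
    have := excess_simpleExt hd i
    simp only [ExtAffSymm.excess] at this
    show _ = _
    linarith⟩

/-- The set of Coxeter generators of the affine symmetric group: all the `s_i` if `d ≥ 2`, and the
empty set if `d = 1` (when the group is trivial). -/
def gens (d : ℕ) : Set (AffSymm d) := {s | ∃ (hd : 2 ≤ d) (i : ℤ), s = simple hd i}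

end AffSymm

namespace ExtAffSymm

variable {d : ℕ}

/-- The component `τ^{-a(w)} w` of `w` in the affine symmetric group. -/
def affPart (w : ExtAffSymm d) : AffSymm d :=
  ⟨tau d ^ (-a w) * w, by
    have h := excess_mul (tau d ^ (-a w)) w
    rw [excess_tau_zpow] at h
    have h2 : a w * d = excess w := Int.ediv_mul_cancel (dvd_excess w)
    simp only [excess] at h h2
    show _ = _
    linarith⟩

/-- The length function of the extended affine symmetric group. -/
def length (w : ExtAffSymm d) : ℕ := CoxeterPair.length (AffSymm.gens d) (affPart w)

/-- The Bruhat order of the extended affine symmetric group. -/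
def BruhatLE (y w : ExtAffSymm d) : Prop :=
  a y = a w ∧ CoxeterPair.BruhatLE (AffSymm.gens d) (affPart y) (affPart w)

/-- The Kazhdan-Lusztig polynomials of the extended affine symmetric group. -/
def klPoly (y w : ExtAffSymm d) : ℤ[X] :=
  if a y = a w then CoxeterPair.klPoly (AffSymm.gens d) (affPart y) (affPart w) else 0

/-- The Bruhat interval `[y, w]`. -/
def interval (y w : ExtAffSymm d) : Set (ExtAffSymm d) := {x | BruhatLE y x ∧ BruhatLE x w}

/-- `inv_i(w)`, the number of `i' < i` with `w(i') > w(i)` (there are finitely many). -/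
def invBelow (i : ℤ) (w : ExtAffSymm d) : ℕ := {i' : ℤ | i' < i ∧ w.1 i < w.1 i'}.ncard

/-- `Inv_i(w)`, the number of `i' > i` with `w(i') < w(i)` (there are finitely many). -/
def invAbove (i : ℤ) (w : ExtAffSymm d) : ℕ := {i' : ℤ | i < i' ∧ w.1 i' < w.1 i}.ncard

/-- `i` is cancellable for the interval `[y, w]`. -/
structure Cancellable (i : ℤ) (y w : ExtAffSymm d) : Prop where
  le : BruhatLE y w
  apply_eq : y.1 i = w.1 i
  invBelow_eq : invBelow i y = invBelow i w
  invAbove_eq : invAbove i y = invAbove i w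

/-- A choice of an order-preserving bijection `σ_c : ℤ \ c → ℤ` for every congruence class `c`
mod `d`. -/
abbrev Relabelling (d : ℕ) : Type := (c : ZMod d) → {x : ℤ // (x : ZMod d) ≠ c} ≃o ℤ

theorem relabel_add (σ : Relabelling d) (c : ZMod d) (x y : {x : ℤ // (x : ZMod d) ≠ c})
    (h : y.1 = x.1 + d) : σ c y = σ c x + ((d - 1 : ℕ) : ℤ) := by
  rcases Nat.eq_zero_or_pos d with rfl | hd
  · have : y = x := Subtype.ext (by simpa using h)
    simp [this]
  have : NeZero d := ⟨hd.ne'⟩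
  have hle : σ c x ≤ σ c y := (σ c).monotone (Subtype.coe_le_coe.1 (by rw [h]; omega))
  have hcard : (Finset.Ico (σ c x) (σ c y)).card = (Finset.univ.erase c : Finset (ZMod d)).card := by
    have hmem : ∀ k : ℤ, k ∈ Finset.Ico (σ c x) (σ c y) ↔
        x.1 ≤ ((σ c).symm k).1 ∧ ((σ c).symm k).1 < x.1 + d := by
      intro k
      rw [Finset.mem_Ico, ← h, Subtype.coe_le_coe, Subtype.coe_lt_coe, (σ c).le_symm_apply,
        (σ c).symm_apply_lt]
    refine Finset.card_bij (fun k _ => (((σ c).symm k).1 : ZMod d)) ?_ ?_ ?_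
    · intro k _
      simpa using ((σ c).symm k).2
    · intro k hk l hl hkl
      rw [hmem] at hk hl
      rw [ZMod.intCast_eq_intCast_iff_dvd_sub] at hkl
      have := Int.eq_zero_of_abs_lt_dvd hkl (by rw [abs_lt]; constructor <;> linarith)
      exact (σ c).symm.injective (Subtype.ext (by linarith))
    · intro e he
      have hz : ((x.1 + ((e - (x.1 : ZMod d)).val : ℤ) : ℤ) : ZMod d) = e := by simp
      refine ⟨σ c ⟨x.1 + ((e - (x.1 : ZMod d)).val : ℤ), ?_⟩, ?_, ?_⟩
      · rw [hz]; simpa using he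
      · rw [hmem, OrderIso.symm_apply_apply]
        have := ZMod.val_lt (e - (x.1 : ZMod d))
        show x.1 ≤ x.1 + ((e - (x.1 : ZMod d)).val : ℤ) ∧
          x.1 + ((e - (x.1 : ZMod d)).val : ℤ) < x.1 + d
        omega
      · rw [OrderIso.symm_apply_apply]
        exact hz
  rw [Int.card_Ico, Finset.card_erase_of_mem (Finset.mem_univ c), Finset.card_univ,
    ZMod.card] at hcard
  omega

/-- The permutation `σ_{w(i)} ∘ w ∘ σ_i⁻¹` of `ℤ`, where `w` is restricted to a bijection from the
integers not congruent to `i` to the integers not congruent to `w(i)`. -/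
def cancelPerm (σ : Relabelling d) (i : ℤ) (w : ExtAffSymm d) : Equiv.Perm ℤ :=
  ((σ (i : ZMod d)).symm.toEquiv.trans
    (w.1.subtypeEquiv fun x => not_congr (cast_apply_eq_iff w x i).symm)).trans
      (σ (w.1 i : ZMod d)).toEquiv

/-- The result `w^î` of cancelling `i` from `w`, an element of the extended affine symmetric group
for `d - 1`. -/
def cancel (σ : Relabelling d) (i : ℤ) (w : ExtAffSymm d) : ExtAffSymm (d - 1) :=
  ⟨cancelPerm σ i w, by
    intro k
    let x : {x : ℤ // (x : ZMod d) ≠ (i : ZMod d)} := (σ (i : ZMod d)).symm k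
    let x' : {x : ℤ // (x : ZMod d) ≠ (i : ZMod d)} := ⟨x.1 + d, by simpa using x.2⟩
    have hx : (σ (i : ZMod d)).symm (k + ((d - 1 : ℕ) : ℤ)) = x' := by
      rw [OrderIso.symm_apply_eq, relabel_add σ _ x x' rfl]
      simp [x]
    show σ (w.1 i : ZMod d) _ = σ (w.1 i : ZMod d) _ + _
    refine relabel_add σ _ _ _ ?_
    show w.1 ((σ (i : ZMod d)).symm (k + ((d - 1 : ℕ) : ℤ))).1 = w.1 x.1 + d
    rw [hx]
    exact apply_add w x.1⟩

end ExtAffSymm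

end

/-! A length-increasing affine transposition never decreases `countGE x p v`, the number of
positions below `p` with value at least `v`. Cancellability makes these counts equal for y and w at
the four corners around the point (i, y(i)). They are then the same for every x in between, and they
determine x(i) and inv_i(x); `countLE` does the same for Inv_i. This is
`Cancellable.apply_eq_of_mem`.

Hence no step of a Bruhat chain inside [y,w] involves the class of i, and the chain descends to the
cancelled permutations (`IsCancel.exists_of_le`). Conversely every chain of cancelled permutations
lifts with the value at i unchanged (`IsCancel.exists_lift`). Together these give the isomorphism of
posets.

Lengths and R-polynomials are compared by induction on length, removing one descent at a time.
`Skip` and `IsCancel` allow any increasing parametrisation of the remaining positions. A descent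
involving i can therefore be removed by moving the omitted position, which leaves the cancelled
permutation unchanged and costs one inversion of i; any other descent is removed on both sides. So
the length drops by inv_i + Inv_i (`IsCancel.length_eq`). For R_{x,y} (`IsCancel.rPoly_eq`), a
descent s of y that involves i is also a descent of x: otherwise xs would lie in [x,y] with another
value at i. Thus R_{x,y} = R_{xs,ys}, and for the other descents the same recursion holds on both
sides.

Finally P is determined by R through ∑ R_{u,x} P_{x,v} = q^{ℓ(v)-ℓ(u)} P_{u,v}(q⁻¹) and the degree
bound. As the posets, the length differences and the R-polynomials agree, so do the Kazhdan-Lusztig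
polynomials (`IsCancel.klPoly_eq`).

The Hecke algebra is given by generators and relations, and `klPoly` is 0 when no family exists. So
the independence of the T_w (`toHecke_injective`) and the existence of the polynomials
(`exists_isKLFamily`) are proved first, for any pair satisfying `IsCoxeterPair`. The affine
symmetric group qualifies because a transposition of a < b increases the length of u exactly when
u(a) < u(b). -/

noncomputable section

/-! ### Length and the exchange condition. -/

namespace CoxeterPair

variable {W : Type*} [Group W] {S : Set W}

/-- The properties of a Coxeter system that the theory of Kazhdan-Lusztig polynomials uses. -/
structure IsCoxeterPair (S : Set W) : Prop where
  mul_self : ∀ s ∈ S, s * s = 1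
  exists_word : ∀ w : W, ∃ l : List W, (∀ s ∈ l, s ∈ S) ∧ l.prod = w
  length_mul_ne : ∀ w : W, ∀ s ∈ S, length S (w * s) ≠ length S w
  -- The exchange condition in terms of reflections: right multiplication by `s` preserves every
  -- ascent along a reflection other than `s`.
  length_lt_mul : ∀ u t s : W, IsReflection S t → s ∈ S → t ≠ s →
    length S u < length S (u * t) → length S (u * s) < length S (u * t * s)

theorem length_prod_le (l : List W) (hl : ∀ s ∈ l, s ∈ S) : length S l.prod ≤ l.length :=
  Nat.sInf_le ⟨l, hl, rfl, rfl⟩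

theorem length_one : length S (1 : W) = 0 :=
  Nat.le_zero.1 (length_prod_le (S := S) ([] : List W) (by simp))

theorem length_le_one {s : W} (hs : s ∈ S) : length S s ≤ 1 := by
  simpa using length_prod_le (S := S) [s] (by simpa using hs)

theorem isReflection_of_mem {s : W} (hs : s ∈ S) : IsReflection S s := ⟨s, hs, 1, by simp⟩

theorem IsReflection.conj {t : W} (ht : IsReflection S t) (g : W) :
    IsReflection S (g * t * g⁻¹) := by
  obtain ⟨s, hs, k, rfl⟩ := ht
  exact ⟨s, hs, g * k, by group⟩

namespace IsCoxeterPair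

variable (h : IsCoxeterPair S)
include h

theorem inv_eq {s : W} (hs : s ∈ S) : s⁻¹ = s := inv_eq_of_mul_eq_one_left (h.mul_self s hs)

theorem mul_mul_cancel {s : W} (hs : s ∈ S) (w : W) : w * s * s = w := by
  rw [mul_assoc, h.mul_self s hs, mul_one]

theorem exists_reduced (w : W) :
    ∃ l : List W, (∀ s ∈ l, s ∈ S) ∧ l.prod = w ∧ l.length = length S w := by
  obtain ⟨l, hl, hw⟩ := h.exists_word w
  exact Nat.sInf_mem (s := {n | ∃ l : List W, (∀ s ∈ l, s ∈ S) ∧ l.prod = w ∧ l.length = n})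
    ⟨_, l, hl, hw, rfl⟩

theorem length_eq_zero {w : W} (hw : length S w = 0) : w = 1 := by
  obtain ⟨l, -, hl, hn⟩ := h.exists_reduced w
  rw [hw, List.length_eq_zero_iff] at hn
  simpa [hn] using hl.symm

theorem length_mul_le (u v : W) : length S (u * v) ≤ length S u + length S v := by
  obtain ⟨l, hl, rfl, hn⟩ := h.exists_reduced u
  obtain ⟨l', hl', rfl, hn'⟩ := h.exists_reduced v
  rw [← hn, ← hn', ← List.prod_append, ← List.length_append]
  refine length_prod_le _ fun s hs => ?_
  rcases List.mem_append.1 hs with hs | hs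
  exacts [hl s hs, hl' s hs]

theorem length_inv_le (w : W) : length S w⁻¹ ≤ length S w := by
  obtain ⟨l, hl, rfl, hn⟩ := h.exists_reduced w
  have hmap : l.map (fun x => x⁻¹) = l := by
    conv_rhs => rw [← List.map_id l]
    exact List.map_congr_left fun s hs => h.inv_eq (hl s hs)
  rw [← hn, List.prod_inv_reverse, hmap, ← List.length_reverse]
  exact length_prod_le _ fun s hs => hl s (List.mem_reverse.1 hs)

theorem length_inv (w : W) : length S w⁻¹ = length S w :=
  le_antisymm (h.length_inv_le w) (by simpa using h.length_inv_le w⁻¹)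

theorem length_mul_gen {s : W} (hs : s ∈ S) (w : W) :
    length S (w * s) = length S w + 1 ∨ length S (w * s) + 1 = length S w := by
  have h1 := h.length_mul_le w s
  have h2 := h.length_mul_le (w * s) s
  rw [h.mul_mul_cancel hs] at h2
  have h3 := length_le_one hs
  have h4 := h.length_mul_ne w s hs
  omega

theorem length_gen {s : W} (hs : s ∈ S) : length S s = 1 := by
  have := h.length_mul_gen hs 1
  rw [one_mul, length_one] at this
  omega

theorem length_gen_mul {s : W} (hs : s ∈ S) (w : W) :
    length S (s * w) = length S w + 1 ∨ length S (s * w) + 1 = length S w := by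
  have := h.length_mul_gen hs w⁻¹
  rw [h.length_inv, ← h.length_inv (w⁻¹ * s), mul_inv_rev, inv_inv, h.inv_eq hs] at this
  exact this

theorem exists_descent {w : W} (hw : w ≠ 1) : ∃ s ∈ S, length S (w * s) + 1 = length S w := by
  obtain ⟨l, hl, hw', hn⟩ := h.exists_reduced w
  rcases List.eq_nil_or_concat l with rfl | ⟨l', s, rfl⟩
  · exact absurd hw'.symm (by simpa using hw)
  · have hs : s ∈ S := hl s (by simp)
    refine ⟨s, hs, ?_⟩
    have hws : w * s = l'.prod := by
      rw [← hw', List.concat_eq_append, List.prod_append, List.prod_singleton,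
        h.mul_mul_cancel hs]
    have h1 := length_prod_le (S := S) l' fun t ht => hl t (by simp [ht])
    have h2 := h.length_mul_gen hs w
    rw [hws] at h2 ⊢
    simp at hn
    omega

theorem right_induction {P : W → Prop} (one : P 1)
    (step : ∀ w, ∀ s ∈ S, length S (w * s) = length S w + 1 → P w → P (w * s)) (w : W) : P w := by
  induction hn : length S w generalizing w with
  | zero => rw [h.length_eq_zero hn]; exact one
  | succ n ih =>
    obtain ⟨s, hs, hws⟩ := h.exists_descent (w := w) (by rintro rfl; simp [length_one] at hn)
    have := step (w * s) s hs (by rw [h.mul_mul_cancel hs, hws]) (ih _ (by omega))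
    rwa [h.mul_mul_cancel hs] at this

/-- Since `u t s = (u s)(s t s)`, the converse is the exchange condition for `u s` and the
reflection `s t s`. -/
theorem length_lt_mul_iff {u t s : W} (ht : IsReflection S t) (hs : s ∈ S) (hts : t ≠ s) :
    length S u < length S (u * t) ↔ length S (u * s) < length S (u * t * s) := by
  refine ⟨h.length_lt_mul u t s ht hs hts, fun hlt => ?_⟩
  have hc : u * t * s = u * s * (s * t * s⁻¹) := by
    rw [h.inv_eq hs, ← mul_assoc, ← mul_assoc, h.mul_mul_cancel hs]
  rw [hc] at hlt
  have := h.length_lt_mul _ _ s (ht.conj s) hs (fun e => hts (by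
    rw [h.inv_eq hs] at e
    have e' := congrArg (fun x => s * x * s) e
    rw [h.mul_mul_cancel hs, ← mul_assoc, ← mul_assoc, h.mul_mul_cancel hs, h.mul_self s hs,
      one_mul] at e'
    exact e')) hlt
  rwa [h.mul_mul_cancel hs, ← hc, h.mul_mul_cancel hs] at this

/-- If `s w ≠ w t` for generators `s`, `t`, then `s` is a left ascent of `w` if and only if it is
one of `w t`. -/
theorem left_ascent_iff {s t w : W} (hs : s ∈ S) (ht : t ∈ S) (hne : s * w ≠ w * t) :
    length S w < length S (s * w) ↔ length S (w * t) < length S (s * (w * t)) := by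
  -- Left multiplication of `w` by `s` is right multiplication by the reflection `w⁻¹ s w`, which
  -- differs from `t` by `hne`.
  have hr : IsReflection S (w⁻¹ * s * w) := by simpa using (isReflection_of_mem hs).conj w⁻¹
  have := h.length_lt_mul_iff (u := w) hr ht (fun e => hne (by rw [← e]; group))
  rwa [show w * (w⁻¹ * s * w) = s * w by group, mul_assoc] at this

/-- If `s w ≠ w t` for generators `s`, `t`, then `t` is a right ascent of `w` if and only if it is
one of `s w`. -/
theorem right_ascent_iff {s t w : W} (hs : s ∈ S) (ht : t ∈ S) (hne : s * w ≠ w * t) :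
    length S w < length S (w * t) ↔ length S (s * w) < length S (s * w * t) := by
  have ht' := h.inv_eq ht
  have hs' := h.inv_eq hs
  have := h.left_ascent_iff (w := w⁻¹) ht hs (fun e => hne (by
    have e' := congrArg (fun x => x⁻¹) e
    simp only [mul_inv_rev, inv_inv, ht', hs'] at e'
    exact e'.symm))
  rw [← h.length_inv (t * w⁻¹), ← h.length_inv (w⁻¹ * s), ← h.length_inv (t * (w⁻¹ * s)),
    h.length_inv w] at this
  simpa only [mul_inv_rev, inv_inv, ht', hs'] using this

end IsCoxeterPair

/-! ### The Bruhat order and the lifting property. -/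

theorem BruhatLE.refl (u : W) : BruhatLE S u u := Relation.ReflTransGen.refl

theorem BruhatLE.trans {u v w : W} (huv : BruhatLE S u v) (hvw : BruhatLE S v w) :
    BruhatLE S u w := Relation.ReflTransGen.trans huv hvw

theorem BruhatLE.length_le {u v : W} (huv : BruhatLE S u v) : length S u ≤ length S v := by
  induction huv with
  | refl => exact le_rfl
  | tail _ hbc ih =>
    obtain ⟨t, -, -, hlt⟩ := hbc
    exact ih.trans hlt.le

theorem BruhatLE.eq_of_length_le {u v : W} (huv : BruhatLE S u v)
    (hl : length S v ≤ length S u) : u = v := by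
  cases huv with
  | refl => rfl
  | tail hab hbc =>
    obtain ⟨t, -, -, hlt⟩ := hbc
    have := BruhatLE.length_le hab
    omega

theorem BruhatLE.length_lt {u v : W} (huv : BruhatLE S u v) (hne : u ≠ v) :
    length S u < length S v := by
  by_contra hc
  exact hne (huv.eq_of_length_le (not_lt.1 hc))

theorem bruhatLE_mul {u t : W} (ht : IsReflection S t) (hlt : length S u < length S (u * t)) :
    BruhatLE S u (u * t) := Relation.ReflTransGen.single ⟨t, ht, rfl, hlt⟩

namespace IsCoxeterPair

variable (h : IsCoxeterPair S)
include h

theorem mul_le_of_length_lt {u s : W} (hs : s ∈ S) (hlt : length S (u * s) < length S u) :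
    BruhatLE S (u * s) u := by
  have := bruhatLE_mul (u := u * s) (isReflection_of_mem hs) (by rwa [h.mul_mul_cancel hs])
  rwa [h.mul_mul_cancel hs] at this

/-- Conjugation by `s` turns the step from `u` to `u t` into one from `u s` along `s t s`, and the
exchange condition keeps it ascending. -/
theorem edge_mul {u t s : W} (ht : IsReflection S t) (hs : s ∈ S)
    (hlt : length S u < length S (u * t)) :
    t = s ∨ BruhatLE S (u * s) (u * t * s) := by
  by_cases hts : t = s
  · exact Or.inl hts
  · right
    have hc : u * t * s = u * s * (s * t * s⁻¹) := by
      rw [h.inv_eq hs, ← mul_assoc, ← mul_assoc, h.mul_mul_cancel hs]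
    have := h.length_lt_mul u t s ht hs hts hlt
    rw [hc] at this ⊢
    exact bruhatLE_mul (ht.conj s) this

/-- Each step of a chain is either carried along by `edge_mul` or is multiplication by `s` itself.
With `le_mul_or`, this yields the lifting property without subwords. -/
theorem mul_le_or {u v s : W} (hs : s ∈ S) (huv : BruhatLE S u v) :
    BruhatLE S (u * s) v ∨ BruhatLE S (u * s) (v * s) := by
  induction huv with
  | refl => exact Or.inr (BruhatLE.refl _)
  | tail _ hbc ih =>
    obtain ⟨t, ht, rfl, hlt⟩ := hbc
    rcases ih with ih | ih
    · exact Or.inl (ih.trans (bruhatLE_mul ht hlt))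
    · rcases h.edge_mul ht hs hlt with rfl | he
      · exact Or.inl ih
      · exact Or.inr (ih.trans he)

theorem le_mul_or {u v s : W} (hs : s ∈ S) (huv : BruhatLE S u v) :
    BruhatLE S u (v * s) ∨ BruhatLE S (u * s) (v * s) := by
  induction huv using Relation.ReflTransGen.head_induction_on with
  | refl => exact Or.inr (BruhatLE.refl _)
  | head hab _ ih =>
    obtain ⟨t, ht, rfl, hlt⟩ := hab
    rcases ih with ih | ih
    · exact Or.inl ((bruhatLE_mul ht hlt).trans ih)
    · rcases h.edge_mul ht hs hlt with rfl | he
      · rw [h.mul_mul_cancel hs] at ih; exact Or.inl ih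
      · exact Or.inr (he.trans ih)

/-- The lifting property, for a generator that is a descent of both elements. -/
theorem mul_le_mul {u v s : W} (hs : s ∈ S) (huv : BruhatLE S u v)
    (hu : length S (u * s) < length S u) : BruhatLE S (u * s) (v * s) := by
  rcases h.le_mul_or hs huv with h1 | h1
  · exact (h.mul_le_of_length_lt hs hu).trans h1
  · exact h1

/-- The lifting property, for a descent of the larger element. -/
theorem mul_le {u v s : W} (hs : s ∈ S) (huv : BruhatLE S u v)
    (hv : length S (v * s) < length S v) : BruhatLE S (u * s) v := by
  rcases h.mul_le_or hs huv with h1 | h1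
  · exact h1
  · exact h1.trans (h.mul_le_of_length_lt hs hv)

/-- An element of length n + 1 is one of length n times a generator. Lower Bruhat intervals are
therefore finite, as finitely supported Kazhdan-Lusztig families require. -/
theorem finite_length_le (hS : S.Finite) (n : ℕ) : {w : W | length S w ≤ n}.Finite := by
  induction n with
  | zero => exact (Set.finite_singleton 1).subset fun w hw => h.length_eq_zero (Nat.le_zero.1 hw)
  | succ n ih =>
    refine ((ih.image2 (fun w s => w * s) hS).union ih).subset fun w hw => ?_
    by_cases hw1 : w = 1
    · right; subst hw1; simp [length_one]
    · obtain ⟨s, hs, hl⟩ := h.exists_descent hw1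
      refine Or.inl ⟨w * s, ?_, s, hs, h.mul_mul_cancel hs w⟩
      simp only [Set.mem_ofPred_eq] at hw ⊢
      omega

theorem finite_bruhatLE (hS : S.Finite) (w : W) : {u : W | BruhatLE S u w}.Finite :=
  (h.finite_length_le hS (length S w)).subset fun _ hu => BruhatLE.length_le hu

end IsCoxeterPair

/-! ### The regular representation of the Hecke algebra. -/

theorem finsupp_hom_ext {ι M : Type*} [AddCommMonoid M] [Module ℤ[T;T⁻¹] M]
    {f g : (ι →₀ ℤ[T;T⁻¹]) →ₗ[ℤ[T;T⁻¹]] M}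
    (hfg : ∀ w, f (Finsupp.single w 1) = g (Finsupp.single w 1)) : f = g := by
  refine Finsupp.lhom_ext fun w c => ?_
  rw [← mul_one c, ← smul_eq_mul, ← Finsupp.smul_single, map_smul, map_smul, hfg]

theorem mul_self_of_quad {R H : Type*} [CommRing R] [Ring H] [Algebra R H] (c : R) (x : H)
    (hx : (x + 1) * (x - algebraMap R H c) = 0) : x * x = c • 1 + (c - 1) • x := by
  rw [Algebra.algebraMap_eq_smul_one, mul_sub, add_mul, one_mul, mul_smul_comm, mul_one, smul_add,
    sub_eq_zero] at hx
  rw [sub_smul, one_smul, ← add_sub_assoc, eq_sub_iff_add_eq, hx, add_comm]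

variable (S) in
/-- Right multiplication by `T_s` on the free module with basis `W`. -/
def rightStep (s : W) : Module.End ℤ[T;T⁻¹] (W →₀ ℤ[T;T⁻¹]) :=
  Finsupp.linearCombination ℤ[T;T⁻¹] fun w =>
    if length S w < length S (w * s) then Finsupp.single (w * s) 1
    else q • Finsupp.single (w * s) 1 + (q - 1) • Finsupp.single w 1

variable (S) in
/-- Left multiplication by `T_s` on the free module with basis `W`. -/
def leftStep (s : W) : Module.End ℤ[T;T⁻¹] (W →₀ ℤ[T;T⁻¹]) :=
  Finsupp.linearCombination ℤ[T;T⁻¹] fun w =>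
    if length S w < length S (s * w) then Finsupp.single (s * w) 1
    else q • Finsupp.single (s * w) 1 + (q - 1) • Finsupp.single w 1

variable (S) in
/-- The inverse of `rightStep S s`, for a generator `s`. -/
def rightStepInv (s : W) : Module.End ℤ[T;T⁻¹] (W →₀ ℤ[T;T⁻¹]) :=
  (LaurentPolynomial.T (-1) : ℤ[T;T⁻¹]) • rightStep S s +
    (LaurentPolynomial.T (-1) - 1 : ℤ[T;T⁻¹]) • 1

theorem rightStep_single (s w : W) : rightStep S s (Finsupp.single w 1) =
    if length S w < length S (w * s) then Finsupp.single (w * s) 1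
    else q • Finsupp.single (w * s) 1 + (q - 1) • Finsupp.single w 1 := by
  rw [rightStep, Finsupp.linearCombination_single, one_smul]

theorem leftStep_single (s w : W) : leftStep S s (Finsupp.single w 1) =
    if length S w < length S (s * w) then Finsupp.single (s * w) 1
    else q • Finsupp.single (s * w) 1 + (q - 1) • Finsupp.single w 1 := by
  rw [leftStep, Finsupp.linearCombination_single, one_smul]

theorem rightStepInv_apply (s : W) (m : W →₀ ℤ[T;T⁻¹]) : rightStepInv S s m =
    (LaurentPolynomial.T (-1) : ℤ[T;T⁻¹]) • rightStep S s m +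
      (LaurentPolynomial.T (-1) - 1 : ℤ[T;T⁻¹]) • m := rfl

theorem T_neg_one_mul_q : (LaurentPolynomial.T (-1) : ℤ[T;T⁻¹]) * q = 1 := by
  rw [← LaurentPolynomial.T_add]; exact LaurentPolynomial.T_zero

theorem heckeT_one : heckeT S 1 = 1 := by
  have := RingQuot.mkAlgHom_rel ℤ[T;T⁻¹] (HeckeRel.one (S := S))
  rwa [map_one] at this

theorem heckeT_mul {u v : W} (huv : length S (u * v) = length S u + length S v) :
    heckeT S u * heckeT S v = heckeT S (u * v) := by
  have := RingQuot.mkAlgHom_rel ℤ[T;T⁻¹] (HeckeRel.mul (S := S) u v huv)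
  rwa [map_mul] at this

theorem heckeT_quad {s : W} (hs : s ∈ S) :
    heckeT S s * heckeT S s = q • 1 + (q - 1) • heckeT S s := by
  refine mul_self_of_quad (H := Hecke S) q (heckeT S s) ?_
  have := RingQuot.mkAlgHom_rel ℤ[T;T⁻¹] (HeckeRel.quad (S := S) s hs)
  rwa [map_mul, map_add, map_sub, map_one, map_zero, AlgHom.commutes] at this

/-- The inverse of `T_s`. -/
def heckeTInv (S : Set W) (s : W) : Hecke S :=
  (LaurentPolynomial.T (-1) : ℤ[T;T⁻¹]) • heckeT S s +
    (LaurentPolynomial.T (-1) - 1 : ℤ[T;T⁻¹]) • 1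

theorem heckeT_mul_heckeTInv {s : W} (hs : s ∈ S) : heckeT S s * heckeTInv S s = 1 := by
  rw [heckeTInv, mul_add, mul_smul_comm, mul_smul_comm, heckeT_quad hs, mul_one, smul_add,
    smul_smul, smul_smul, mul_sub, T_neg_one_mul_q, mul_one, one_smul, add_assoc, ← add_smul,
    sub_add_sub_cancel, sub_self, zero_smul, add_zero]

theorem heckeTInv_mul_heckeT {s : W} (hs : s ∈ S) : heckeTInv S s * heckeT S s = 1 := by
  rw [heckeTInv, add_mul, smul_mul_assoc, smul_mul_assoc, heckeT_quad hs, one_mul, smul_add,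
    smul_smul, smul_smul, mul_sub, T_neg_one_mul_q, mul_one, one_smul, add_assoc, ← add_smul,
    sub_add_sub_cancel, sub_self, zero_smul, add_zero]

variable (S) in
/-- The linear map from the free module with basis `W` to the Hecke algebra, sending `w` to
`T_w`. -/
def toHecke : (W →₀ ℤ[T;T⁻¹]) →ₗ[ℤ[T;T⁻¹]] Hecke S :=
  Finsupp.linearCombination ℤ[T;T⁻¹] (heckeT S)

theorem toHecke_single (w : W) : toHecke S (Finsupp.single w 1) = heckeT S w := by
  rw [toHecke, Finsupp.linearCombination_single, one_smul]

theorem rightStep_single_of_length {s w : W} (hl : length S (w * s) = length S w + 1) :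
    rightStep S s (Finsupp.single w 1) = Finsupp.single (w * s) 1 := by
  rw [rightStep_single, if_pos (by omega)]

theorem inverse_heckeT_one : Ring.inverse (heckeT S (1 : W)⁻¹) = 1 := by
  rw [inv_one, heckeT_one, Ring.inverse_one]

namespace IsCoxeterPair

variable (h : IsCoxeterPair S)
include h

theorem left_induction {P : W → Prop} (one : P 1)
    (step : ∀ w, ∀ s ∈ S, length S (s * w) = length S w + 1 → P w → P (s * w)) (w : W) : P w := by
  have := h.right_induction (P := fun w => P w⁻¹) (by simpa using one) (fun w s hs hl hw => by
    rw [mul_inv_rev, h.inv_eq hs]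
    refine step _ s hs ?_ hw
    rw [← h.length_inv (s * w⁻¹), mul_inv_rev, inv_inv, h.inv_eq hs, hl, h.length_inv]) w⁻¹
  simpa using this

theorem gen_mul_mul {s : W} (hs : s ∈ S) (w : W) : s * (s * w) = w := by
  rw [← mul_assoc, h.mul_self s hs, one_mul]

/-- If `s w ≠ w t`, ascents of `w` on one side are unaffected by multiplication on the other, and
the cases match term by term. If `s w = w t`, the two operators agree on the basis elements at `w`
and at `w t`. -/
theorem leftStep_comp_rightStep {s t : W} (hs : s ∈ S) (ht : t ∈ S) :
    leftStep S s * rightStep S t = rightStep S t * leftStep S s := by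
  refine finsupp_hom_ext fun w => ?_
  rw [Module.End.mul_apply, Module.End.mul_apply]
  have hsw := h.length_gen_mul hs w
  have hwt := h.length_mul_gen ht w
  by_cases hc : s * w = w * t
  · have hwt' : rightStep S t (Finsupp.single w 1) = leftStep S s (Finsupp.single w 1) := by
      rw [rightStep_single, leftStep_single, hc]
    have hwt2 : rightStep S t (Finsupp.single (w * t) 1) =
        leftStep S s (Finsupp.single (w * t) 1) := by
      rw [rightStep_single, leftStep_single, ← hc, h.gen_mul_mul hs, hc, h.mul_mul_cancel ht]
    rw [← hwt', rightStep_single]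
    split_ifs
    · exact hwt2.symm
    · simp only [map_add, map_smul, hwt', hwt2]
  · have h1 := h.left_ascent_iff hs ht hc
    have h2 := h.right_ascent_iff hs ht hc
    rw [mul_assoc] at h2
    by_cases h3 : length S w < length S (s * w) <;>
      by_cases h4 : length S w < length S (w * t)
    all_goals
      have h5 := h3
      have h6 := h4
      rw [h1] at h5
      rw [h2] at h6
      simp only [rightStep_single, leftStep_single, h3, h4, if_true, if_false,
        map_add, map_smul, h5, h6, mul_assoc]
      try module

/-- The basis element at 1 generates the module under the right steps. Relations between operators
commuting with these need only be checked at that element. -/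
theorem eq_of_commute_rightStep {f g : Module.End ℤ[T;T⁻¹] (W →₀ ℤ[T;T⁻¹])}
    (hf : ∀ s ∈ S, f * rightStep S s = rightStep S s * f)
    (hg : ∀ s ∈ S, g * rightStep S s = rightStep S s * g)
    (hfg : f (Finsupp.single 1 1) = g (Finsupp.single 1 1)) : f = g := by
  refine finsupp_hom_ext fun w => ?_
  induction w using h.right_induction with
  | one => exact hfg
  | step w s hs hl hw =>
    rw [← rightStep_single_of_length hl, ← Module.End.mul_apply, ← Module.End.mul_apply, hf s hs,
      hg s hs, Module.End.mul_apply, hw, Module.End.mul_apply]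

/-- A product of left steps along a reduced word works. By `eq_of_commute_rightStep` the two
recorded properties determine the operator, so different reduced words need not be compared. -/
theorem exists_leftOp (w : W) : ∃ f : Module.End ℤ[T;T⁻¹] (W →₀ ℤ[T;T⁻¹]),
    (∀ s ∈ S, f * rightStep S s = rightStep S s * f) ∧
      f (Finsupp.single 1 1) = Finsupp.single w 1 := by
  induction w using h.left_induction with
  | one => exact ⟨1, fun s _ => by rw [one_mul, mul_one], rfl⟩
  | step w s hs hl hw =>
    obtain ⟨f, hf, hf1⟩ := hw
    refine ⟨leftStep S s * f, fun t ht => ?_, ?_⟩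
    · rw [mul_assoc, hf t ht, ← mul_assoc, h.leftStep_comp_rightStep hs ht, mul_assoc]
    · rw [Module.End.mul_apply, hf1, leftStep_single, if_pos (by omega)]

/-- Left multiplication by `T_w` on the free module with basis `W`. -/
def leftOp (w : W) : Module.End ℤ[T;T⁻¹] (W →₀ ℤ[T;T⁻¹]) := (h.exists_leftOp w).choose

theorem leftOp_comm (w : W) : ∀ s ∈ S, h.leftOp w * rightStep S s = rightStep S s * h.leftOp w :=
  (h.exists_leftOp w).choose_spec.1

theorem leftOp_single_one (w : W) : h.leftOp w (Finsupp.single 1 1) = Finsupp.single w 1 :=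
  (h.exists_leftOp w).choose_spec.2

theorem leftOp_single {u v : W} (huv : length S (u * v) = length S u + length S v) :
    h.leftOp u (Finsupp.single v 1) = Finsupp.single (u * v) 1 := by
  induction v using h.right_induction with
  | one => rw [leftOp_single_one, mul_one]
  | step v s hs hl ih =>
    rw [← mul_assoc] at huv
    have h1 := h.length_mul_le u v
    have h2 := h.length_mul_gen hs (u * v)
    rw [← rightStep_single_of_length hl, ← Module.End.mul_apply, h.leftOp_comm u s hs,
      Module.End.mul_apply, ih (by omega), rightStep_single_of_length (by omega), mul_assoc]

theorem leftOp_one : h.leftOp 1 = 1 :=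
  h.eq_of_commute_rightStep (h.leftOp_comm 1) (fun s _ => by rw [one_mul, mul_one])
    (h.leftOp_single_one 1)

theorem leftOp_mul {u v : W} (huv : length S (u * v) = length S u + length S v) :
    h.leftOp u * h.leftOp v = h.leftOp (u * v) := by
  refine h.eq_of_commute_rightStep (fun s hs => ?_) (h.leftOp_comm _) ?_
  · rw [mul_assoc, h.leftOp_comm v s hs, ← mul_assoc, h.leftOp_comm u s hs, mul_assoc]
  · rw [Module.End.mul_apply, h.leftOp_single_one, h.leftOp_single huv, h.leftOp_single_one]

theorem leftOp_gen_single {s : W} (hs : s ∈ S) :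
    h.leftOp s (Finsupp.single s 1) = q • Finsupp.single 1 1 + (q - 1) • Finsupp.single s 1 := by
  have h1 : length S (1 * s) = length S (1 : W) + 1 := by
    rw [one_mul, length_one, h.length_gen hs]
  have h2 := rightStep_single_of_length h1
  rw [one_mul] at h2
  -- The basis element at `s` is the right translate of the one at 1, and `leftOp s` commutes with
  -- right translation.
  conv_lhs => rw [← h2]
  rw [← Module.End.mul_apply, h.leftOp_comm s s hs, Module.End.mul_apply, h.leftOp_single_one,
    rightStep_single, h.mul_self s hs, length_one, if_neg (by omega)]

theorem leftOp_quad {s : W} (hs : s ∈ S) :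
    (h.leftOp s + 1) * (h.leftOp s - algebraMap ℤ[T;T⁻¹] _ q) = 0 := by
  refine h.eq_of_commute_rightStep (fun t ht => ?_) (fun t _ => by rw [zero_mul, mul_zero]) ?_
  · have h1 := h.leftOp_comm s t ht
    have h3 : (h.leftOp s - algebraMap ℤ[T;T⁻¹] _ q) * rightStep S t =
        rightStep S t * (h.leftOp s - algebraMap ℤ[T;T⁻¹] _ q) :=
      LinearMap.ext fun m => by
        have h1' := LinearMap.congr_fun h1 m
        rw [Module.End.mul_apply, Module.End.mul_apply] at h1' ⊢
        rw [LinearMap.sub_apply, LinearMap.sub_apply, map_sub, h1', Module.algebraMap_end_apply,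
          Module.algebraMap_end_apply, map_smul]
    have h4 : (h.leftOp s + 1) * rightStep S t = rightStep S t * (h.leftOp s + 1) := by
      rw [add_mul, mul_add, h1, one_mul, mul_one]
    rw [mul_assoc, h3, ← mul_assoc, h4, mul_assoc]
  · rw [Module.End.mul_apply, LinearMap.sub_apply, Module.algebraMap_end_apply,
      h.leftOp_single_one, map_sub, map_smul, LinearMap.add_apply, LinearMap.add_apply,
      h.leftOp_gen_single hs, h.leftOp_single_one, Module.End.one_apply, Module.End.one_apply,
      LinearMap.zero_apply]
    module

/-- The left regular representation of the Hecke algebra, on the free module with basis `W`. -/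
def heckeRep : Hecke S →ₐ[ℤ[T;T⁻¹]] Module.End ℤ[T;T⁻¹] (W →₀ ℤ[T;T⁻¹]) :=
  RingQuot.liftAlgHom ℤ[T;T⁻¹] ⟨FreeAlgebra.lift ℤ[T;T⁻¹] h.leftOp, fun x y hxy => by
    cases hxy with
    | one => rw [FreeAlgebra.lift_ι_apply, map_one, h.leftOp_one]
    | mul u v huv => simp only [map_mul, FreeAlgebra.lift_ι_apply, h.leftOp_mul huv]
    | quad s hs =>
      simp only [map_mul, map_add, map_sub, map_one, map_zero, FreeAlgebra.lift_ι_apply,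
        AlgHom.commutes]
      exact h.leftOp_quad hs⟩

theorem heckeRep_heckeT (w : W) : h.heckeRep (heckeT S w) = h.leftOp w := by
  rw [heckeRep, heckeT, RingQuot.liftAlgHom_mkAlgHom_apply, FreeAlgebra.lift_ι_apply]

/-- Acting on the basis element at 1 recovers the coordinates, hence the independence of the T_w. -/
theorem heckeRep_toHecke (m : W →₀ ℤ[T;T⁻¹]) :
    h.heckeRep (toHecke S m) (Finsupp.single 1 1) = m := by
  let f : (W →₀ ℤ[T;T⁻¹]) →ₗ[ℤ[T;T⁻¹]] (W →₀ ℤ[T;T⁻¹]) :=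
    (LinearMap.applyₗ (Finsupp.single 1 1)).comp (h.heckeRep.toLinearMap.comp (toHecke S))
  have hf : f = LinearMap.id := finsupp_hom_ext fun w => by
    change h.heckeRep (toHecke S (Finsupp.single w 1)) (Finsupp.single 1 1) = _
    rw [toHecke_single, heckeRep_heckeT, leftOp_single_one, LinearMap.id_apply]
  exact LinearMap.congr_fun hf m

/-- The elements `T_w` of the Hecke algebra are linearly independent. -/
theorem toHecke_injective : Function.Injective (toHecke S) :=
  fun m n hmn => by
  rw [← h.heckeRep_toHecke m, hmn, h.heckeRep_toHecke]

theorem toHecke_rightStep {s : W} (hs : s ∈ S) (m : W →₀ ℤ[T;T⁻¹]) :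
    toHecke S (rightStep S s m) = toHecke S m * heckeT S s := by
  have key : (toHecke S).comp (rightStep S s) =
      (LinearMap.mulRight ℤ[T;T⁻¹] (heckeT S s)).comp (toHecke S) :=
    finsupp_hom_ext fun w => by
      change toHecke S (rightStep S s (Finsupp.single w 1)) =
        toHecke S (Finsupp.single w 1) * heckeT S s
      rw [toHecke_single]
      rcases h.length_mul_gen hs w with hl | hl
      · rw [rightStep_single_of_length hl, toHecke_single, heckeT_mul]
        rw [hl, h.length_gen hs]
      · have hw : heckeT S w = heckeT S (w * s) * heckeT S s := by
          rw [heckeT_mul, h.mul_mul_cancel hs]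
          rw [h.mul_mul_cancel hs, h.length_gen hs, hl]
        rw [rightStep_single, if_neg (by omega), map_add, map_smul, map_smul, toHecke_single,
          toHecke_single]
        conv_rhs => rw [hw, mul_assoc, heckeT_quad hs, mul_add, mul_smul_comm, mul_smul_comm,
          mul_one, ← hw]
  exact LinearMap.congr_fun key m

theorem toHecke_rightStepInv {s : W} (hs : s ∈ S) (m : W →₀ ℤ[T;T⁻¹]) :
    toHecke S (rightStepInv S s m) = toHecke S m * heckeTInv S s := by
  rw [rightStepInv_apply, map_add, map_smul, map_smul, h.toHecke_rightStep hs, heckeTInv, mul_add,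
    mul_smul_comm, mul_smul_comm, mul_one]

theorem rightStep_rightStepInv {s : W} (hs : s ∈ S) (m : W →₀ ℤ[T;T⁻¹]) :
    rightStep S s (rightStepInv S s m) = m :=
  h.toHecke_injective (by
    rw [h.toHecke_rightStep hs, h.toHecke_rightStepInv hs, mul_assoc, heckeTInv_mul_heckeT hs,
      mul_one])

/-! ### The bar involution in coordinates. -/

theorem isUnit_heckeT (w : W) : IsUnit (heckeT S w) := by
  induction w using h.right_induction with
  | one => rw [heckeT_one]; exact isUnit_one
  | step w s hs hl ih =>
    rw [← heckeT_mul (by rw [hl, h.length_gen hs])]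
    exact ih.mul ⟨⟨_, _, heckeT_mul_heckeTInv hs, heckeTInv_mul_heckeT hs⟩, rfl⟩

/-- The coordinates of `(T_{w⁻¹})⁻¹`, the image of `T_w` by the bar involution. -/
def barT (w : W) : W →₀ ℤ[T;T⁻¹] :=
  h.heckeRep (Ring.inverse (heckeT S w⁻¹)) (Finsupp.single 1 1)

/-- Inverting `T_{(ws)⁻¹} = T_s T_{w⁻¹}` reverses the factors. The recursions for `barT` and `rPoly`
come from this. -/
theorem inverse_heckeT_mul {w s : W} (hs : s ∈ S) (hl : length S (w * s) = length S w + 1) :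
    Ring.inverse (heckeT S (w * s)⁻¹) = Ring.inverse (heckeT S w⁻¹) * heckeTInv S s := by
  have h1 : heckeT S s * heckeT S w⁻¹ = heckeT S (w * s)⁻¹ := by
    rw [heckeT_mul, mul_inv_rev, h.inv_eq hs]
    rw [← h.length_inv (s * w⁻¹), mul_inv_rev, inv_inv, h.inv_eq hs, hl, h.length_gen hs,
      h.length_inv, add_comm]
  refine (isUnit_heckeT h (w * s)⁻¹).mul_left_cancel ?_
  rw [Ring.mul_inverse_cancel _ (h.isUnit_heckeT _), ← h1, mul_assoc,
    ← mul_assoc (heckeT S w⁻¹), Ring.mul_inverse_cancel _ (h.isUnit_heckeT _), one_mul,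
    heckeT_mul_heckeTInv hs]

/-- Applying `rightStepInv` repeatedly shows that the inverse is a combination of the T_x; `barT`
then reads off its coordinates. -/
theorem toHecke_barT (w : W) : toHecke S (h.barT w) = Ring.inverse (heckeT S w⁻¹) := by
  suffices hex : ∃ m, toHecke S m = Ring.inverse (heckeT S w⁻¹) by
    obtain ⟨m, hm⟩ := hex
    rw [barT, ← hm, h.heckeRep_toHecke]
  induction w using h.right_induction with
  | one => exact ⟨Finsupp.single 1 1, by rw [inverse_heckeT_one, toHecke_single, heckeT_one]⟩
  | step w s hs hl ih =>
    obtain ⟨m, hm⟩ := ih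
    exact ⟨rightStepInv S s m, by
      rw [h.toHecke_rightStepInv hs, hm, h.inverse_heckeT_mul hs hl]⟩

theorem barT_one : h.barT 1 = Finsupp.single 1 1 :=
  h.toHecke_injective (by rw [h.toHecke_barT, inverse_heckeT_one, toHecke_single, heckeT_one])

theorem barT_mul {w s : W} (hs : s ∈ S) (hl : length S (w * s) = length S w + 1) :
    h.barT (w * s) = rightStepInv S s (h.barT w) :=
  h.toHecke_injective (by
    rw [h.toHecke_barT, h.inverse_heckeT_mul hs hl, h.toHecke_rightStepInv hs, h.toHecke_barT])

/-- The bar invariance of a Kazhdan-Lusztig family, in coordinates. -/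
theorem bar_invariant_iff (w : W) (p : W →₀ ℤ[X]) :
    q ^ length S w • p.sum (fun y f => LaurentPolynomial.invert (Polynomial.toLaurent f) •
          Ring.inverse (heckeT S y⁻¹)) = p.sum (fun y f => Polynomial.toLaurent f • heckeT S y) ↔
      ∀ x, q ^ length S w * p.sum (fun y f => LaurentPolynomial.invert (Polynomial.toLaurent f) *
        h.barT y x) = Polynomial.toLaurent (p x) := by
  have h1 : q ^ length S w • p.sum (fun y f => LaurentPolynomial.invert (Polynomial.toLaurent f) •
          Ring.inverse (heckeT S y⁻¹)) =
      toHecke S (q ^ length S w • p.sum (fun y f =>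
        LaurentPolynomial.invert (Polynomial.toLaurent f) • h.barT y)) := by
    rw [map_smul, Finsupp.sum, Finsupp.sum, map_sum]
    simp only [map_smul, h.toHecke_barT]
  have h2 : p.sum (fun y f => Polynomial.toLaurent f • heckeT S y) =
      toHecke S (p.mapRange Polynomial.toLaurent (map_zero _)) := by
    rw [toHecke, Finsupp.linearCombination_apply, Finsupp.sum_mapRange_index]
    intro; exact zero_smul _ _
  rw [h1, h2, h.toHecke_injective.eq_iff, Finsupp.ext_iff]
  refine forall_congr' fun x => ?_
  rw [Finsupp.smul_apply, smul_eq_mul, Finsupp.sum, Finsupp.finsetSum_apply,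
    Finsupp.mapRange_apply]
  rfl

end IsCoxeterPair

/-! ### Laurent polynomials that are symmetric or antisymmetric under inversion of q. -/

theorem coeff_toLaurent_natCast (f : ℤ[X]) (n : ℕ) :
    (Polynomial.toLaurent f).coeff (n : ℤ) = f.coeff n := by
  rw [LaurentPolynomial.coeff_toLaurent]
  exact (Finsupp.mapDomain_apply Nat.castEmbedding.injective _ n).trans
    (Polynomial.toFinsupp_apply f n)

theorem coeff_toLaurent_of_neg (f : ℤ[X]) {k : ℤ} (hk : k < 0) :
    (Polynomial.toLaurent f).coeff k = 0 := by
  rw [LaurentPolynomial.coeff_toLaurent]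
  refine Finsupp.mapDomain_of_notMem_range _ _ ?_
  rintro ⟨n, hn⟩
  simp at hn
  omega

theorem coeff_T_mul_invert (n k : ℤ) (f : ℤ[T;T⁻¹]) :
    (LaurentPolynomial.T n * LaurentPolynomial.invert f).coeff k = f.coeff (n - k) := by
  rw [LaurentPolynomial.T, AddMonoidAlgebra.coeff_single_mul_apply, one_mul,
    LaurentPolynomial.invert_apply]
  congr 1; ring

/-- A polynomial of degree less than `n / 2` with `f(q) = qⁿ f(q⁻¹)` is zero. -/
theorem eq_zero_of_T_mul_invert_eq {n : ℕ} {f : ℤ[X]} (hdeg : ∀ i, n ≤ 2 * i → f.coeff i = 0)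
    (hf : LaurentPolynomial.T (n : ℤ) * LaurentPolynomial.invert (Polynomial.toLaurent f) =
      Polynomial.toLaurent f) : f = 0 := by
  ext i
  rw [Polynomial.coeff_zero]
  by_cases hi : n ≤ 2 * i
  · exact hdeg i hi
  · rw [← coeff_toLaurent_natCast, ← hf, coeff_T_mul_invert,
      show (n : ℤ) - i = ((n - i : ℕ) : ℤ) by omega, coeff_toLaurent_natCast]
    exact hdeg _ (by omega)

/-- If `qⁿ g(q⁻¹) = -g(q)` then `g = qⁿ f(q⁻¹) - f` for some `f` of degree less than `n / 2`. -/
theorem exists_of_T_mul_invert_eq_neg {n : ℕ} {g : ℤ[X]}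
    (hg : LaurentPolynomial.T (n : ℤ) * LaurentPolynomial.invert (Polynomial.toLaurent g) =
      -Polynomial.toLaurent g) :
    ∃ f : ℤ[X], (0 < n → 2 * f.natDegree + 1 ≤ n) ∧
      LaurentPolynomial.T (n : ℤ) * LaurentPolynomial.invert (Polynomial.toLaurent f) =
        Polynomial.toLaurent f + Polynomial.toLaurent g := by
  have hc : ∀ k : ℤ, (Polynomial.toLaurent g).coeff (n - k) =
      -(Polynomial.toLaurent g).coeff k := fun k => by
    rw [← coeff_T_mul_invert, hg]; rfl
  -- Minus the lower half of `g`. A middle coefficient, at n / 2, equals its own negative and so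
  -- vanishes. The degree bound is impossible for n = 0, where even the zero polynomial violates it.
  let f : ℤ[X] := -∑ i ∈ (Finset.range n).filter (fun i => 2 * i < n),
    Polynomial.monomial i (g.coeff i)
  have hfc : ∀ i, f.coeff i = if 2 * i < n then -g.coeff i else 0 := by
    intro i
    simp only [f, Polynomial.coeff_neg, Polynomial.finsetSum_coeff, Polynomial.coeff_monomial,
      Finset.sum_ite_eq', Finset.mem_filter, Finset.mem_range]
    split_ifs with h1 h2 h2
    · rfl
    · omega
    · omega
    · rfl
  have hF : ∀ k : ℤ, (Polynomial.toLaurent f).coeff k =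
      if 2 * k < n then -(Polynomial.toLaurent g).coeff k else 0 := fun k => by
    rcases lt_or_ge k 0 with hk | hk
    · rw [coeff_toLaurent_of_neg f hk, coeff_toLaurent_of_neg g hk, neg_zero, ite_self]
    · lift k to ℕ using hk
      rw [coeff_toLaurent_natCast, coeff_toLaurent_natCast, hfc]
      exact if_congr (by omega) rfl rfl
  refine ⟨f, fun hn => ?_, LaurentPolynomial.ext fun k => ?_⟩
  · have : f.natDegree ≤ (n - 1) / 2 := by
      rw [Polynomial.natDegree_le_iff_coeff_eq_zero]
      intro i hi
      rw [hfc, if_neg (by omega)]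
    omega
  · rw [coeff_T_mul_invert, AddMonoidAlgebra.coeff_add, Finsupp.add_apply, hF, hF, hc]
    have := hc k
    split_ifs with h1 h2 h2
    · omega
    · ring
    · ring
    · rw [show (n : ℤ) - k = k by omega] at this
      omega

/-- The transpose of the definition: only the basis elements at `x` and `x s` contribute to the
coordinate at `x`. -/
theorem rightStep_apply (s : W) (hs : s * s = 1) (m : W →₀ ℤ[T;T⁻¹]) (x : W)
    (hne : length S (x * s) ≠ length S x) :
    rightStep S s m x = if length S (x * s) < length S x then m (x * s) + (q - 1) * m x
      else q * m (x * s) := by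
  have hxs : x * s * s = x := by rw [mul_assoc, hs, mul_one]
  have hlx : ∀ w, w * s = x → w = x * s := by
    rintro w rfl; rw [mul_assoc, hs, mul_one]
  let f : (W →₀ ℤ[T;T⁻¹]) →ₗ[ℤ[T;T⁻¹]] ℤ[T;T⁻¹] := (Finsupp.lapply x).comp (rightStep S s)
  let g : (W →₀ ℤ[T;T⁻¹]) →ₗ[ℤ[T;T⁻¹]] ℤ[T;T⁻¹] := if length S (x * s) < length S x then
    Finsupp.lapply (x * s) + (q - 1) • Finsupp.lapply x else q • Finsupp.lapply (x * s)
  have hfg : f = g := finsupp_hom_ext fun w => by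
    change rightStep S s (Finsupp.single w 1) x = g _
    classical
    have hs1 : ∀ y, x ≠ y → (Finsupp.single y 1 : W →₀ ℤ[T;T⁻¹]) x = 0 := fun y hy =>
      Finsupp.single_eq_of_ne hy
    rw [rightStep_single]
    by_cases h1 : w = x
    · subst h1
      have h2 : w ≠ w * s := fun h => hne (by rw [← h])
      simp only [g]
      split_ifs <;> first | omega | simp [h2, h2.symm]
    · by_cases h2 : w = x * s
      · subst h2
        simp only [g, hxs]
        split_ifs <;> first | omega | simp [Ne.symm h1]
      · have h3 : w * s ≠ x := fun h => h2 (hlx w h)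
        simp only [g]
        split_ifs <;> simp [Ne.symm h1, Ne.symm h2, Ne.symm h3]
  have := LinearMap.congr_fun hfg m
  change rightStep S s m x = g m at this
  rw [this]
  simp only [g]
  split_ifs <;> simp

/-! ### The R-polynomials. -/

namespace IsCoxeterPair

variable (h : IsCoxeterPair S)
include h

theorem rightStepInv_apply_apply {s : W} (hs : s ∈ S) (m : W →₀ ℤ[T;T⁻¹]) (x : W) :
    rightStepInv S s m x = if length S (x * s) < length S x
      then LaurentPolynomial.T (-1) * m (x * s)
      else m (x * s) + (LaurentPolynomial.T (-1) - 1) * m x := by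
  rw [rightStepInv_apply, Finsupp.add_apply, Finsupp.smul_apply, Finsupp.smul_apply, smul_eq_mul,
    smul_eq_mul, rightStep_apply s (h.mul_self s hs) m x (h.length_mul_ne x s hs)]
  have := T_neg_one_mul_q
  split_ifs
  · linear_combination m x * this
  · linear_combination m (x * s) * this

/-- The polynomial `R_{x,y}`, as a Laurent polynomial. -/
def rPoly (x y : W) : ℤ[T;T⁻¹] :=
  LaurentPolynomial.T (-(length S x : ℤ)) * LaurentPolynomial.invert (h.barT y x)

theorem invert_barT (x y : W) : LaurentPolynomial.invert (h.barT y x) =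
    LaurentPolynomial.T (length S x : ℤ) * h.rPoly x y := by
  rw [rPoly, ← mul_assoc, ← LaurentPolynomial.T_add, add_neg_cancel, LaurentPolynomial.T_zero,
    one_mul]

theorem barT_apply (x y : W) : h.barT y x =
    LaurentPolynomial.T (-(length S x : ℤ)) * LaurentPolynomial.invert (h.rPoly x y) := by
  rw [← LaurentPolynomial.involutive_invert (h.barT y x), invert_barT, map_mul,
    LaurentPolynomial.invert_T]

theorem rPoly_one_right (x : W) : h.rPoly x 1 = Finsupp.single (1 : W) (1 : ℤ[T;T⁻¹]) x := by
  rw [rPoly, h.barT_one]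
  by_cases hx : x = 1
  · subst hx
    simp [length_one]
  · rw [Finsupp.single_eq_of_ne hx, map_zero, mul_zero]

/-- This and `rPoly_mul_of_gt` are `barT_mul` read at one coordinate. Apart from them, the effect of
cancellation on R is found using only R_{x,x} = 1 and the vanishing of R off the Bruhat order. -/
theorem rPoly_mul_of_lt {x y s : W} (hs : s ∈ S) (hy : length S y < length S (y * s))
    (hx : length S (x * s) < length S x) : h.rPoly x (y * s) = h.rPoly (x * s) y := by
  have h1 := h.length_mul_gen hs y
  have h2 := h.length_mul_gen hs x
  rw [rPoly, h.barT_mul hs (by omega), h.rightStepInv_apply_apply hs, if_pos hx, map_mul,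
    LaurentPolynomial.invert_T, ← mul_assoc, ← LaurentPolynomial.T_add, rPoly]
  congr 2; omega

theorem rPoly_mul_of_gt {x y s : W} (hs : s ∈ S) (hy : length S y < length S (y * s))
    (hx : length S x < length S (x * s)) :
    h.rPoly x (y * s) = q * h.rPoly (x * s) y + (q - 1) * h.rPoly x y := by
  have h1 := h.length_mul_gen hs y
  have h2 := h.length_mul_gen hs x
  have h3 : (LaurentPolynomial.T (-(length S x : ℤ)) : ℤ[T;T⁻¹]) =
      q * LaurentPolynomial.T (-(length S (x * s) : ℤ)) := by
    rw [← LaurentPolynomial.T_add]; congr 1; omega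
  rw [rPoly, h.barT_mul hs (by omega), h.rightStepInv_apply_apply hs, if_neg (by omega), map_add,
    map_mul LaurentPolynomial.invert, map_sub, map_one, LaurentPolynomial.invert_T, mul_add, rPoly, rPoly, neg_neg, h3]
  ring

/-- The recursion replaces (x, y s) by (x s, y) or (x, y); `mul_le_or` brings the resulting
inequality back. -/
theorem le_of_rPoly_ne_zero {x y : W} (hxy : h.rPoly x y ≠ 0) : BruhatLE S x y := by
  induction y using h.right_induction generalizing x with
  | one =>
    rw [rPoly_one_right] at hxy
    by_cases hx : x = 1
    · rw [hx]; exact BruhatLE.refl _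
    · exact absurd (Finsupp.single_eq_of_ne hx) hxy
  | step y s hs hl ih =>
    have hy : BruhatLE S y (y * s) := bruhatLE_mul (isReflection_of_mem hs) (by omega)
    have key : h.rPoly (x * s) y ≠ 0 → BruhatLE S x (y * s) := fun hne => by
      rcases h.mul_le_or hs (ih hne) with h1 | h1
      · rw [h.mul_mul_cancel hs] at h1; exact h1.trans hy
      · rwa [h.mul_mul_cancel hs] at h1
    rcases h.length_mul_gen hs x with hx | hx
    · rw [h.rPoly_mul_of_gt hs (by omega) (by omega)] at hxy
      by_cases h0 : h.rPoly (x * s) y = 0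
      · refine (ih fun h1 => hxy ?_).trans hy
        rw [h0, h1, mul_zero, mul_zero, add_zero]
      · exact key h0
    · rw [h.rPoly_mul_of_lt hs (by omega) (by omega)] at hxy
      exact key hxy

theorem rPoly_self (x : W) : h.rPoly x x = 1 := by
  induction x using h.right_induction with
  | one => rw [rPoly_one_right, Finsupp.single_eq_same]
  | step x s hs hl ih =>
    rw [h.rPoly_mul_of_lt hs (by omega), h.mul_mul_cancel hs, ih]
    rw [h.mul_mul_cancel hs, hl]; omega

theorem exists_toLaurent_eq_rPoly (x y : W) : ∃ f : ℤ[X], Polynomial.toLaurent f = h.rPoly x y := by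
  induction y using h.right_induction generalizing x with
  | one =>
    rw [rPoly_one_right]
    classical
    rw [Finsupp.single_apply]
    split_ifs
    · exact ⟨1, map_one _⟩
    · exact ⟨0, map_zero _⟩
  | step y s hs hl ih =>
    rcases h.length_mul_gen hs x with hx | hx
    · rw [h.rPoly_mul_of_gt hs (by omega) (by omega)]
      obtain ⟨f, hf⟩ := ih x
      obtain ⟨g, hg⟩ := ih (x * s)
      refine ⟨Polynomial.X * g + (Polynomial.X - 1) * f, ?_⟩
      rw [map_add, map_mul, map_mul, map_sub, map_one, Polynomial.toLaurent_X, hf, hg]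
    · rw [h.rPoly_mul_of_lt hs (by omega) (by omega)]
      exact ih _

/-- Inverting q in each coordinate and adjusting by a power of q replaces the inverses of Hecke
elements by R-polynomials. -/
theorem bar_invariant_iff_rPoly (w : W) (p : W →₀ ℤ[X]) :
    q ^ length S w • p.sum (fun y f => LaurentPolynomial.invert (Polynomial.toLaurent f) •
          Ring.inverse (heckeT S y⁻¹)) = p.sum (fun y f => Polynomial.toLaurent f • heckeT S y) ↔
      ∀ x, p.sum (fun y f => h.rPoly x y * Polynomial.toLaurent f) =
        LaurentPolynomial.T ((length S w : ℤ) - length S x) *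
          LaurentPolynomial.invert (Polynomial.toLaurent (p x)) := by
  rw [h.bar_invariant_iff]
  refine forall_congr' fun x => ?_
  have h1 : q ^ length S w * p.sum (fun y f =>
      LaurentPolynomial.invert (Polynomial.toLaurent f) * h.barT y x) =
      LaurentPolynomial.T ((length S w : ℤ) - length S x) * LaurentPolynomial.invert
        (p.sum (fun y f => h.rPoly x y * Polynomial.toLaurent f)) := by
    rw [LaurentPolynomial.T_pow, mul_one, LaurentPolynomial.T_sub, mul_assoc, Finsupp.sum,
      Finsupp.sum, map_sum LaurentPolynomial.invert]
    congr 1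
    rw [Finset.mul_sum]
    refine Finset.sum_congr rfl fun y _ => ?_
    rw [h.barT_apply, map_mul]; ring
  rw [h1]
  have h2 := LaurentPolynomial.involutive_invert (R := ℤ)
  have h3 : (LaurentPolynomial.T ((length S w : ℤ) - length S x) : ℤ[T;T⁻¹]) *
      LaurentPolynomial.T (-((length S w : ℤ) - length S x)) = 1 := by
    rw [← LaurentPolynomial.T_add, add_neg_cancel, LaurentPolynomial.T_zero]
  constructor
  · intro h4
    rw [← h4, map_mul, h2, LaurentPolynomial.invert_T, ← mul_assoc, h3, one_mul]
  · intro h4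
    rw [h4, map_mul, h2, LaurentPolynomial.invert_T, ← mul_assoc, h3, one_mul]

/-! ### Existence of the Kazhdan-Lusztig polynomials. -/

/-- The bar involution, on the free module with basis `W`. -/
def bar : (W →₀ ℤ[T;T⁻¹]) →+ (W →₀ ℤ[T;T⁻¹]) :=
  Finsupp.liftAddHom fun y =>
    AddMonoidHom.mk' (fun c => LaurentPolynomial.invert c • h.barT y)
      fun b c => by rw [map_add, add_smul]

theorem bar_single (y : W) (c : ℤ[T;T⁻¹]) :
    h.bar (Finsupp.single y c) = LaurentPolynomial.invert c • h.barT y := by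
  rw [bar, Finsupp.liftAddHom_apply_single]; rfl

theorem bar_apply (m : W →₀ ℤ[T;T⁻¹]) (x : W) :
    h.bar m x = ∑ y ∈ m.support, LaurentPolynomial.invert (m y) * h.barT y x := by
  conv_lhs => rw [← Finsupp.sum_single m, Finsupp.sum, map_sum, Finsupp.finsetSum_apply]
  refine Finset.sum_congr rfl fun y _ => ?_
  rw [bar_single, Finsupp.smul_apply, smul_eq_mul]

theorem bar_smul (c : ℤ[T;T⁻¹]) (m : W →₀ ℤ[T;T⁻¹]) :
    h.bar (c • m) = LaurentPolynomial.invert c • h.bar m := by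
  induction m using Finsupp.induction_linear with
  | zero => rw [smul_zero, map_zero, smul_zero]
  | add f g hf hg => rw [smul_add, map_add, hf, hg, map_add, smul_add]
  | single y b => rw [Finsupp.smul_single, bar_single, bar_single, smul_eq_mul, map_mul, mul_smul]

/-- Bar carries T_s to its inverse. At a descent `s` of `y` this follows from `barT y = rightStepInv
S s (barT (y s))`. -/
theorem bar_rightStep {s : W} (hs : s ∈ S) (m : W →₀ ℤ[T;T⁻¹]) :
    h.bar (rightStep S s m) = rightStepInv S s (h.bar m) := by
  induction m using Finsupp.induction_linear with
  | zero => simp only [map_zero]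
  | add f g hf hg => simp only [map_add, hf, hg]
  | single y b =>
    have key : h.bar (rightStep S s (Finsupp.single y 1)) = rightStepInv S s (h.barT y) := by
      rcases h.length_mul_gen hs y with hl | hl
      · rw [rightStep_single_of_length hl, bar_single, map_one, one_smul, h.barT_mul hs hl]
      · have h1 : h.barT y = rightStepInv S s (h.barT (y * s)) := by
          rw [← h.barT_mul hs (by rw [h.mul_mul_cancel hs, hl]), h.mul_mul_cancel hs]
        rw [rightStep_single, if_neg (by omega), map_add, bar_smul, bar_smul, bar_single,
          bar_single, map_one, one_smul, one_smul, map_sub, map_one, LaurentPolynomial.invert_T]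
        rw [rightStepInv_apply s (h.barT y)]
        conv_rhs => rw [h1, h.rightStep_rightStepInv hs, ← h1]
    have hb : Finsupp.single y b = b • Finsupp.single y (1 : ℤ[T;T⁻¹]) := by
      rw [Finsupp.smul_single, smul_eq_mul, mul_one]
    rw [hb, map_smul, bar_smul, key, bar_smul, bar_single, map_one, one_smul, map_smul]

theorem bar_barT (y : W) : h.bar (h.barT y) = Finsupp.single y 1 := by
  induction y using h.right_induction with
  | one => rw [barT_one, bar_single, map_one, one_smul, barT_one]
  | step y s hs hl ih =>
    have h1 := h.bar_rightStep hs (h.barT (y * s))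
    rw [h.barT_mul hs hl, h.rightStep_rightStepInv hs, ih] at h1
    rw [h.barT_mul hs hl, ← rightStep_single_of_length hl, h1, h.rightStep_rightStepInv hs]

theorem bar_bar (m : W →₀ ℤ[T;T⁻¹]) : h.bar (h.bar m) = m := by
  induction m using Finsupp.induction_linear with
  | zero => simp only [map_zero]
  | add f g hf hg => simp only [map_add, hf, hg]
  | single y b =>
    rw [bar_single, bar_smul, bar_barT, LaurentPolynomial.involutive_invert, Finsupp.smul_single,
      smul_eq_mul, mul_one]

theorem le_of_barT_ne_zero {x y : W} (hxy : h.barT y x ≠ 0) : BruhatLE S x y :=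
  h.le_of_rPoly_ne_zero fun h0 => hxy (by rw [h.barT_apply, h0, map_zero, mul_zero])

/-- The defect of bar invariance, at the element `x`, of the combination of the `T_y` with
coefficients `p y`. -/
def klDefect (n : ℤ) (s : Finset W) (p : W → ℤ[T;T⁻¹]) (x : W) : ℤ[T;T⁻¹] :=
  ∑ y ∈ s, h.rPoly x y * p y -
    LaurentPolynomial.T (n - length S x) * LaurentPolynomial.invert (p x)

/-- Since bar is an involution, D = qⁿ bar(C) - C satisfies qⁿ bar(D) = -D, and the coordinates of D
are the defects up to inversion and a power of q. The coordinate of bar(D) at x involves only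
elements above x, where the defect is assumed to vanish except at x itself; this leaves an
antisymmetry of the defect at x. -/
theorem T_mul_invert_klDefect (n : ℤ) (s : Finset W) (p : W → ℤ[T;T⁻¹]) (hp : ∀ y ∉ s, p y = 0)
    (x : W) (hx : ∀ y, BruhatLE S x y → y ≠ x → h.klDefect n s p y = 0) :
    LaurentPolynomial.T (n - length S x) * LaurentPolynomial.invert (h.klDefect n s p x) =
      -h.klDefect n s p x := by
  have hinv := LaurentPolynomial.involutive_invert (R := ℤ)
  have hT : ∀ k : ℤ, (LaurentPolynomial.T k : ℤ[T;T⁻¹]) * LaurentPolynomial.T (-k) = 1 :=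
    fun k => by rw [← LaurentPolynomial.T_add, add_neg_cancel, LaurentPolynomial.T_zero]
  let C : W →₀ ℤ[T;T⁻¹] := ∑ y ∈ s, Finsupp.single y (p y)
  have hC : ∀ y, C y = p y := fun y => by
    classical
    rw [Finsupp.finsetSum_apply]
    simp only [Finsupp.single_apply, Finset.sum_ite_eq']
    split_ifs with hy
    · rfl
    · exact (hp y hy).symm
  let D : W →₀ ℤ[T;T⁻¹] := (LaurentPolynomial.T n : ℤ[T;T⁻¹]) • h.bar C - C
  have hD : ∀ y, D y =
      LaurentPolynomial.T (n - length S y) * LaurentPolynomial.invert (h.klDefect n s p y) := by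
    intro y
    have hBC : h.bar C y = LaurentPolynomial.T (-(length S y : ℤ)) *
        LaurentPolynomial.invert (∑ z ∈ s, h.rPoly y z * p z) := by
      rw [map_sum h.bar, Finsupp.finsetSum_apply, map_sum LaurentPolynomial.invert, Finset.mul_sum]
      refine Finset.sum_congr rfl fun z _ => ?_
      rw [bar_single, Finsupp.smul_apply, smul_eq_mul, barT_apply,
        map_mul LaurentPolynomial.invert]
      ring
    rw [Finsupp.sub_apply, Finsupp.smul_apply, smul_eq_mul, hC, hBC, klDefect, map_sub, mul_sub,
      map_mul LaurentPolynomial.invert, hinv, LaurentPolynomial.invert_T,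
      ← mul_assoc _ (LaurentPolynomial.T (-(n - (length S y : ℤ)))) (p y), hT, one_mul, ← mul_assoc,
      ← LaurentPolynomial.T_add, ← sub_eq_add_neg]
  have hBD : (LaurentPolynomial.T n : ℤ[T;T⁻¹]) • h.bar D = -D := by
    rw [map_sub h.bar, bar_smul, bar_bar, smul_sub, smul_smul, LaurentPolynomial.invert_T, hT,
      one_smul, neg_sub]
  have hBDx : h.bar D x =
      LaurentPolynomial.invert (D x) * LaurentPolynomial.T (-(length S x : ℤ)) := by
    rw [bar_apply, Finset.sum_eq_single x]
    · rw [h.barT_apply, h.rPoly_self, map_one, mul_one]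
    · intro y hy hyx
      by_contra hne
      have h1 := hx y (h.le_of_barT_ne_zero (right_ne_zero_of_mul hne)) hyx
      rw [Finsupp.mem_support_iff, hD, h1, map_zero, mul_zero] at hy
      exact hy rfl
    · intro hy
      rw [Finsupp.notMem_support_iff.1 hy, map_zero, zero_mul]
  have h2 := DFunLike.congr_fun hBD x
  rw [Finsupp.smul_apply, Finsupp.neg_apply, smul_eq_mul, hBDx, hD, map_mul LaurentPolynomial.invert,
    hinv, LaurentPolynomial.invert_T] at h2
  have h3 : (LaurentPolynomial.T n : ℤ[T;T⁻¹]) * (LaurentPolynomial.T (-(n - (length S x : ℤ))) *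
      h.klDefect n s p x * LaurentPolynomial.T (-(length S x : ℤ))) = h.klDefect n s p x := by
    have h4 : (LaurentPolynomial.T n : ℤ[T;T⁻¹]) * LaurentPolynomial.T (-(n - (length S x : ℤ))) *
        LaurentPolynomial.T (-(length S x : ℤ)) = 1 := by
      rw [← LaurentPolynomial.T_add, ← LaurentPolynomial.T_add, ← LaurentPolynomial.T_zero]
      congr 1; ring
    linear_combination h.klDefect n s p x * h4
  rw [h3] at h2
  linear_combination h2

theorem exists_toLaurent_eq_sum (s : Finset W) (p : W → ℤ[X]) (x : W) :
    ∃ f : ℤ[X], Polynomial.toLaurent f = ∑ y ∈ s, h.rPoly x y * Polynomial.toLaurent (p y) := by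
  choose r hr using h.exists_toLaurent_eq_rPoly x
  refine ⟨∑ y ∈ s, r y * p y, ?_⟩
  rw [map_sum]
  exact Finset.sum_congr rfl fun y _ => by rw [map_mul, hr]

/-- The coefficients are built downwards from w, one length at a time. At a new length the defect is
an antisymmetric polynomial, and `exists_of_T_mul_invert_eq_neg` converts it into a coefficient
within the degree bound. Longer elements are unaffected because R_{x,y} = 0 unless x ≤ y. -/
theorem exists_klDefect_eq_zero (w : W) (s : Finset W) (hs : ∀ y, y ∈ s ↔ BruhatLE S y w) (k : ℕ)
    (hk : k ≤ length S w) :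
    ∃ p : W → ℤ[X], p w = 1 ∧ (∀ y ∉ s, p y = 0) ∧
      (∀ y ∈ s, y ≠ w → length S y + (2 * (p y).natDegree + 1) ≤ length S w) ∧
      (∀ x, length S x + k < length S w → p x = 0) ∧
      ∀ x, length S w ≤ length S x + k →
        h.klDefect (length S w) s (fun y => Polynomial.toLaurent (p y)) x = 0 := by
  classical
  have hdefect : ∀ (p : W → ℤ[X]), (∀ y ∉ s, p y = 0) → ∀ x ∉ s,
      h.klDefect (length S w) s (fun y => Polynomial.toLaurent (p y)) x = 0 := by
    intro p hp x hx
    rw [klDefect, hp x hx, map_zero, map_zero, mul_zero, sub_zero]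
    refine Finset.sum_eq_zero fun y hy => ?_
    rw [mul_eq_zero]
    refine Or.inl (by_contra fun hne => hx ?_)
    exact (hs x).2 ((h.le_of_rPoly_ne_zero hne).trans ((hs y).1 hy))
  have hws : w ∈ s := (hs w).2 (BruhatLE.refl _)
  induction k with
  | zero =>
    have hp : ∀ y ∉ s, Pi.single (M := fun _ => ℤ[X]) w 1 y = 0 := fun y hy =>
      Pi.single_eq_of_ne (by rintro rfl; exact hy hws) _
    refine ⟨Pi.single w 1, Pi.single_eq_same _ _, hp, ?_, ?_, ?_⟩
    · intro y hy hyw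
      have := BruhatLE.length_lt ((hs y).1 hy) hyw
      rw [Pi.single_eq_of_ne hyw, Polynomial.natDegree_zero]
      omega
    · intro x hx
      exact Pi.single_eq_of_ne (by rintro rfl; omega) _
    · intro x hx
      by_cases hxs : x ∈ s
      · have := ((hs x).1 hxs).eq_of_length_le hx
        subst this
        rw [klDefect, Finset.sum_eq_single x]
        · rw [Pi.single_eq_same, h.rPoly_self, map_one, map_one, sub_self, LaurentPolynomial.T_zero,
            mul_one, sub_self]
        · intro y _ hy
          rw [Pi.single_eq_of_ne hy, map_zero, mul_zero]
        · exact fun hx => absurd hws hx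
      · exact hdefect _ hp x hxs
  | succ k ih =>
    obtain ⟨p, hpw, hps, hpd, hp0, hpk⟩ := ih (by omega)
    let E := h.klDefect (length S w) s (fun y => Polynomial.toLaurent (p y))
    have hex : ∀ x, length S x + (k + 1) = length S w → ∃ f : ℤ[X],
        2 * f.natDegree + 1 ≤ length S w - length S x ∧
        LaurentPolynomial.T ((length S w : ℤ) - length S x) *
          LaurentPolynomial.invert (Polynomial.toLaurent f) = Polynomial.toLaurent f + E x := by
      intro x hx
      obtain ⟨g, hg⟩ := h.exists_toLaurent_eq_sum s p x
      have hE : E x = Polynomial.toLaurent g := by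
        simp only [E]
        rw [klDefect, ← hg, hp0 x (by omega), map_zero, map_zero, mul_zero, sub_zero]
      have h1 := h.T_mul_invert_klDefect (length S w) s (fun y => Polynomial.toLaurent (p y))
        (fun y hy => by rw [hps y hy, map_zero]) x (fun y hxy hyx => hpk y (by
          have := BruhatLE.length_lt hxy (Ne.symm hyx)
          omega))
      change _ * LaurentPolynomial.invert (E x) = -E x at h1
      have hn : (length S w : ℤ) - length S x = ((length S w - length S x : ℕ) : ℤ) := by omega
      rw [hE, hn] at h1
      obtain ⟨f, hf1, hf2⟩ := exists_of_T_mul_invert_eq_neg h1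
      exact ⟨f, hf1 (by omega), by rw [hE, hn, hf2]⟩
    choose! F hFd hF using hex
    let p' : W → ℤ[X] := fun x =>
      if length S x + (k + 1) = length S w ∧ x ∈ s then F x else p x
    have hp's : ∀ y ∉ s, p' y = 0 := fun y hy => by
      simp only [p']
      rw [if_neg (fun hc => hy hc.2), hps y hy]
    have hp'eq : ∀ y, length S y + (k + 1) ≠ length S w → p' y = p y := fun y hy => by
      simp only [p']
      rw [if_neg (fun hc => hy hc.1)]
    refine ⟨p', ?_, hp's, ?_, ?_, ?_⟩
    · rw [hp'eq w (by omega), hpw]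
    · intro y hy hyw
      simp only [p']
      split_ifs with hc
      · have := hFd y hc.1
        omega
      · exact hpd y hy hyw
    · intro x hx
      rw [hp'eq x (by omega), hp0 x (by omega)]
    · intro x hx
      by_cases hxs : x ∈ s
      swap
      · exact hdefect p' hp's x hxs
      have hne : ∀ y ∈ s, y ≠ x →
          h.rPoly x y * Polynomial.toLaurent (p' y) = h.rPoly x y * Polynomial.toLaurent (p y) := by
        intro y _ hyx
        by_cases h0 : h.rPoly x y = 0
        · rw [h0, zero_mul, zero_mul]
        · have := BruhatLE.length_lt (h.le_of_rPoly_ne_zero h0) (Ne.symm hyx)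
          rw [hp'eq y (by omega)]
      -- Any y ≠ x with R_{x,y} ≠ 0 is longer than x and keeps its coefficient, so only the diagonal
      -- term, where R_{x,x} = 1, can change.
      have hsum : ∑ y ∈ s, h.rPoly x y * Polynomial.toLaurent (p' y) -
          Polynomial.toLaurent (p' x) = ∑ y ∈ s, h.rPoly x y * Polynomial.toLaurent (p y) -
          Polynomial.toLaurent (p x) := by
        rw [← Finset.add_sum_erase s _ hxs, ← Finset.add_sum_erase s _ hxs, h.rPoly_self, one_mul,
          one_mul, add_sub_cancel_left, add_sub_cancel_left]
        exact Finset.sum_congr rfl fun y hy =>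
          hne y (Finset.mem_of_mem_erase hy) (Finset.ne_of_mem_erase hy)
      by_cases hxk : length S x + (k + 1) = length S w
      · have hp'x : p' x = F x := if_pos ⟨hxk, hxs⟩
        have hE : E x = ∑ y ∈ s, h.rPoly x y * Polynomial.toLaurent (p y) := by
          simp only [E]
          rw [klDefect, hp0 x (by omega), map_zero, map_zero, mul_zero, sub_zero]
        have h2 := hF x hxk
        rw [hp0 x (by omega), map_zero, sub_zero, ← hE, hp'x] at hsum
        rw [klDefect, hp'x, h2]
        linear_combination hsum
      · have h2 := hpk x (by omega)
        rw [klDefect] at h2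
        rw [hp'eq x hxk] at hsum
        rw [klDefect, hp'eq x hxk]
        linear_combination hsum + h2

/-- The existence of the Kazhdan-Lusztig polynomials. -/
theorem exists_isKLFamily (hS : S.Finite) (w : W) : ∃ p : W →₀ ℤ[X], IsKLFamily S w p := by
  have hfin := h.finite_bruhatLE hS w
  obtain ⟨p, hpw, hps, hpd, -, hp⟩ := h.exists_klDefect_eq_zero w hfin.toFinset
    (fun y => by rw [Set.Finite.mem_toFinset]; rfl) (length S w) le_rfl
  have hsupp : ∀ y, p y ≠ 0 → y ∈ hfin.toFinset := fun y hy => by_contra fun hc => hy (hps y hc)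
  refine ⟨Finsupp.onFinset hfin.toFinset p hsupp, hpw, fun y hy => hps y (by simpa using hy),
    fun y hy => hpd y (by simpa using hy), (h.bar_invariant_iff_rPoly w _).2 fun x => ?_⟩
  have h1 := hp x (by omega)
  rw [klDefect, sub_eq_zero] at h1
  rw [Finsupp.onFinset_apply, ← h1, Finsupp.onFinset_sum]
  intro y
  rw [map_zero, mul_zero]

/-- By existence, the default value 0 of `klPoly` is never used. -/
theorem isKLFamily_klPoly (hS : S.Finite) (w : W) :
    ∃ p : W →₀ ℤ[X], IsKLFamily S w p ∧ ∀ y, klPoly S y w = p y := by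
  have hex := h.exists_isKLFamily hS w
  exact ⟨hex.choose, hex.choose_spec, fun y => by rw [klPoly, dif_pos hex]⟩

theorem klPoly_self (hS : S.Finite) (w : W) : klPoly S w w = 1 := by
  obtain ⟨p, hp, he⟩ := h.isKLFamily_klPoly hS w
  rw [he, hp.self]

theorem klPoly_eq_zero (hS : S.Finite) {y w : W} (hyw : ¬ BruhatLE S y w) : klPoly S y w = 0 := by
  obtain ⟨p, hp, he⟩ := h.isKLFamily_klPoly hS w
  rw [he, hp.support y hyw]

theorem klPoly_degree (hS : S.Finite) {y w : W} (hyw : BruhatLE S y w) (hne : y ≠ w) :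
    length S y + (2 * (klPoly S y w).natDegree + 1) ≤ length S w := by
  obtain ⟨p, hp, he⟩ := h.isKLFamily_klPoly hS w
  rw [he]
  exact hp.degree y hyw hne

/-- The identity `∑ R_{u,y} P_{y,v} = q^{ℓ(v)-ℓ(u)} P_{u,v}(q⁻¹)`, where `y` runs over a finite set
that contains the interval from `u` to `v`. -/
theorem sum_rPoly_mul_klPoly (hS : S.Finite) (u v : W) (s : Finset W)
    (hs : ∀ y, BruhatLE S u y → BruhatLE S y v → y ∈ s) :
    ∑ y ∈ s, h.rPoly u y * Polynomial.toLaurent (klPoly S y v) =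
      LaurentPolynomial.T ((length S v : ℤ) - length S u) *
        LaurentPolynomial.invert (Polynomial.toLaurent (klPoly S u v)) := by
  classical
  obtain ⟨p, hp, he⟩ := h.isKLFamily_klPoly hS v
  rw [he, ← (h.bar_invariant_iff_rPoly v p).1 hp.bar_invariant u, Finsupp.sum]
  simp only [he]
  -- Both `s` and the support of `p` contain every index with a nonzero term, so the two sums are
  -- compared with the sum over their union. The second alternative is ruled out in both uses.
  have h1 : ∀ t : Finset W, (∀ y, BruhatLE S u y → p y ≠ 0 → y ∈ t) →
      ∑ y ∈ t, h.rPoly u y * Polynomial.toLaurent (p y) =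
        ∑ y ∈ s ∪ p.support, h.rPoly u y * Polynomial.toLaurent (p y) ∨ ¬ t ⊆ s ∪ p.support := by
    intro t ht
    by_cases hts : t ⊆ s ∪ p.support
    · refine Or.inl (Finset.sum_subset hts fun y _ hy => ?_)
      by_contra hne
      refine hy (ht y (h.le_of_rPoly_ne_zero (left_ne_zero_of_mul hne)) fun h0 => ?_)
      rw [h0, map_zero, mul_zero] at hne
      exact hne rfl
    · exact Or.inr hts
  rw [(h1 s fun y h2 h3 => hs y h2 (by_contra fun h4 => h3 (hp.support y h4))).resolve_right
      (not_not.2 Finset.subset_union_left),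
    (h1 p.support fun y _ h3 => Finsupp.mem_support_iff.2 h3).resolve_right
      (not_not.2 Finset.subset_union_right)]

end IsCoxeterPair

end CoxeterPair

/-! ### Affine transpositions are the reflections. -/

namespace ExtAffSymm

variable {d : ℕ}

theorem modEq_apply_iff (w : ExtAffSymm d) (i j : ℤ) :
    w.1 i ≡ w.1 j [ZMOD d] ↔ i ≡ j [ZMOD d] := by
  rw [← ZMod.intCast_eq_intCast_iff, ← ZMod.intCast_eq_intCast_iff, cast_apply_eq_iff]

theorem exists_eq_add_of_modEq {i j : ℤ} (hij : i ≡ j [ZMOD d]) : ∃ k : ℤ, i = j + k * d := by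
  obtain ⟨k, hk⟩ := hij.symm.dvd
  exact ⟨k, by linarith [mul_comm k (d : ℤ)]⟩

theorem add_mul_modEq (i k : ℤ) : i + k * d ≡ i [ZMOD d] := by
  simp [Int.ModEq]

theorem ext_apply {x y : ExtAffSymm d} (hxy : ∀ k, x.1 k = y.1 k) : x = y :=
  Subtype.ext (Equiv.ext hxy)

theorem mul_apply (x y : ExtAffSymm d) (k : ℤ) : (x * y).1 k = x.1 (y.1 k) := rfl

/-- The underlying function of the affine transposition of `a` and `b`. -/
def swapFun (d : ℕ) (a b j : ℤ) : ℤ :=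
  if j ≡ a [ZMOD d] then j + (b - a) else if j ≡ b [ZMOD d] then j + (a - b) else j

theorem swapFun_left (a b k : ℤ) : swapFun d a b (a + k * d) = b + k * d := by
  rw [swapFun, if_pos (add_mul_modEq a k)]; ring

theorem swapFun_right {a b : ℤ} (hab : ¬ a ≡ b [ZMOD d]) (k : ℤ) :
    swapFun d a b (b + k * d) = a + k * d := by
  rw [swapFun, if_neg (fun h => hab (h.symm.trans (add_mul_modEq b k))),
    if_pos (add_mul_modEq b k)]
  ring

theorem swapFun_of_not_modEq {a b j : ℤ} (ha : ¬ j ≡ a [ZMOD d]) (hb : ¬ j ≡ b [ZMOD d]) :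
    swapFun d a b j = j := by
  rw [swapFun, if_neg ha, if_neg hb]

theorem modEq_cases (a b j : ℤ) : (∃ k : ℤ, j = a + k * d) ∨ (∃ k : ℤ, j = b + k * d) ∨
    (¬ j ≡ a [ZMOD d] ∧ ¬ j ≡ b [ZMOD d]) := by
  by_cases ha : j ≡ a [ZMOD d]
  · exact Or.inl (exists_eq_add_of_modEq ha)
  · by_cases hb : j ≡ b [ZMOD d]
    · exact Or.inr (Or.inl (exists_eq_add_of_modEq hb))
    · exact Or.inr (Or.inr ⟨ha, hb⟩)

theorem swapFun_swapFun {a b : ℤ} (hab : ¬ a ≡ b [ZMOD d]) (j : ℤ) :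
    swapFun d a b (swapFun d a b j) = j := by
  rcases modEq_cases (d := d) a b j with ⟨k, rfl⟩ | ⟨k, rfl⟩ | ⟨ha, hb⟩
  · rw [swapFun_left, swapFun_right hab]
  · rw [swapFun_right hab, swapFun_left]
  · rw [swapFun_of_not_modEq ha hb, swapFun_of_not_modEq ha hb]

theorem swapFun_add (a b j : ℤ) : swapFun d a b (j + d) = swapFun d a b j + d := by
  have h : ∀ x : ℤ, j + d ≡ x [ZMOD d] ↔ j ≡ x [ZMOD d] := fun x => by simp [Int.ModEq]
  unfold swapFun
  simp only [h]
  split_ifs <;> ring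

/-- The affine transposition of `a` and `b`, which exchanges `a + k d` and `b + k d` for all
`k`. -/
def swap (a b : ℤ) (hab : ¬ a ≡ b [ZMOD d]) : ExtAffSymm d :=
  ⟨⟨swapFun d a b, swapFun d a b, swapFun_swapFun hab, swapFun_swapFun hab⟩, swapFun_add a b⟩

section

variable {a b : ℤ} (hab : ¬ a ≡ b [ZMOD d])

theorem swap_apply (j : ℤ) : (swap a b hab).1 j = swapFun d a b j := rfl

theorem swap_left : (swap a b hab).1 a = b := by
  rw [swap_apply]
  simpa using swapFun_left (d := d) a b 0

theorem swap_right : (swap a b hab).1 b = a := by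
  rw [swap_apply]
  simpa using swapFun_right hab 0

theorem swap_of_not_modEq {j : ℤ} (ha : ¬ j ≡ a [ZMOD d]) (hb : ¬ j ≡ b [ZMOD d]) :
    (swap a b hab).1 j = j := swapFun_of_not_modEq ha hb

theorem swap_swap_apply (j : ℤ) : (swap a b hab).1 ((swap a b hab).1 j) = j :=
  swapFun_swapFun hab j

theorem swap_mul_self : swap a b hab * swap a b hab = 1 := ext_apply (swap_swap_apply hab)

theorem swap_comm : swap b a (fun h => hab h.symm) = swap a b hab := by
  refine ext_apply fun j => ?_
  rw [swap_apply, swap_apply]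
  rcases modEq_cases (d := d) a b j with ⟨k, rfl⟩ | ⟨k, rfl⟩ | ⟨ha, hb⟩
  · rw [swapFun_left, swapFun_right (fun h => hab h.symm)]
  · rw [swapFun_right hab, swapFun_left]
  · rw [swapFun_of_not_modEq ha hb, swapFun_of_not_modEq hb ha]

/-- The conjugation formula, written without inverses; it identifies the reflections with the affine
transpositions. -/
theorem mul_swap (g : ExtAffSymm d) :
    g * swap a b hab = swap (g.1 a) (g.1 b) (mt (modEq_apply_iff g a b).1 hab) * g := by
  refine ext_apply fun j => ?_
  rw [mul_apply, mul_apply, swap_apply, swap_apply]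
  rcases modEq_cases (d := d) a b j with ⟨k, rfl⟩ | ⟨k, rfl⟩ | ⟨ha, hb⟩
  · rw [swapFun_left, apply_add_mul, apply_add_mul, swapFun_left]
  · rw [swapFun_right hab, apply_add_mul, apply_add_mul,
      swapFun_right (mt (modEq_apply_iff g a b).1 hab)]
  · rw [swapFun_of_not_modEq ha hb, swapFun_of_not_modEq (mt (modEq_apply_iff g j a).1 ha)
      (mt (modEq_apply_iff g j b).1 hb)]

theorem excess_swap : excess (swap a b hab) = 0 := by
  have h1 := excess_mul (swap a b hab) (swap a b hab)
  rw [swap_mul_self] at h1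
  have h2 : excess (1 : ExtAffSymm d) = 0 := by simp [excess]
  omega

/-- The affine transposition of `a` and `b`, as an element of the affine symmetric group. -/
def affSwap : AffSymm d :=
  ⟨swap a b hab, by
    have := excess_swap hab
    simp only [excess] at this
    show _ = _
    linarith⟩

theorem affSwap_mul_self : affSwap hab * affSwap hab = 1 := Subtype.ext (swap_mul_self hab)

end

theorem simple_not_modEq (hd : 2 ≤ d) (k : ℤ) : ¬ k ≡ k + 1 [ZMOD d] := fun h => by
  have h1 : (d : ℤ) ∣ 1 := by simpa using h.dvd
  have := Int.le_of_dvd one_pos h1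
  omega

theorem simple_eq_affSwap (hd : 2 ≤ d) (k : ℤ) :
    AffSymm.simple hd k = affSwap (simple_not_modEq hd k) := by
  refine Subtype.ext (ext_apply fun j => ?_)
  change AffSymm.simpleFun d k j = swapFun d k (k + 1) j
  unfold AffSymm.simpleFun swapFun
  split_ifs <;> ring

theorem mem_gens_iff {s : AffSymm d} :
    s ∈ AffSymm.gens d ↔ ∃ (hd : 2 ≤ d) (k : ℤ), s = affSwap (simple_not_modEq hd k) := by
  simp only [AffSymm.gens, Set.mem_ofPred_eq, simple_eq_affSwap]

theorem two_le_of_not_modEq (hd : 1 ≤ d) {a b : ℤ} (hab : ¬ a ≡ b [ZMOD d]) : 2 ≤ d := by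
  rcases Nat.lt_or_ge d 2 with h | h
  · obtain rfl : d = 1 := by omega
    exact absurd (by rw [Nat.cast_one]; exact Int.modEq_one) hab
  · exact h

/-- A simple transposition reverses the order of `a < b` only if it is the transposition of `a` and
`b`. -/
theorem simple_swap_lt_or (hd : 2 ≤ d) (k : ℤ) {a b : ℤ} (hlt : a < b)
    (hab : ¬ a ≡ b [ZMOD d]) :
    (swap k (k + 1) (simple_not_modEq hd k)).1 a < (swap k (k + 1) (simple_not_modEq hd k)).1 b ∨
      swap a b hab = swap k (k + 1) (simple_not_modEq hd k) := by
  have hk := simple_not_modEq hd k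
  rw [swap_apply, swap_apply]
  rcases modEq_cases (d := d) k (k + 1) a with ⟨m, rfl⟩ | ⟨m, rfl⟩ | ⟨ha, hb⟩
  · rw [swapFun_left]
    rcases modEq_cases (d := d) k (k + 1) b with ⟨n, rfl⟩ | ⟨n, rfl⟩ | ⟨ha', hb'⟩
    · exact absurd ((add_mul_modEq k m).trans (add_mul_modEq k n).symm) hab
    · rw [swapFun_right hk]
      rcases lt_trichotomy m n with h | rfl | h
      · left
        have : m * (d : ℤ) + d ≤ n * d := by nlinarith
        have : (2 : ℤ) ≤ d := by exact_mod_cast hd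
        linarith
      · right
        refine ext_apply fun j => ?_
        rw [swap_apply, swap_apply]
        unfold swapFun
        have h1 : ∀ x : ℤ, j ≡ x + m * d [ZMOD d] ↔ j ≡ x [ZMOD d] := fun x => by
          simp [Int.ModEq]
        simp only [h1]
        split_ifs <;> ring
      · exfalso
        have : n * (d : ℤ) + d ≤ m * d := by nlinarith
        have : (2 : ℤ) ≤ d := by exact_mod_cast hd
        linarith
    · rw [swapFun_of_not_modEq ha' hb']
      left
      rcases lt_or_eq_of_le (show k + m * d + 1 ≤ b from hlt) with h | h
      · linarith
      · exact absurd (by rw [← h, show k + m * (d : ℤ) + 1 = k + 1 + m * d by ring];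
                         exact add_mul_modEq _ _) hb'
  · left
    rw [swapFun_right hk]
    rcases modEq_cases (d := d) k (k + 1) b with ⟨n, rfl⟩ | ⟨n, rfl⟩ | ⟨ha', hb'⟩
    · rw [swapFun_left]; linarith
    · exact absurd ((add_mul_modEq (k + 1) m).trans (add_mul_modEq (k + 1) n).symm) hab
    · rw [swapFun_of_not_modEq ha' hb']; linarith
  · rw [swapFun_of_not_modEq ha hb]
    left
    rcases modEq_cases (d := d) k (k + 1) b with ⟨n, rfl⟩ | ⟨n, rfl⟩ | ⟨ha', hb'⟩
    · rw [swapFun_left]; linarith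
    · rw [swapFun_right hk]
      rcases lt_or_eq_of_le (show a ≤ k + n * d by linarith [Int.add_one_le_iff.2 hlt]) with h | h
      · exact h
      · exact absurd (by rw [h]; exact add_mul_modEq _ _) ha
    · rwa [swapFun_of_not_modEq ha' hb']

/-- Induction on b - a, conjugating by the simple transposition of b - 1 and b. If a ≡ b - 1 this
also moves a to a + 1, but then a ≤ b - 1 - d, so the new pair is still in order and closer. -/
theorem isReflection_affSwap (hd : 1 ≤ d) {a b : ℤ} (hlt : a < b) (hab : ¬ a ≡ b [ZMOD d]) :
    CoxeterPair.IsReflection (AffSymm.gens d) (affSwap hab) := by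
  have hd2 := two_le_of_not_modEq hd hab
  have hd2' : (2 : ℤ) ≤ d := by exact_mod_cast hd2
  induction hn : (b - a).toNat using Nat.strong_induction_on generalizing a b with
  | _ n ih =>
    by_cases h1 : b = a + 1
    · subst h1
      exact CoxeterPair.isReflection_of_mem (mem_gens_iff.2 ⟨hd2, a, rfl⟩)
    · have hk := simple_not_modEq hd2 (b - 1)
      rw [sub_add_cancel] at hk
      let g : AffSymm d := affSwap hk
      have hgb : g.1.1 b = b - 1 := swap_right hk
      have hga : g.1.1 a < b - 1 ∧ a ≤ g.1.1 a := by
        change swapFun d (b - 1) b a < b - 1 ∧ a ≤ swapFun d (b - 1) b a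
        rcases modEq_cases (d := d) (b - 1) b a with ⟨m, hm⟩ | ⟨m, hm⟩ | ⟨ha, hb⟩
        · rw [hm, swapFun_left]
          have : m < 0 := by
            by_contra hm0
            have : 0 ≤ m * (d : ℤ) := mul_nonneg (not_lt.1 hm0) (by omega)
            omega
          have : m * (d : ℤ) ≤ -d := by nlinarith
          omega
        · exact absurd (by rw [hm]; exact add_mul_modEq _ _) hab
        · rw [swapFun_of_not_modEq ha hb]
          omega
      have hab' := mt (modEq_apply_iff g.1 a b).1 hab
      rw [hgb] at hab'
      have key := ih _ (by omega) hga.1 hab' rfl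
      have hconj : g⁻¹ * affSwap hab' * (g⁻¹)⁻¹ = affSwap hab := by
        rw [inv_inv, mul_assoc, inv_mul_eq_iff_eq_mul]
        refine Subtype.ext ?_
        have := mul_swap hab g.1
        simp only [hgb] at this
        exact this.symm
      rw [← hconj]
      exact key.conj _

theorem IsReflection.exists_affSwap {t : AffSymm d}
    (ht : CoxeterPair.IsReflection (AffSymm.gens d) t) :
    ∃ (a b : ℤ) (hab : ¬ a ≡ b [ZMOD d]), a < b ∧ t = affSwap hab := by
  obtain ⟨s, hs, g, rfl⟩ := ht
  obtain ⟨hd, k, rfl⟩ := mem_gens_iff.1 hs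
  have hk := simple_not_modEq hd k
  have hab := mt (modEq_apply_iff g.1 k (k + 1)).1 hk
  have he : g * affSwap hk * g⁻¹ = affSwap hab := by
    rw [mul_inv_eq_iff_eq_mul]
    exact Subtype.ext (mul_swap hk g.1)
  rw [he]
  have hne : g.1.1 k ≠ g.1.1 (k + 1) := fun e => by
    have := g.1.1.injective e
    omega
  rcases lt_or_gt_of_ne hne with h | h
  · exact ⟨_, _, hab, h, rfl⟩
  · exact ⟨_, _, fun e => hab e.symm, h, Subtype.ext (swap_comm hab).symm⟩

/-- The strong exchange property. -/
theorem length_prod_mul_affSwap_lt (l : List (AffSymm d)) (hl : ∀ s ∈ l, s ∈ AffSymm.gens d)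
    {a b : ℤ} (hlt : a < b) (hab : ¬ a ≡ b [ZMOD d]) (h : l.prod.1.1 b < l.prod.1.1 a) :
    CoxeterPair.length (AffSymm.gens d) (l.prod * affSwap hab) < l.length := by
  suffices hex : ∃ l' : List (AffSymm d), (∀ s ∈ l', s ∈ AffSymm.gens d) ∧
      l'.prod = l.prod * affSwap hab ∧ l'.length < l.length by
    obtain ⟨l', hl', he, hlen⟩ := hex
    rw [← he]
    exact (CoxeterPair.length_prod_le l' hl').trans_lt hlen
  induction l using List.reverseRecOn generalizing a b with
  | nil => exact absurd h (not_lt.2 hlt.le)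
  | append_singleton l s ih =>
    have hl' : ∀ t ∈ l, t ∈ AffSymm.gens d := fun t ht => hl t (by simp [ht])
    obtain ⟨hd, k, rfl⟩ := mem_gens_iff.1 (hl s (by simp))
    have hk := simple_not_modEq hd k
    rw [List.prod_append, List.prod_singleton] at h ⊢
    -- Either the last letter keeps a and b in order and the transposition is moved past it, or the
    -- last letter is the transposition itself and is deleted.
    rcases simple_swap_lt_or hd k hlt hab with h1 | h1
    · obtain ⟨l', hl1, hl2, hl3⟩ :=
        ih hl' h1 (mt (modEq_apply_iff (swap k (k + 1) hk) a b).1 hab) h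
      refine ⟨l' ++ [affSwap hk], ?_, ?_, ?_⟩
      · intro t ht
        rcases List.mem_append.1 ht with ht | ht
        · exact hl1 t ht
        · rw [List.mem_singleton.1 ht]; exact mem_gens_iff.2 ⟨hd, k, rfl⟩
      · rw [List.prod_append, List.prod_singleton, hl2, mul_assoc, mul_assoc]
        congr 1
        exact Subtype.ext (mul_swap hab (swap k (k + 1) hk)).symm
      · simpa using hl3
    · refine ⟨l, hl', ?_, by simp⟩
      have h2 : affSwap hab = affSwap hk := Subtype.ext h1
      rw [h2, mul_assoc, affSwap_mul_self, mul_one]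

/-! ### Generation by the simple transpositions -/

/-- The sum over a window of the squares of the displacements. -/
def displacement (w : ExtAffSymm d) : ℤ := ∑ i ∈ Finset.Icc (1 : ℤ) d, (w.1 i - i) ^ 2

theorem exists_zmod_lift [NeZero d] (g : ℤ → ℤ) (hg : ∀ i k : ℤ, g (i + k * d) = g i) :
    ∃ G : ZMod d → ℤ, ∀ i : ℤ, g i = G i := by
  refine ⟨fun c => g (c.val : ℤ), fun i => ?_⟩
  have h : i ≡ ((i : ZMod d).val : ℤ) [ZMOD d] := by
    rw [← ZMod.intCast_eq_intCast_iff]; simp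
  obtain ⟨k, hk⟩ := exists_eq_add_of_modEq h
  conv_lhs => rw [hk, hg]

/-- Reindexed by s, the new sum is that of (w(i) - s(i))². Only the classes of k and k + 1
contribute to the change, which is 2(w(k+1) - w(k)) < 0, so sorting by simple transpositions
terminates. -/
theorem displacement_mul_swap_lt (hd : 2 ≤ d) (w : ExtAffSymm d) (k : ℤ)
    (hk : w.1 (k + 1) < w.1 k) :
    displacement (w * swap k (k + 1) (simple_not_modEq hd k)) < displacement w := by
  have : NeZero d := ⟨by omega⟩
  have hne := simple_not_modEq hd k
  set s := swap k (k + 1) hne with hs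
  obtain ⟨G, hG⟩ := exists_zmod_lift (d := d) (fun i => (w.1 i - s.1 i) ^ 2) (fun i k => by
    simp only [apply_add_mul]; ring)
  have h1 : displacement (w * s) = ∑ i ∈ Finset.Icc (1 : ℤ) d, (w.1 i - s.1 i) ^ 2 := by
    simp only [hG]
    rw [← sum_window_apply s, displacement]
    refine Finset.sum_congr rfl fun i _ => ?_
    rw [← hG (s.1 i), hs, swap_swap_apply, mul_apply]
  let u := 1 - 2 * (w.1 k - k)
  let v := 2 * (w.1 (k + 1) - k) - 1
  have h2 : ∀ i : ℤ, (w.1 i - s.1 i) ^ 2 - (w.1 i - i) ^ 2 =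
      (fun c : ZMod d => (if c = (k : ZMod d) then u else 0) +
        if c = ((k + 1 : ℤ) : ZMod d) then v else 0) (i : ZMod d) := by
    intro i
    simp only [ZMod.intCast_eq_intCast_iff]
    rw [hs, swap_apply]
    rcases modEq_cases (d := d) k (k + 1) i with ⟨m, rfl⟩ | ⟨m, rfl⟩ | ⟨ha, hb⟩
    · rw [if_pos (add_mul_modEq _ _), if_neg (fun h => hne ((add_mul_modEq _ _).symm.trans h)),
        swapFun_left, apply_add_mul]
      ring
    · rw [if_pos (add_mul_modEq _ _), swapFun_right hne, apply_add_mul,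
        if_neg (fun h => hne (h.symm.trans (add_mul_modEq _ _)))]
      ring
    · rw [if_neg ha, if_neg hb, swapFun_of_not_modEq ha hb]
      ring
  have h3 : displacement (w * s) - displacement w = u + v := by
    rw [h1, displacement, ← Finset.sum_sub_distrib, Finset.sum_congr rfl fun i _ => h2 i,
      sum_cast_Icc (fun c : ZMod d => (if c = (k : ZMod d) then u else 0) +
        if c = ((k + 1 : ℤ) : ZMod d) then v else 0), Finset.sum_add_distrib, Finset.sum_ite_eq', Finset.sum_ite_eq',
      if_pos (Finset.mem_univ _), if_pos (Finset.mem_univ _)]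
  simp only [u, v] at h3
  linarith

theorem apply_eq_of_no_descent (w : ExtAffSymm d) (hw : ∀ k, w.1 k < w.1 (k + 1)) (k : ℤ) :
    w.1 k = k + w.1 0 := by
  have hmono : StrictMono w.1 := strictMono_int_of_lt_succ hw
  have hstep : ∀ k, w.1 (k + 1) = w.1 k + 1 := fun k => by
    obtain ⟨c, hc⟩ := w.1.surjective (w.1 k + 1)
    have h1 : k < c := hmono.lt_iff_lt.1 (by omega)
    have h2 : w.1 (k + 1) ≤ w.1 c := hmono.monotone (by omega)
    have := hw k
    omega
  induction k using Int.induction_on with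
  | zero => simp
  | succ k ih => rw [hstep, ih]; ring
  | pred k ih =>
    have := hstep (-(k : ℤ) - 1)
    rw [sub_add_cancel, ih] at this
    linarith

theorem eq_one_of_no_descent (hd : 1 ≤ d) (w : AffSymm d) (hw : ∀ k, w.1.1 k < w.1.1 (k + 1)) :
    w = 1 := by
  have h := apply_eq_of_no_descent w.1 hw
  have h0 : w.1.1 0 = 0 := by
    have h1 : ∑ i ∈ Finset.Icc (1 : ℤ) d, w.1.1 i = ∑ i ∈ Finset.Icc (1 : ℤ) d, i := w.2
    rw [Finset.sum_congr rfl fun i _ => h i, Finset.sum_add_distrib, add_eq_left,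
      Finset.sum_const, Int.card_Icc, nsmul_eq_mul, mul_eq_zero] at h1
    rcases h1 with h1 | h1
    · simp at h1; omega
    · exact h1
  exact Subtype.ext (ext_apply fun k => by rw [h, h0, add_zero]; rfl)

theorem two_le_of_descent (hd : 1 ≤ d) (w : ExtAffSymm d) {k : ℤ} (hk : w.1 (k + 1) < w.1 k) :
    2 ≤ d := by
  rcases Nat.lt_or_ge d 2 with h | h
  · obtain rfl : d = 1 := by omega
    have := apply_add w k
    rw [Nat.cast_one] at this
    omega
  · exact h

theorem lt_or_gt_apply_succ (w : ExtAffSymm d) (k : ℤ) :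
    w.1 k < w.1 (k + 1) ∨ w.1 (k + 1) < w.1 k :=
  lt_or_gt_of_ne fun e => by
    have := w.1.injective e
    omega

theorem exists_word (hd : 1 ≤ d) (w : AffSymm d) :
    ∃ l : List (AffSymm d), (∀ s ∈ l, s ∈ AffSymm.gens d) ∧ l.prod = w := by
  induction hn : (displacement w.1).toNat using Nat.strong_induction_on generalizing w with
  | _ n ih =>
    by_cases hw : ∀ k, w.1.1 k < w.1.1 (k + 1)
    · exact ⟨[], by simp, (eq_one_of_no_descent hd w hw).symm⟩
    · push Not at hw
      obtain ⟨k, hk⟩ := hw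
      have hk : w.1.1 (k + 1) < w.1.1 k := ((lt_or_gt_apply_succ w.1 k).resolve_left (not_lt.2 hk))
      have hd2 := two_le_of_descent hd w.1 hk
      have hlt := displacement_mul_swap_lt hd2 w.1 k hk
      have h0 : 0 ≤ displacement (w.1 * swap k (k + 1) (simple_not_modEq hd2 k)) :=
        Finset.sum_nonneg fun i _ => sq_nonneg _
      obtain ⟨l, hl, hlw⟩ := ih _ (by
        change (displacement (w.1 * swap k (k + 1) (simple_not_modEq hd2 k))).toNat < n
        omega) (w * affSwap (simple_not_modEq hd2 k)) rfl
      refine ⟨l ++ [affSwap (simple_not_modEq hd2 k)], ?_, ?_⟩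
      · intro t ht
        rcases List.mem_append.1 ht with ht | ht
        · exact hl t ht
        · rw [List.mem_singleton.1 ht]; exact mem_gens_iff.2 ⟨hd2, k, rfl⟩
      · rw [List.prod_append, List.prod_singleton, hlw, mul_assoc, affSwap_mul_self, mul_one]

/-! ### Length compared through values; the Coxeter pair of the affine symmetric group. -/

theorem length_mul_affSwap_lt (hd : 1 ≤ d) (w : AffSymm d) {a b : ℤ} (hlt : a < b)
    (hab : ¬ a ≡ b [ZMOD d]) (h : w.1.1 b < w.1.1 a) :
    CoxeterPair.length (AffSymm.gens d) (w * affSwap hab) <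
      CoxeterPair.length (AffSymm.gens d) w := by
  obtain ⟨l, hl, hlw⟩ := exists_word hd w
  obtain ⟨l, hl, rfl, hn⟩ := Nat.sInf_mem
    (s := {n | ∃ l : List (AffSymm d), (∀ s ∈ l, s ∈ AffSymm.gens d) ∧ l.prod = w ∧ l.length = n})
    ⟨_, l, hl, hlw, rfl⟩
  exact (length_prod_mul_affSwap_lt l hl hlt hab h).trans_eq hn

theorem length_lt_mul_affSwap (hd : 1 ≤ d) (w : AffSymm d) {a b : ℤ} (hlt : a < b)
    (hab : ¬ a ≡ b [ZMOD d]) (h : w.1.1 a < w.1.1 b) :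
    CoxeterPair.length (AffSymm.gens d) w <
      CoxeterPair.length (AffSymm.gens d) (w * affSwap hab) := by
  have h1 := length_mul_affSwap_lt hd (w * affSwap hab) hlt hab (by
    change w.1.1 ((swap a b hab).1 b) < w.1.1 ((swap a b hab).1 a)
    rwa [swap_left, swap_right])
  rwa [mul_assoc, affSwap_mul_self, mul_one] at h1

theorem apply_lt_or_gt (w : ExtAffSymm d) {a b : ℤ} (hab : ¬ a ≡ b [ZMOD d]) :
    w.1 a < w.1 b ∨ w.1 b < w.1 a :=
  lt_or_gt_of_ne fun e => hab (by rw [w.1.injective e])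

/-- In these terms the exchange condition says that a simple transposition other than that of a and
b keeps a and b in order. -/
theorem length_lt_mul_affSwap_iff (hd : 1 ≤ d) (w : AffSymm d) {a b : ℤ} (hlt : a < b)
    (hab : ¬ a ≡ b [ZMOD d]) :
    CoxeterPair.length (AffSymm.gens d) w <
      CoxeterPair.length (AffSymm.gens d) (w * affSwap hab) ↔ w.1.1 a < w.1.1 b := by
  refine ⟨fun h => (apply_lt_or_gt w.1 hab).resolve_right fun h1 => ?_,
    length_lt_mul_affSwap hd w hlt hab⟩
  have := length_mul_affSwap_lt hd w hlt hab h1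
  omega

theorem isCoxeterPair (hd : 1 ≤ d) : CoxeterPair.IsCoxeterPair (AffSymm.gens d) where
  mul_self := by
    intro s hs
    obtain ⟨hd2, k, rfl⟩ := mem_gens_iff.1 hs
    exact affSwap_mul_self _
  exists_word := exists_word hd
  length_mul_ne := by
    intro w s hs
    obtain ⟨hd2, k, rfl⟩ := mem_gens_iff.1 hs
    rcases lt_or_gt_apply_succ w.1 k with h | h
    · exact (length_lt_mul_affSwap hd w (by omega) _ h).ne'
    · exact (length_mul_affSwap_lt hd w (by omega) _ h).ne
  length_lt_mul := by
    intro u t s ht hs hts hlt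
    obtain ⟨a, b, hab, hlt', rfl⟩ := IsReflection.exists_affSwap ht
    obtain ⟨hd2, k, rfl⟩ := mem_gens_iff.1 hs
    have hk := simple_not_modEq hd2 k
    rw [length_lt_mul_affSwap_iff hd u hlt' hab] at hlt
    rcases simple_swap_lt_or hd2 k hlt' hab with h1 | h1
    · have hab' := mt (modEq_apply_iff (swap k (k + 1) hk) a b).1 hab
      have h2 : u * affSwap hab * affSwap hk = u * affSwap hk * affSwap hab' := by
        rw [mul_assoc, mul_assoc]
        congr 1
        have := mul_swap hab (swap k (k + 1) hk)
        refine Subtype.ext ?_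
        change swap a b hab * swap k (k + 1) hk = swap k (k + 1) hk * swap _ _ hab'
        rw [mul_swap hab' (swap k (k + 1) hk)]
        simp only [swap_swap_apply]
      rw [h2, length_lt_mul_affSwap_iff hd _ h1]
      change u.1.1 ((swap k (k + 1) hk).1 _) < u.1.1 ((swap k (k + 1) hk).1 _)
      rwa [swap_swap_apply, swap_swap_apply]
    · exact absurd (Subtype.ext h1) hts

theorem finite_gens (hd : 1 ≤ d) : (AffSymm.gens d).Finite := by
  rcases Nat.lt_or_ge d 2 with h | h
  · refine Set.finite_empty.subset fun s hs => ?_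
    obtain ⟨h2, -⟩ := hs
    omega
  · refine ((Finset.Ico (0 : ℤ) d).finite_toSet.image (AffSymm.simple h)).subset fun s hs => ?_
    obtain ⟨-, k, rfl⟩ := hs
    have hd0 : (0 : ℤ) < d := by omega
    refine ⟨k % d, ?_, ?_⟩
    · rw [Finset.mem_coe, Finset.mem_Ico]
      exact ⟨Int.emod_nonneg k hd0.ne', Int.emod_lt_of_pos k hd0⟩
    · refine Subtype.ext (ext_apply fun j => ?_)
      change AffSymm.simpleFun d (k % d) j = AffSymm.simpleFun d k j
      have h1 : k % d ≡ k [ZMOD d] := Int.mod_modEq k d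
      exact if_congr ⟨fun e => e.trans h1, fun e => e.trans h1.symm⟩ rfl
        (if_congr ⟨fun e => e.trans (h1.add_right 1), fun e => e.trans (h1.add_right 1).symm⟩ rfl
          rfl)

/-! ### The affine part -/

theorem tau_apply (k : ℤ) : (tau d).1 k = k + 1 := rfl

theorem tau_zpow_apply (m k : ℤ) : (tau d ^ m).1 k = k + m := by
  induction m using Int.induction_on generalizing k with
  | zero => rw [zpow_zero, add_zero]; rfl
  | succ m ih => rw [zpow_add_one, mul_apply, ih, tau_apply]; ring
  | pred m ih =>
    have h := ih (k - 1)
    rw [show (-(m : ℤ)) = -(m : ℤ) - 1 + 1 by ring, zpow_add_one, mul_apply, tau_apply,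
      sub_add_cancel] at h
    rw [h]; ring

theorem affPart_apply (x : ExtAffSymm d) (k : ℤ) : (affPart x).1.1 k = x.1 k - a x := by
  change (tau d ^ (-a x)).1 (x.1 k) = _
  rw [tau_zpow_apply, sub_eq_add_neg]

theorem excess_coe (t : AffSymm d) : excess t.1 = 0 := sub_eq_zero.2 t.2

theorem a_mul_coe (x : ExtAffSymm d) (t : AffSymm d) : a (x * t.1) = a x := by
  rw [a, a, excess_mul, excess_coe, add_zero]

theorem affPart_mul_coe (x : ExtAffSymm d) (t : AffSymm d) :
    affPart (x * t.1) = affPart x * t := by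
  refine Subtype.ext ?_
  change tau d ^ (-a (x * t.1)) * (x * t.1) = tau d ^ (-a x) * x * t.1
  rw [a_mul_coe, mul_assoc]

theorem tau_zpow_mul_affPart (x : ExtAffSymm d) : tau d ^ a x * (affPart x).1 = x := by
  change tau d ^ a x * (tau d ^ (-a x) * x) = x
  rw [← mul_assoc, ← zpow_add, add_neg_cancel, zpow_zero, one_mul]

theorem eq_of_affPart_eq {x y : ExtAffSymm d} (ha : a x = a y) (h : affPart x = affPart y) :
    x = y := by
  rw [← tau_zpow_mul_affPart x, ← tau_zpow_mul_affPart y, ha, h]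

theorem a_tau_zpow_mul (hd : 1 ≤ d) (m : ℤ) (u : AffSymm d) : a (tau d ^ m * u.1) = m := by
  rw [a_mul_coe, a, excess_tau_zpow, Int.mul_ediv_cancel _ (by omega)]

theorem affPart_tau_zpow_mul (hd : 1 ≤ d) (m : ℤ) (u : AffSymm d) :
    affPart (tau d ^ m * u.1) = u := by
  refine Subtype.ext ?_
  change tau d ^ (-a (tau d ^ m * u.1)) * (tau d ^ m * u.1) = u.1
  rw [a_tau_zpow_mul hd, ← mul_assoc, ← zpow_add, neg_add_cancel, zpow_zero, one_mul]

section

variable {b c : ℤ} (hbc : ¬ b ≡ c [ZMOD d])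

theorem a_mul_swap (x : ExtAffSymm d) : a (x * swap b c hbc) = a x := a_mul_coe x (affSwap hbc)

theorem affPart_mul_swap (x : ExtAffSymm d) :
    affPart (x * swap b c hbc) = affPart x * affSwap hbc := affPart_mul_coe x (affSwap hbc)

theorem mul_swap_mul_swap (x : ExtAffSymm d) : x * swap b c hbc * swap b c hbc = x := by
  rw [mul_assoc, swap_mul_self, mul_one]

theorem length_lt_mul_swap_iff (hd : 1 ≤ d) (x : ExtAffSymm d) (hlt : b < c) :
    length x < length (x * swap b c hbc) ↔ x.1 b < x.1 c := by
  rw [length, length, affPart_mul_swap, length_lt_mul_affSwap_iff hd _ hlt, affPart_apply,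
    affPart_apply, sub_lt_sub_iff_right]

theorem length_mul_swap_lt_iff (hd : 1 ≤ d) (x : ExtAffSymm d) (hlt : b < c) :
    length (x * swap b c hbc) < length x ↔ x.1 c < x.1 b := by
  have := length_lt_mul_swap_iff hbc hd (x * swap b c hbc) hlt
  rwa [mul_swap_mul_swap, mul_apply, mul_apply, swap_left, swap_right] at this

end

/-! ### The Bruhat order -/

/-- `z` is obtained from `x` by an affine transposition that increases the length. -/
def Edge (x z : ExtAffSymm d) : Prop :=
  ∃ (b c : ℤ) (hbc : ¬ b ≡ c [ZMOD d]), b < c ∧ x.1 b < x.1 c ∧ z = x * swap b c hbc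

/-- Powers of τ on the left add a constant to all values and preserve their order. `Edge` mentions
neither lengths nor `a`, so chains can be carried from one period to another. -/
theorem bruhatLE_iff (hd : 1 ≤ d) (y w : ExtAffSymm d) :
    BruhatLE y w ↔ Relation.ReflTransGen Edge y w := by
  constructor
  · rintro ⟨ha, h⟩
    have key : ∀ u v : AffSymm d, CoxeterPair.BruhatLE (AffSymm.gens d) u v →
        Relation.ReflTransGen Edge (tau d ^ a y * u.1) (tau d ^ a y * v.1) := by
      intro u v huv
      induction huv with
      | refl => exact Relation.ReflTransGen.refl
      | tail _ hbc ih =>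
        obtain ⟨t, ht, rfl, hlt⟩ := hbc
        obtain ⟨b, c, hbc, hlt', rfl⟩ := IsReflection.exists_affSwap ht
        refine ih.tail ⟨b, c, hbc, hlt', ?_, ?_⟩
        · rw [length_lt_mul_affSwap_iff hd _ hlt'] at hlt
          rw [mul_apply, mul_apply, tau_zpow_apply, tau_zpow_apply]
          exact add_lt_add_left hlt _
        · rw [mul_assoc]; rfl
    have := key _ _ h
    rwa [tau_zpow_mul_affPart, ha, tau_zpow_mul_affPart] at this
  · intro h
    induction h with
    | refl => exact ⟨rfl, Relation.ReflTransGen.refl⟩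
    | tail _ hbc ih =>
      obtain ⟨b, c, hbc, hlt, hx, rfl⟩ := hbc
      refine ⟨ih.1.trans (a_mul_swap hbc _).symm, ih.2.tail
        ⟨affSwap hbc, isReflection_affSwap hd hlt hbc, affPart_mul_swap hbc _, ?_⟩⟩
      exact (length_lt_mul_swap_iff hbc hd _ hlt).2 hx

theorem BruhatLE.refl (x : ExtAffSymm d) : BruhatLE x x := ⟨rfl, Relation.ReflTransGen.refl⟩

theorem BruhatLE.trans {x y z : ExtAffSymm d} (hxy : BruhatLE x y) (hyz : BruhatLE y z) :
    BruhatLE x z := ⟨hxy.1.trans hyz.1, CoxeterPair.BruhatLE.trans hxy.2 hyz.2⟩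

theorem BruhatLE.length_lt {x y : ExtAffSymm d} (hxy : BruhatLE x y) (hne : x ≠ y) :
    length x < length y :=
  CoxeterPair.BruhatLE.length_lt hxy.2 fun h => hne (eq_of_affPart_eq hxy.1 h)

theorem BruhatLE.mul_simple (hd : 2 ≤ d) {x y : ExtAffSymm d} (hxy : BruhatLE x y) {k : ℤ}
    (hk : ¬ k ≡ k + 1 [ZMOD d]) (hx : x.1 (k + 1) < x.1 k) :
    BruhatLE (x * swap k (k + 1) hk) (y * swap k (k + 1) hk) := by
  refine ⟨by rw [a_mul_swap, a_mul_swap, hxy.1], ?_⟩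
  have := (length_mul_swap_lt_iff hk (by omega) x (by omega)).2 hx
  rw [length, length, affPart_mul_swap] at this
  rw [affPart_mul_swap, affPart_mul_swap]
  exact (isCoxeterPair (by omega)).mul_le_mul (mem_gens_iff.2 ⟨hd, k, rfl⟩) hxy.2 this

theorem BruhatLE.mul_simple_le (hd : 2 ≤ d) {x y : ExtAffSymm d} (hxy : BruhatLE x y) {k : ℤ}
    (hk : ¬ k ≡ k + 1 [ZMOD d]) (hy : y.1 (k + 1) < y.1 k) :
    BruhatLE (x * swap k (k + 1) hk) y := by
  refine ⟨by rw [a_mul_swap, hxy.1], ?_⟩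
  have := (length_mul_swap_lt_iff hk (by omega) y (by omega)).2 hy
  rw [length, length, affPart_mul_swap] at this
  rw [affPart_mul_swap]
  exact (isCoxeterPair (by omega)).mul_le (mem_gens_iff.2 ⟨hd, k, rfl⟩) hxy.2 this

theorem bruhatLE_mul_swap (hd : 1 ≤ d) (x : ExtAffSymm d) {b c : ℤ} (hbc : ¬ b ≡ c [ZMOD d])
    (hlt : b < c) (hx : x.1 b < x.1 c) : BruhatLE x (x * swap b c hbc) :=
  (bruhatLE_iff hd _ _).2 (Relation.ReflTransGen.single ⟨b, c, hbc, hlt, hx, rfl⟩)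

theorem exists_descent_of_length_pos (hd : 1 ≤ d) (x : ExtAffSymm d) (hx : length x ≠ 0) :
    ∃ k, x.1 (k + 1) < x.1 k := by
  by_contra hc
  push Not at hc
  refine hx ?_
  rw [length, eq_one_of_no_descent hd (affPart x) fun k => ?_, CoxeterPair.length_one]
  rw [affPart_apply, affPart_apply, sub_lt_sub_iff_right]
  exact (lt_or_gt_apply_succ x k).resolve_right (not_lt.2 (hc k))

theorem length_eq_zero_iff (hd : 1 ≤ d) (x : ExtAffSymm d) :
    length x = 0 ↔ ∀ k, x.1 k < x.1 (k + 1) := by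
  constructor
  · intro h k
    refine (lt_or_gt_apply_succ x k).resolve_right fun hk => ?_
    have hd2 := two_le_of_descent hd x hk
    have := (length_mul_swap_lt_iff (simple_not_modEq hd2 k) hd x (by omega)).2 hk
    omega
  · intro h
    by_contra hc
    obtain ⟨k, hk⟩ := exists_descent_of_length_pos hd x hc
    have := h k
    omega

theorem length_mul_simple (hd : 2 ≤ d) (x : ExtAffSymm d) {k : ℤ} (hk : ¬ k ≡ k + 1 [ZMOD d])
    (hx : x.1 (k + 1) < x.1 k) : length (x * swap k (k + 1) hk) + 1 = length x := by
  have h1 := (length_mul_swap_lt_iff hk (by omega) x (by omega)).2 hx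
  have h2 := (isCoxeterPair (d := d) (by omega)).length_mul_gen
    (mem_gens_iff.2 ⟨hd, k, rfl⟩) (affPart x)
  rw [length, length, affPart_mul_swap] at *
  omega

/-! ### Counting -/

/-- The displacement x(k) - k has period d. Boundedness makes the sets counted below finite, so
`ncard` is a true cardinality. -/
theorem exists_bound (hd : 1 ≤ d) (x : ExtAffSymm d) : ∃ C : ℤ, ∀ k, |x.1 k - k| ≤ C := by
  refine ⟨∑ j ∈ Finset.Ico (0 : ℤ) d, |x.1 j - j|, fun k => ?_⟩
  have h1 : k = k % d + (k / d) * d := by rw [mul_comm]; exact (Int.emod_add_mul_ediv k d).symm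
  have h2 : x.1 k - k = x.1 (k % d) - k % d := by
    conv_lhs => rw [h1, apply_add_mul]
    ring
  rw [h2]
  refine Finset.single_le_sum (f := fun j => |x.1 j - j|) (fun j _ => abs_nonneg _) ?_
  rw [Finset.mem_Ico]
  exact ⟨Int.emod_nonneg k (by omega), Int.emod_lt_of_pos k (by omega)⟩

/-- The number of positions before `b` with a value at least `c`. -/
def countGE (x : ExtAffSymm d) (b c : ℤ) : ℕ := {k : ℤ | k < b ∧ c ≤ x.1 k}.ncard

/-- The number of positions after `b` with a value at most `c`. -/
def countLE (x : ExtAffSymm d) (b c : ℤ) : ℕ := {k : ℤ | b < k ∧ x.1 k ≤ c}.ncard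

theorem finite_countGE (hd : 1 ≤ d) (x : ExtAffSymm d) (b c : ℤ) :
    {k : ℤ | k < b ∧ c ≤ x.1 k}.Finite := by
  obtain ⟨C, hC⟩ := exists_bound hd x
  refine (Set.finite_Icc (c - C) b).subset fun k hk => ?_
  have := abs_le.1 (hC k)
  exact ⟨by linarith [hk.2], hk.1.le⟩

theorem finite_countLE (hd : 1 ≤ d) (x : ExtAffSymm d) (b c : ℤ) :
    {k : ℤ | b < k ∧ x.1 k ≤ c}.Finite := by
  obtain ⟨C, hC⟩ := exists_bound hd x
  refine (Set.finite_Icc b (c + C)).subset fun k hk => ?_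
  have := abs_le.1 (hC k)
  exact ⟨hk.1.le, by linarith [hk.2]⟩

theorem swap_lt_of_apply_lt (x : ExtAffSymm d) {b c : ℤ} (hbc : ¬ b ≡ c [ZMOD d]) (hlt : b < c)
    (hx : x.1 b < x.1 c) {k : ℤ} (hk : x.1 ((swap b c hbc).1 k) < x.1 k) :
    (swap b c hbc).1 k < k := by
  rw [swap_apply] at *
  rcases modEq_cases (d := d) b c k with ⟨m, rfl⟩ | ⟨m, rfl⟩ | ⟨hb, hc⟩
  · rw [swapFun_left, apply_add_mul, apply_add_mul] at hk
    linarith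
  · rw [swapFun_right hbc]
    linarith
  · rw [swapFun_of_not_modEq hb hc] at hk
    exact absurd hk (lt_irrefl _)

/-- A position k is kept if its new value is still at least v, and otherwise goes to s(k). In the
second case x(s(k)) < x(k), which forces s(k) < k because x(b) < x(c), so the image stays below p.
-/
theorem countGE_mul_swap (hd : 1 ≤ d) (x : ExtAffSymm d) {b c : ℤ} (hbc : ¬ b ≡ c [ZMOD d])
    (hlt : b < c) (hx : x.1 b < x.1 c) (p v : ℤ) :
    countGE x p v ≤ countGE (x * swap b c hbc) p v := by
  let s := (swap b c hbc).1
  have hss : ∀ k, s (s k) = k := swap_swap_apply hbc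
  have hs : ∀ k, x.1 (s k) < x.1 k → s k < k := fun k => swap_lt_of_apply_lt x hbc hlt hx
  refine Set.ncard_le_ncard_of_injOn (fun k => if v ≤ x.1 (s k) then k else s k) ?_ ?_
    (finite_countGE hd _ p v)
  · rintro k ⟨hk1, hk2⟩
    split_ifs with h
    · exact ⟨hk1, h⟩
    · refine ⟨(hs k (by omega)).trans hk1, ?_⟩
      change v ≤ x.1 (s (s k))
      rwa [hss]
  · rintro k ⟨hk1, hk2⟩ l ⟨hl1, hl2⟩ hkl
    simp only at hkl
    split_ifs at hkl with h1 h2 h2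
    · exact hkl
    · subst hkl
      exact absurd hk2 h2
    · subst hkl
      exact absurd hl2 h1
    · exact s.injective hkl

theorem countLE_mul_swap (hd : 1 ≤ d) (x : ExtAffSymm d) {b c : ℤ} (hbc : ¬ b ≡ c [ZMOD d])
    (hlt : b < c) (hx : x.1 b < x.1 c) (p v : ℤ) :
    countLE x p v ≤ countLE (x * swap b c hbc) p v := by
  let s := (swap b c hbc).1
  have hss : ∀ k, s (s k) = k := swap_swap_apply hbc
  have hs : ∀ k, x.1 k < x.1 (s k) → k < s k := fun k h => by
    have := swap_lt_of_apply_lt x hbc hlt hx (k := s k)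
    change x.1 (s (s k)) < x.1 (s k) → s (s k) < s k at this
    rw [hss] at this
    exact this h
  refine Set.ncard_le_ncard_of_injOn (fun k => if x.1 (s k) ≤ v then k else s k) ?_ ?_
    (finite_countLE hd _ p v)
  · rintro k ⟨hk1, hk2⟩
    split_ifs with h
    · exact ⟨hk1, h⟩
    · refine ⟨hk1.trans (hs k (by omega)), ?_⟩
      change x.1 (s (s k)) ≤ v
      rwa [hss]
  · rintro k ⟨hk1, hk2⟩ l ⟨hl1, hl2⟩ hkl
    simp only at hkl
    split_ifs at hkl with h1 h2 h2
    · exact hkl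
    · subst hkl
      exact absurd hk2 h2
    · subst hkl
      exact absurd hl2 h1
    · exact s.injective hkl

theorem BruhatLE.countGE_le (hd : 1 ≤ d) {x y : ExtAffSymm d} (hxy : BruhatLE x y) (p v : ℤ) :
    countGE x p v ≤ countGE y p v := by
  rw [bruhatLE_iff hd] at hxy
  induction hxy with
  | refl => exact le_rfl
  | tail _ hbc ih =>
    obtain ⟨b, c, hbc, hlt, hx, rfl⟩ := hbc
    exact ih.trans (countGE_mul_swap hd _ hbc hlt hx p v)

theorem BruhatLE.countLE_le (hd : 1 ≤ d) {x y : ExtAffSymm d} (hxy : BruhatLE x y) (p v : ℤ) :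
    countLE x p v ≤ countLE y p v := by
  rw [bruhatLE_iff hd] at hxy
  induction hxy with
  | refl => exact le_rfl
  | tail _ hbc ih =>
    obtain ⟨b, c, hbc, hlt, hx, rfl⟩ := hbc
    exact ih.trans (countLE_mul_swap hd _ hbc hlt hx p v)

theorem countGE_succ_of_le (hd : 1 ≤ d) (x : ExtAffSymm d) {p v : ℤ} (h : v ≤ x.1 p) :
    countGE x (p + 1) v = countGE x p v + 1 := by
  have hset : {k : ℤ | k < p + 1 ∧ v ≤ x.1 k} = insert p {k : ℤ | k < p ∧ v ≤ x.1 k} := by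
    ext k
    simp only [Set.mem_ofPred_eq, Set.mem_insert_iff]
    constructor
    · rintro ⟨h1, h2⟩
      rcases eq_or_ne k p with h3 | h3
      · exact Or.inl h3
      · exact Or.inr ⟨by omega, h2⟩
    · rintro (rfl | ⟨h1, h2⟩)
      · exact ⟨by omega, h⟩
      · exact ⟨by omega, h2⟩
  rw [countGE, hset, Set.ncard_insert_of_notMem (fun h => lt_irrefl _ h.1) (finite_countGE hd x p v),
    countGE]

theorem countGE_succ_of_gt (x : ExtAffSymm d) {p v : ℤ} (h : x.1 p < v) :
    countGE x (p + 1) v = countGE x p v := by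
  rw [countGE, countGE]
  congr 1
  ext k
  simp only [Set.mem_ofPred_eq]
  refine and_congr_left fun h1 => ?_
  have : k ≠ p := by rintro rfl; omega
  omega

theorem invBelow_eq_countGE_succ (x : ExtAffSymm d) (i : ℤ) :
    invBelow i x = countGE x i (x.1 i + 1) := rfl

theorem invBelow_eq_countGE (x : ExtAffSymm d) (i : ℤ) : invBelow i x = countGE x i (x.1 i) := by
  rw [invBelow, countGE]
  congr 1
  ext k
  simp only [Set.mem_ofPred_eq]
  refine and_congr_right fun h1 => ⟨le_of_lt, fun h2 => lt_of_le_of_ne h2 fun h3 => ?_⟩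
  have := x.1.injective h3
  omega

theorem invAbove_eq_countLE (x : ExtAffSymm d) (i : ℤ) :
    invAbove i x = countLE x i (x.1 i - 1) := by
  rw [invAbove, countLE]
  congr 1
  ext k
  simp only [Set.mem_ofPred_eq]
  omega

/-- Cancellable positions take constant values and have constant numbers of inversions on the
interval. -/
theorem Cancellable.apply_eq_of_mem (hd : 1 ≤ d) {i : ℤ} {y w x : ExtAffSymm d}
    (h : Cancellable i y w) (hx : x ∈ interval y w) :
    x.1 i = y.1 i ∧ invBelow i x = invBelow i y ∧ invAbove i x = invAbove i y := by
  obtain ⟨hyx, hxw⟩ := hx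
  obtain ⟨-, hi, hb, ha⟩ := h
  -- With v = y(i), the counts at (i, v), (i, v+1), (i+1, v+1) equal inv_i and the one at (i+1, v)
  -- equals inv_i + 1, for y and w alike. Monotonicity gives x the same four counts. Passing from i
  -- to i + 1 adds one exactly when x(i) reaches the threshold; this happens at v and not at v + 1,
  -- so x(i) = v.
  have l1 := fun p v => hyx.countGE_le hd p v
  have l2 := fun p v => hxw.countGE_le hd p v
  have e1 := invBelow_eq_countGE_succ y i
  have e2 := invBelow_eq_countGE_succ w i
  have e3 := invBelow_eq_countGE y i
  have e4 := invBelow_eq_countGE w i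
  have e5 := countGE_succ_of_le hd y (le_refl (y.1 i))
  have e6 := countGE_succ_of_le hd w (le_refl (w.1 i))
  have e7 := countGE_succ_of_gt y (lt_add_one (y.1 i))
  have e8 := countGE_succ_of_gt w (lt_add_one (w.1 i))
  rw [← hi] at e2 e4 e6 e8
  have m1 := l1 i (y.1 i)
  have m2 := l2 i (y.1 i)
  have m3 := l1 i (y.1 i + 1)
  have m4 := l2 i (y.1 i + 1)
  have m5 := l1 (i + 1) (y.1 i)
  have m6 := l2 (i + 1) (y.1 i)
  have m7 := l1 (i + 1) (y.1 i + 1)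
  have m8 := l2 (i + 1) (y.1 i + 1)
  have hxi : x.1 i = y.1 i := by
    refine le_antisymm (not_lt.1 fun h1 => ?_) (not_lt.1 fun h1 => ?_)
    · have := countGE_succ_of_le hd x (p := i) (v := y.1 i + 1) h1
      omega
    · have := countGE_succ_of_gt x h1
      omega
  refine ⟨hxi, ?_, ?_⟩
  · rw [invBelow_eq_countGE x, hxi]
    omega
  · have h1 := hyx.countLE_le hd i (y.1 i - 1)
    have h2 := hxw.countLE_le hd i (y.1 i - 1)
    have h3 := invAbove_eq_countLE w i
    rw [← hi] at h3
    rw [invAbove_eq_countLE x, invAbove_eq_countLE y, hxi]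
    rw [invAbove_eq_countLE y] at ha
    omega

theorem Cancellable.of_mem (hd : 1 ≤ d) {i : ℤ} {y w u v : ExtAffSymm d}
    (h : Cancellable i y w) (hu : u ∈ interval y w) (hv : v ∈ interval y w)
    (huv : BruhatLE u v) : Cancellable i u v := by
  have h1 := h.apply_eq_of_mem hd hu
  have h2 := h.apply_eq_of_mem hd hv
  exact ⟨huv, by rw [h1.1, h2.1], by rw [h1.2.1, h2.2.1], by rw [h1.2.2, h2.2.2]⟩

variable {n : ℕ}

/-! ### Cancelling a position -/

/-- The map `e` is an order isomorphism from `ℤ` to the integers that are not congruent to `i`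
mod `d`, and carries translation by `n` to translation by `d`. -/
structure Skip (d n : ℕ) (i : ℤ) (e : ℤ → ℤ) : Prop where
  mono : StrictMono e
  range : ∀ k, (∃ m, e m = k) ↔ ¬ k ≡ i [ZMOD d]
  shift : ∀ k, e (k + n) = e k + d

namespace Skip

variable {i : ℤ} {e : ℤ → ℤ} (h : Skip d n i e)
include h

theorem not_modEq (m : ℤ) : ¬ e m ≡ i [ZMOD d] := (h.range _).1 ⟨m, rfl⟩

theorem shift_mul (k m : ℤ) : e (k + m * n) = e k + m * d := by
  induction m using Int.induction_on with
  | zero => simp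
  | succ m ih =>
    rw [show k + ((m : ℤ) + 1) * n = k + m * n + n by ring, h.shift, ih]; ring
  | pred m ih =>
    have := h.shift (k + (-(m : ℤ) - 1) * n)
    rw [show k + (-(m : ℤ) - 1) * n + n = k + -(m : ℤ) * n by ring, ih] at this
    linarith

theorem modEq_iff (k l : ℤ) : e k ≡ e l [ZMOD d] ↔ k ≡ l [ZMOD n] := by
  constructor
  · intro hkl
    obtain ⟨m, hm⟩ := exists_eq_add_of_modEq hkl
    rw [← h.shift_mul] at hm
    rw [h.mono.injective hm]
    exact add_mul_modEq l m
  · intro hkl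
    obtain ⟨m, rfl⟩ := exists_eq_add_of_modEq hkl
    rw [h.shift_mul]
    exact add_mul_modEq _ m

theorem swapFun_apply {b c : ℤ} (hbc : ¬ b ≡ c [ZMOD n]) (k : ℤ) :
    swapFun d (e b) (e c) (e k) = e (swapFun n b c k) := by
  have hbc' := mt (h.modEq_iff b c).1 hbc
  rcases modEq_cases (d := n) b c k with ⟨m, rfl⟩ | ⟨m, rfl⟩ | ⟨hb, hc⟩
  · rw [h.shift_mul, swapFun_left, swapFun_left, h.shift_mul]
  · rw [h.shift_mul, swapFun_right hbc', swapFun_right hbc, h.shift_mul]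
  · rw [swapFun_of_not_modEq hb hc, swapFun_of_not_modEq (mt (h.modEq_iff k b).1 hb)
      (mt (h.modEq_iff k c).1 hc)]

/-- Nothing lies strictly between k and k + 1, so simple transpositions avoiding the omitted class
remain simple after cancelling. -/
theorem exists_succ {k : ℤ} (hk : ¬ k ≡ i [ZMOD d]) (hk1 : ¬ k + 1 ≡ i [ZMOD d]) :
    ∃ m, e m = k ∧ e (m + 1) = k + 1 := by
  obtain ⟨m, hm⟩ := (h.range k).2 hk
  obtain ⟨l, hl⟩ := (h.range (k + 1)).2 hk1
  refine ⟨m, hm, ?_⟩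
  have h1 : m < l := h.mono.lt_iff_lt.1 (by omega)
  have h2 : e (m + 1) ≤ e l := h.mono.monotone h1
  have h3 : e m < e (m + 1) := h.mono (by omega)
  omega

/-- Moving the omitted class by a simple transposition. -/
theorem move (hd : 2 ≤ d) (k : ℤ) (hk : ¬ k ≡ k + 1 [ZMOD d])
    (hi : (swap k (k + 1) hk).1 i ≠ i) :
    Skip d n ((swap k (k + 1) hk).1 i) (fun m => (swap k (k + 1) hk).1 (e m)) where
  mono := by
    intro l m hlm
    have hlt := h.mono hlm
    by_cases hc : e l ≡ e m [ZMOD d]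
    · obtain ⟨r, hr⟩ := exists_eq_add_of_modEq hc
      dsimp only
      rw [hr, apply_add_mul]
      omega
    -- A reversal would make this the transposition of `e l` and `e m`, which lie outside the class
    -- of i; it would then fix i.
    · rcases simple_swap_lt_or hd k hlt hc with h1 | h1
      · exact h1
      · rw [← h1] at hi
        exact absurd (swap_of_not_modEq hc (fun h2 => h.not_modEq l h2.symm)
          (fun h2 => h.not_modEq m h2.symm)) hi
  range := by
    intro l
    have h1 : (∃ m, (swap k (k + 1) hk).1 (e m) = l) ↔
        ∃ m, e m = (swap k (k + 1) hk).1 l := by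
      refine exists_congr fun m => ⟨?_, ?_⟩
      · rintro rfl; rw [swap_swap_apply]
      · intro h2; rw [h2, swap_swap_apply]
    rw [h1, h.range, ← modEq_apply_iff (swap k (k + 1) hk), swap_swap_apply]
  shift := by
    intro l
    rw [h.shift, apply_add]

end Skip

/-- The permutation `z` is the result of cancelling a position from `x`, relative to the
parametrisations `e` of the other positions and `f` of the other values. -/
def IsCancel (e f : ℤ → ℤ) (x : ExtAffSymm d) (z : ExtAffSymm n) : Prop :=
  ∀ k, f (z.1 k) = x.1 (e k)

section

variable {i j : ℤ} {e f : ℤ → ℤ}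

theorem IsCancel.mul_swap (he : Skip d n i e) {x : ExtAffSymm d} {z : ExtAffSymm n}
    (h : IsCancel e f x z) {b c : ℤ} (hbc : ¬ b ≡ c [ZMOD n]) (hbc' : ¬ e b ≡ e c [ZMOD d]) :
    IsCancel e f (x * swap (e b) (e c) hbc') (z * swap b c hbc) := fun k => by
  rw [mul_apply, mul_apply, swap_apply, swap_apply, h, he.swapFun_apply hbc]

/-- The parametrisation absorbs the transposition and `z` stays the same. This handles descents
involving the omitted position. -/
theorem IsCancel.move {x : ExtAffSymm d} {z : ExtAffSymm n} (h : IsCancel e f x z) (k : ℤ)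
    (hk : ¬ k ≡ k + 1 [ZMOD d]) :
    IsCancel (fun m => (swap k (k + 1) hk).1 (e m)) f (x * swap k (k + 1) hk) z := fun m => by
  rw [mul_apply, swap_swap_apply, h]

theorem IsCancel.eq_of_apply_eq (he : Skip d n i e) {x y : ExtAffSymm d} {z : ExtAffSymm n}
    (hx : IsCancel e f x z) (hy : IsCancel e f y z) (hxy : x.1 i = y.1 i) : x = y := by
  refine ext_apply fun k => ?_
  by_cases hk : k ≡ i [ZMOD d]
  · obtain ⟨m, rfl⟩ := exists_eq_add_of_modEq hk
    rw [apply_add_mul, apply_add_mul, hxy]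
  · obtain ⟨m, rfl⟩ := (he.range k).2 hk
    rw [← hx, ← hy]

theorem IsCancel.unique (hf : Skip d n j f) {x : ExtAffSymm d} {z z' : ExtAffSymm n}
    (h : IsCancel e f x z) (h' : IsCancel e f x z') : z = z' :=
  ext_apply fun k => hf.mono.injective (by rw [h, h'])

theorem IsCancel.lt_iff (hf : Skip d n j f) {x : ExtAffSymm d} {z : ExtAffSymm n}
    (h : IsCancel e f x z) (k l : ℤ) : z.1 k < z.1 l ↔ x.1 (e k) < x.1 (e l) := by
  rw [← h, ← h, hf.mono.lt_iff_lt]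

/-- A transposition of b and c lifts to one of `e b` and `e c`, with positions and values in the
same order. It avoids the class of i and so keeps the value there. -/
theorem IsCancel.exists_lift (he : Skip d n i e) (hf : Skip d n j f) {x : ExtAffSymm d}
    {z z' : ExtAffSymm n} (h : IsCancel e f x z) (hz : Relation.ReflTransGen Edge z z') :
    ∃ x', Relation.ReflTransGen Edge x x' ∧ IsCancel e f x' z' ∧ x'.1 i = x.1 i := by
  induction hz with
  | refl => exact ⟨x, Relation.ReflTransGen.refl, h, rfl⟩
  | tail _ hbc ih =>
    obtain ⟨x', hxx', hx', hi⟩ := ih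
    obtain ⟨b, c, hbc, hlt, hz, rfl⟩ := hbc
    have hbc' := mt (he.modEq_iff b c).1 hbc
    refine ⟨_, hxx'.tail ⟨e b, e c, hbc', he.mono hlt, (hx'.lt_iff hf b c).1 hz, rfl⟩,
      hx'.mul_swap he hbc hbc', ?_⟩
    rw [mul_apply, swap_of_not_modEq hbc' (fun h1 => he.not_modEq b h1.symm)
      (fun h1 => he.not_modEq c h1.symm), hi]

theorem IsCancel.exists_le (hd : 1 ≤ d) (hn : 1 ≤ n) (he : Skip d n i e) (hf : Skip d n j f)
    {x : ExtAffSymm d} {z z' : ExtAffSymm n} (h : IsCancel e f x z) (hz : BruhatLE z z') :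
    ∃ x', BruhatLE x x' ∧ IsCancel e f x' z' ∧ x'.1 i = x.1 i := by
  simp only [bruhatLE_iff hd]
  exact h.exists_lift he hf ((bruhatLE_iff hn _ _).1 hz)

/-- The lifted chain ends at `y`, because the cancelled permutation and the value at i determine the
permutation. Equal values at i suffice here; cancellability is not needed. -/
theorem IsCancel.le_of_le (hd : 1 ≤ d) (hn : 1 ≤ n) (he : Skip d n i e) (hf : Skip d n j f)
    {x y : ExtAffSymm d} {z z' : ExtAffSymm n} (hx : IsCancel e f x z) (hy : IsCancel e f y z')
    (hxy : x.1 i = y.1 i) (hz : BruhatLE z z') : BruhatLE x y := by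
  obtain ⟨x', hxx', hx', hi⟩ := hx.exists_le hd hn he hf hz
  rwa [hx'.eq_of_apply_eq he hy (hi.trans hxy)] at hxx'

/-- Every chain from x to y stays in [x,y], where the value at i is constant. No step can then
involve the class of i, and each step descends. -/
theorem IsCancel.exists_of_le (hd : 1 ≤ d) (hn : 1 ≤ n) (he : Skip d n i e) (hf : Skip d n j f)
    {x y : ExtAffSymm d} {z : ExtAffSymm n} (hx : IsCancel e f x z) (hxy : Cancellable i x y) :
    ∃ z', IsCancel e f y z' ∧ BruhatLE z z' := by
  have key : ∀ v, Relation.ReflTransGen Edge x v → BruhatLE v y →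
      ∃ z', IsCancel e f v z' ∧ BruhatLE z z' := by
    intro v hxv
    induction hxv with
    | refl => exact fun _ => ⟨z, hx, BruhatLE.refl z⟩
    | @tail u v hxu huv ih =>
      intro hvy
      obtain ⟨b, c, hbc, hlt, hu, rfl⟩ := huv
      have huv := bruhatLE_mul_swap hd u hbc hlt hu
      have hxu' := (bruhatLE_iff hd _ _).2 hxu
      obtain ⟨z', hz', hzz'⟩ := ih (huv.trans hvy)
      have e1 := (hxy.apply_eq_of_mem hd ⟨hxu', huv.trans hvy⟩).1
      have e2 := (hxy.apply_eq_of_mem hd ⟨hxu'.trans huv, hvy⟩).1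
      rw [← e1, mul_apply] at e2
      have e3 := u.1.injective e2
      rw [swap_apply] at e3
      rcases modEq_cases (d := d) b c i with ⟨m, rfl⟩ | ⟨m, rfl⟩ | ⟨hb, hc⟩
      · rw [swapFun_left] at e3
        omega
      · rw [swapFun_right hbc] at e3
        omega
      · obtain ⟨b', rfl⟩ := (he.range b).2 fun h1 => hb h1.symm
        obtain ⟨c', rfl⟩ := (he.range c).2 fun h1 => hc h1.symm
        have hbc' := mt (he.modEq_iff b' c').2 hbc
        exact ⟨_, hz'.mul_swap he hbc' hbc, hzz'.trans (bruhatLE_mul_swap hn z' hbc'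
          (he.mono.lt_iff_lt.1 hlt) ((hz'.lt_iff hf b' c').2 hu))⟩
  exact key y ((bruhatLE_iff hd _ _).1 hxy.le) (BruhatLE.refl y)

theorem IsCancel.le (hd : 1 ≤ d) (hn : 1 ≤ n) (he : Skip d n i e) (hf : Skip d n j f)
    {x y : ExtAffSymm d} {z z' : ExtAffSymm n} (hx : IsCancel e f x z) (hy : IsCancel e f y z')
    (hxy : Cancellable i x y) : BruhatLE z z' := by
  obtain ⟨z'', hz, hle⟩ := hx.exists_of_le hd hn he hf hxy
  rwa [hz.unique hf hy] at hle

end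

/-! ### Inversions and simple transpositions -/

theorem simple_swap_bound {k : ℤ} (hk : ¬ k ≡ k + 1 [ZMOD d]) (m : ℤ) :
    m - 1 ≤ (swap k (k + 1) hk).1 m ∧ (swap k (k + 1) hk).1 m ≤ m + 1 := by
  rw [swap_apply]
  rcases modEq_cases (d := d) k (k + 1) m with ⟨r, rfl⟩ | ⟨r, rfl⟩ | ⟨hb, hc⟩
  · rw [swapFun_left]; omega
  · rw [swapFun_right hk]; omega
  · rw [swapFun_of_not_modEq hb hc]; omega

theorem invBelow_mul (x s : ExtAffSymm d) (i : ℤ) (hs : ∀ m, s.1 (s.1 m) = m) :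
    invBelow i (x * s) = {m : ℤ | s.1 m < i ∧ x.1 (s.1 i) < x.1 m}.ncard := by
  rw [invBelow, ← Set.ncard_image_of_injective _ s.1.injective]
  congr 1
  ext m
  simp only [Set.mem_image, Set.mem_ofPred_eq, mul_apply]
  constructor
  · rintro ⟨l, ⟨h1, h2⟩, rfl⟩
    exact ⟨by rwa [hs], h2⟩
  · rintro ⟨h1, h2⟩
    exact ⟨s.1 m, ⟨h1, by rwa [hs]⟩, hs m⟩

theorem invAbove_mul (x s : ExtAffSymm d) (i : ℤ) (hs : ∀ m, s.1 (s.1 m) = m) :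
    invAbove i (x * s) = {m : ℤ | i < s.1 m ∧ x.1 m < x.1 (s.1 i)}.ncard := by
  rw [invAbove, ← Set.ncard_image_of_injective _ s.1.injective]
  congr 1
  ext m
  simp only [Set.mem_image, Set.mem_ofPred_eq, mul_apply]
  constructor
  · rintro ⟨l, ⟨h1, h2⟩, rfl⟩
    exact ⟨by rwa [hs], h2⟩
  · rintro ⟨h1, h2⟩
    exact ⟨s.1 m, ⟨h1, by rwa [hs]⟩, hs m⟩

theorem finite_invBelow (hd : 1 ≤ d) (x : ExtAffSymm d) (i : ℤ) :
    {m : ℤ | m < i ∧ x.1 i < x.1 m}.Finite := finite_countGE hd x i (x.1 i + 1)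

theorem finite_invAbove (hd : 1 ≤ d) (x : ExtAffSymm d) (i : ℤ) :
    {m : ℤ | i < m ∧ x.1 m < x.1 i}.Finite :=
  (finite_countLE hd x i (x.1 i)).subset fun _ hm => ⟨hm.1, hm.2.le⟩

theorem ncard_add_one_of_iff {A B : Set ℤ} {k : ℤ} (hB : B.Finite) (hk : k ∈ B)
    (h : ∀ m, m ∈ A ↔ m ∈ B ∧ m ≠ k) : A.ncard + 1 = B.ncard := by
  have hA : A = B \ {k} := Set.ext fun m => h m
  rw [hA]
  exact Set.ncard_sdiff_singleton_add_one hk hB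

/-- A simple transposition moves integers by at most one, so if it fixes i it carries no position
across i. -/
theorem inv_mul_simple_of_fixed (x : ExtAffSymm d) {k : ℤ} (hk : ¬ k ≡ k + 1 [ZMOD d]) {i : ℤ}
    (hi : (swap k (k + 1) hk).1 i = i) :
    invBelow i (x * swap k (k + 1) hk) = invBelow i x ∧
      invAbove i (x * swap k (k + 1) hk) = invAbove i x := by
  have hb := simple_swap_bound hk
  have hs := swap_swap_apply hk
  have hne : ∀ m, m ≠ i → (swap k (k + 1) hk).1 m ≠ i := fun m hm e => hm (by rw [← hs m, e, hi])
  rw [invBelow_mul x _ _ hs, invAbove_mul x _ _ hs, hi]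
  constructor
  · rw [invBelow]
    congr 1
    ext m
    simp only [Set.mem_ofPred_eq]
    refine and_congr_left fun h1 => ?_
    have h2 : m ≠ i := by rintro rfl; omega
    have := hb m
    have := hne m h2
    omega
  · rw [invAbove]
    congr 1
    ext m
    simp only [Set.mem_ofPred_eq]
    refine and_congr_left fun h1 => ?_
    have h2 : m ≠ i := by rintro rfl; omega
    have := hb m
    have := hne m h2
    omega

section

variable (hd : 2 ≤ d) (x : ExtAffSymm d) {k : ℤ} (hk : ¬ k ≡ k + 1 [ZMOD d])
include hd

/-- The entry at k moves to k + 1 and loses only its inversion with the former entry there.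
`inv_mul_simple_right` is the mirror image. -/
theorem inv_mul_simple_left (hx : x.1 (k + 1) < x.1 k) :
    invBelow (k + 1) (x * swap k (k + 1) hk) = invBelow k x ∧
      invAbove (k + 1) (x * swap k (k + 1) hk) + 1 = invAbove k x := by
  have hb := simple_swap_bound hk
  have hs := swap_swap_apply hk
  have hl := swap_left hk
  have hr := swap_right hk
  rw [invBelow_mul x _ _ hs, invAbove_mul x _ _ hs, hr]
  constructor
  · rw [invBelow]
    congr 1
    ext m
    simp only [Set.mem_ofPred_eq]
    refine and_congr_left fun h1 => ?_
    have h2 : m ≠ k := by rintro rfl; omega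
    have h3 : m ≠ k + 1 := by rintro rfl; omega
    have := hb m
    omega
  · refine ncard_add_one_of_iff (finite_invAbove (by omega) x k) (k := k + 1) ⟨by omega, hx⟩
      fun m => ?_
    simp only [Set.mem_ofPred_eq]
    rw [and_right_comm]
    refine and_congr_left fun h1 => ?_
    have h2 : m ≠ k := by rintro rfl; omega
    have h4 : (swap k (k + 1) hk).1 m ≠ k + 1 := fun e => h2 (by rw [← hs m, e, hr])
    have := hb m
    constructor
    · intro h5
      have h3 : m ≠ k + 1 := by rintro rfl; omega
      omega
    · omega

theorem inv_mul_simple_right (hx : x.1 (k + 1) < x.1 k) :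
    invBelow k (x * swap k (k + 1) hk) + 1 = invBelow (k + 1) x ∧
      invAbove k (x * swap k (k + 1) hk) = invAbove (k + 1) x := by
  have hb := simple_swap_bound hk
  have hs := swap_swap_apply hk
  have hl := swap_left hk
  have hr := swap_right hk
  rw [invBelow_mul x _ _ hs, invAbove_mul x _ _ hs, hl]
  constructor
  · refine ncard_add_one_of_iff (finite_invBelow (by omega) x (k + 1)) (k := k) ⟨by omega, hx⟩
      fun m => ?_
    simp only [Set.mem_ofPred_eq]
    rw [and_right_comm]
    refine and_congr_left fun h1 => ?_
    have h2 : m ≠ k + 1 := by rintro rfl; omega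
    have h4 : (swap k (k + 1) hk).1 m ≠ k := fun e => h2 (by rw [← hs m, e, hl])
    have := hb m
    constructor
    · intro h5
      have h3 : m ≠ k := by rintro rfl; omega
      omega
    · omega
  · rw [invAbove]
    congr 1
    ext m
    simp only [Set.mem_ofPred_eq]
    refine and_congr_left fun h1 => ?_
    have h2 : m ≠ k := by rintro rfl; omega
    have h3 : m ≠ k + 1 := by rintro rfl; omega
    have := hb m
    omega

end

section

variable {i j : ℤ} {e f : ℤ → ℤ}

/-- A position with a descent next to the position `i`, or away from it. -/
theorem descent_cases (x : ExtAffSymm d) (i : ℤ) {k : ℤ} (hk : x.1 (k + 1) < x.1 k) :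
    x.1 (i + 1) < x.1 i ∨ (∃ l, l + 1 = i ∧ x.1 (l + 1) < x.1 l) ∨
      (¬ k ≡ i [ZMOD d] ∧ ¬ k + 1 ≡ i [ZMOD d]) := by
  by_cases h1 : k ≡ i [ZMOD d]
  · left
    obtain ⟨m, rfl⟩ := exists_eq_add_of_modEq h1
    rw [add_right_comm, apply_add_mul, apply_add_mul] at hk
    linarith
  · by_cases h2 : k + 1 ≡ i [ZMOD d]
    · right; left
      obtain ⟨m, hm⟩ := exists_eq_add_of_modEq h2
      refine ⟨i - 1, by ring, ?_⟩
      rw [hm, show k = i - 1 + m * d by linarith, apply_add_mul, apply_add_mul] at hk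
      rw [sub_add_cancel]
      linarith
    · exact Or.inr (Or.inr ⟨h1, h2⟩)

/-- The length after cancelling a position. -/
theorem IsCancel.length_eq (hd : 1 ≤ d) (hn : 1 ≤ n) (hf : Skip d n j f) (he : Skip d n i e)
    {x : ExtAffSymm d} {z : ExtAffSymm n} (h : IsCancel e f x z) :
    length x = length z + (invBelow i x + invAbove i x) := by
  induction hN : length x generalizing x z i e with
  | zero =>
    have h0 := (length_eq_zero_iff hd x).1 hN
    have hmono : StrictMono x.1 := strictMono_int_of_lt_succ h0
    have hz : length z = 0 := (length_eq_zero_iff hn z).2 fun k =>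
      (h.lt_iff hf k (k + 1)).2 (hmono (he.mono (by omega)))
    have h1 : invBelow i x = 0 := by
      rw [invBelow]
      convert Set.ncard_empty ℤ
      refine Set.eq_empty_of_forall_notMem fun m hm => ?_
      exact absurd (hmono hm.1) (not_lt.2 hm.2.le)
    have h2 : invAbove i x = 0 := by
      rw [invAbove]
      convert Set.ncard_empty ℤ
      refine Set.eq_empty_of_forall_notMem fun m hm => ?_
      exact absurd (hmono hm.1) (not_lt.2 hm.2.le)
    rw [hz, h1, h2]
  | succ N ih =>
    obtain ⟨k, hk⟩ := exists_descent_of_length_pos hd x (by omega)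
    have hd2 := two_le_of_descent hd x hk
    -- Moving i across an adjacent descent keeps `z` and removes one inversion of i. A descent away
    -- from i is also one of `z`, and removing it shortens both permutations while keeping the
    -- inversions of i.
    rcases descent_cases x i hk with h1 | ⟨l, rfl, h1⟩ | ⟨h1, h2⟩
    · have hs := simple_not_modEq hd2 i
      have hl := length_mul_simple hd2 x hs h1
      have hi := swap_left hs
      have := ih (i := i + 1) (by simpa only [hi] using he.move hd2 i hs (by omega))
        (h.move i hs) (by omega)
      have h3 := inv_mul_simple_left hd2 x hs h1
      omega
    · have hs := simple_not_modEq hd2 l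
      have hl := length_mul_simple hd2 x hs h1
      have hi := swap_right hs
      have := ih (i := l) (by simpa only [hi] using he.move hd2 l hs (by omega))
        (h.move l hs) (by omega)
      have h3 := inv_mul_simple_right hd2 x hs h1
      omega
    · have hs := simple_not_modEq hd2 k
      obtain ⟨m, rfl, hm⟩ := he.exists_succ h1 h2
      simp only [← hm] at hs hk h2
      have hl : length (x * swap (e m) (e (m + 1)) hs) + 1 = length x := by
        simp only [hm] at hs hk ⊢
        exact length_mul_simple hd2 x hs hk
      have hs' := mt (he.modEq_iff m (m + 1)).2 hs
      have hzk := (h.lt_iff hf (m + 1) m).2 hk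
      have hlz := length_mul_simple (two_le_of_descent hn z hzk) z hs' hzk
      have := ih he (h.mul_swap he hs' hs) (by omega)
      have h3 : invBelow i (x * swap (e m) (e (m + 1)) hs) = invBelow i x ∧
          invAbove i (x * swap (e m) (e (m + 1)) hs) = invAbove i x := by
        have h4 : (swap (e m) (e (m + 1)) hs).1 i = i :=
          swap_of_not_modEq hs (fun h5 => h1 h5.symm) (fun h5 => h2 h5.symm)
        simp only [hm] at hs h4 ⊢
        exact inv_mul_simple_of_fixed x hs h4
      omega

end

/-! ### The polynomials `R_{x,y}` -/

/-- The polynomial `R_{x,y}` of the affine parts of `x` and `y`, as a Laurent polynomial. -/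
def rPoly (hd : 1 ≤ d) (x y : ExtAffSymm d) : ℤ[T;T⁻¹] :=
  (isCoxeterPair hd).rPoly (affPart x) (affPart y)

theorem rPoly_self (hd : 1 ≤ d) (x : ExtAffSymm d) : rPoly hd x x = 1 :=
  (isCoxeterPair hd).rPoly_self _

theorem rPoly_eq_zero (hd : 1 ≤ d) {x y : ExtAffSymm d} (ha : a x = a y) (hxy : ¬ BruhatLE x y) :
    rPoly hd x y = 0 :=
  by_contra fun h => hxy ⟨ha, (isCoxeterPair hd).le_of_rPoly_ne_zero h⟩

section

variable (hd : 1 ≤ d) (hd2 : 2 ≤ d) {x y : ExtAffSymm d} {k : ℤ} (hk : ¬ k ≡ k + 1 [ZMOD d])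
include hd2

theorem rPoly_of_descent (hy : y.1 (k + 1) < y.1 k) (hx : x.1 (k + 1) < x.1 k) :
    rPoly hd x y = rPoly hd (x * swap k (k + 1) hk) (y * swap k (k + 1) hk) := by
  have h1 := (length_mul_swap_lt_iff hk hd x (by omega)).2 hx
  have h2 := (length_mul_swap_lt_iff hk hd y (by omega)).2 hy
  rw [length, length, affPart_mul_swap] at h1 h2
  have h := isCoxeterPair hd
  have hs : affSwap hk ∈ AffSymm.gens d := mem_gens_iff.2 ⟨hd2, k, rfl⟩
  have := h.rPoly_mul_of_lt (x := affPart x) (y := affPart y * affSwap hk) hs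
    (by rwa [h.mul_mul_cancel hs]) h1
  rw [h.mul_mul_cancel hs] at this
  rw [rPoly, rPoly, this, affPart_mul_swap, affPart_mul_swap]

theorem rPoly_of_ascent (hy : y.1 (k + 1) < y.1 k) (hx : x.1 k < x.1 (k + 1)) :
    rPoly hd x y = CoxeterPair.q * rPoly hd (x * swap k (k + 1) hk) (y * swap k (k + 1) hk) +
      (CoxeterPair.q - 1) * rPoly hd x (y * swap k (k + 1) hk) := by
  have h1 := (length_lt_mul_swap_iff hk hd x (by omega)).2 hx
  have h2 := (length_mul_swap_lt_iff hk hd y (by omega)).2 hy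
  rw [length, length, affPart_mul_swap] at h1 h2
  have h := isCoxeterPair hd
  have hs : affSwap hk ∈ AffSymm.gens d := mem_gens_iff.2 ⟨hd2, k, rfl⟩
  have := h.rPoly_mul_of_gt (x := affPart x) (y := affPart y * affSwap hk) hs
    (by rwa [h.mul_mul_cancel hs]) h1
  rw [h.mul_mul_cancel hs] at this
  rw [rPoly, rPoly, rPoly, this, affPart_mul_swap, affPart_mul_swap]

end

section

variable {i j : ℤ} {e f : ℤ → ℤ}

/-- If the position `i` is cancellable for `[x, y]`, then a descent of `y` at `k` that involves the
position `i` is also one of `x`. -/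
theorem Cancellable.descent (hd : 2 ≤ d) {x y : ExtAffSymm d} (h : Cancellable i x y) {k : ℤ}
    (hk : ¬ k ≡ k + 1 [ZMOD d]) (hi : (swap k (k + 1) hk).1 i ≠ i) (hy : y.1 (k + 1) < y.1 k) :
    x.1 (k + 1) < x.1 k := by
  -- At an ascent of x, lifting would place x s in [x,y], where the value at i is constant; this
  -- would force s to fix i.
  refine (lt_or_gt_apply_succ x k).resolve_left fun hx => hi ?_
  have h1 := h.le.mul_simple_le hd hk hy
  have h2 := (h.apply_eq_of_mem (by omega)
    ⟨bruhatLE_mul_swap (by omega) x hk (by omega) hx, h1⟩).1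
  exact x.1.injective h2

theorem IsCancel.a_eq (hd : 1 ≤ d) (hn : 1 ≤ n) (he : Skip d n i e) (hf : Skip d n j f)
    {x y : ExtAffSymm d} {z z' : ExtAffSymm n} (hx : IsCancel e f x z) (hy : IsCancel e f y z')
    (hxy : Cancellable i x y) : a z = a z' := (hx.le hd hn he hf hy hxy).1

/-- Cancelling a cancellable position does not change the polynomial `R_{x,y}`. -/
theorem IsCancel.rPoly_eq (hd : 1 ≤ d) (hn : 1 ≤ n) (hf : Skip d n j f) (he : Skip d n i e)
    {x y : ExtAffSymm d} {z z' : ExtAffSymm n} (hx : IsCancel e f x z) (hy : IsCancel e f y z')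
    (hxy : Cancellable i x y) : rPoly hd x y = rPoly hn z z' := by
  induction hN : length y generalizing x y z z' i e with
  | zero =>
    have h1 : x = y := by
      by_contra hne
      have := hxy.le.length_lt hne
      omega
    subst h1
    obtain rfl := hx.unique hf hy
    rw [rPoly_self, rPoly_self]
  | succ N ih =>
    obtain ⟨k, hk⟩ := exists_descent_of_length_pos hd y (by omega)
    have hd2 := two_le_of_descent hd y hk
    rcases descent_cases y i hk with h1 | ⟨l, rfl, h1⟩ | ⟨h1, h2⟩
    · have hs := simple_not_modEq hd2 i
      have hl := length_mul_simple hd2 y hs h1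
      have hi := swap_left hs
      have hx1 := hxy.descent hd2 hs (by omega) h1
      rw [rPoly_of_descent hd hd2 hs h1 hx1]
      have i1 := inv_mul_simple_left hd2 x hs hx1
      have i2 := inv_mul_simple_left hd2 y hs h1
      have i3 := hxy.invBelow_eq
      have i4 := hxy.invAbove_eq
      refine ih (i := i + 1) (by simpa only [hi] using he.move hd2 i hs (by omega))
        (hx.move i hs) (hy.move i hs) ⟨hxy.le.mul_simple hd2 hs hx1, ?_, ?_, ?_⟩ (by omega)
      · rw [mul_apply, mul_apply, swap_right, hxy.apply_eq]
      · omega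
      · omega
    · have hs := simple_not_modEq hd2 l
      have hl := length_mul_simple hd2 y hs h1
      have hi := swap_right hs
      have hx1 := hxy.descent hd2 hs (by omega) h1
      rw [rPoly_of_descent hd hd2 hs h1 hx1]
      have i1 := inv_mul_simple_right hd2 x hs hx1
      have i2 := inv_mul_simple_right hd2 y hs h1
      have i3 := hxy.invBelow_eq
      have i4 := hxy.invAbove_eq
      refine ih (i := l) (by simpa only [hi] using he.move hd2 l hs (by omega))
        (hx.move l hs) (hy.move l hs) ⟨hxy.le.mul_simple hd2 hs hx1, ?_, ?_, ?_⟩ (by omega)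
      · rw [mul_apply, mul_apply, swap_left, hxy.apply_eq]
      · omega
      · omega
    · have hs := simple_not_modEq hd2 k
      obtain ⟨m, rfl, hm⟩ := he.exists_succ h1 h2
      have hi : (swap (e m) (e m + 1) hs).1 i = i :=
        swap_of_not_modEq hs (fun h5 => h1 h5.symm) (fun h5 => h2 h5.symm)
      have hl := length_mul_simple hd2 y hs hk
      have hs' : ¬ m ≡ m + 1 [ZMOD n] := mt (he.modEq_iff m (m + 1)).2 (by rwa [hm])
      have hmul : ∀ {v : ExtAffSymm d} {r : ExtAffSymm n}, IsCancel e f v r →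
          IsCancel e f (v * swap (e m) (e m + 1) hs) (r * swap m (m + 1) hs') := by
        intro v r hv
        have := hv.mul_swap he hs' (by rwa [hm])
        simpa only [hm] using this
      have hlt : ∀ {v : ExtAffSymm d} {r : ExtAffSymm n}, IsCancel e f v r →
          (r.1 (m + 1) < r.1 m ↔ v.1 (e m + 1) < v.1 (e m)) := by
        intro v r hv
        rw [hv.lt_iff hf, hm]
      have hgt : ∀ {v : ExtAffSymm d} {r : ExtAffSymm n}, IsCancel e f v r →
          (r.1 m < r.1 (m + 1) ↔ v.1 (e m) < v.1 (e m + 1)) := by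
        intro v r hv
        rw [hv.lt_iff hf, hm]
      have hz'k := (hlt hy).2 hk
      have hn2 := two_le_of_descent hn z' hz'k
      have iy := inv_mul_simple_of_fixed y hs hi
      -- Used for v = x s and v = x. If v ≤ y s, then i is cancellable there and induction applies.
      -- Otherwise both sides vanish, since `IsCancel.le_of_le` would lift an inequality between the
      -- cancelled permutations. The conditions on `a` are needed because `rPoly` only sees affine
      -- parts.
      have key : ∀ {v : ExtAffSymm d} {r : ExtAffSymm n}, IsCancel e f v r → v.1 i = x.1 i →
          invBelow i v = invBelow i x → invAbove i v = invAbove i x → a v = a x → a r = a z →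
          rPoly hd v (y * swap (e m) (e m + 1) hs) = rPoly hn r (z' * swap m (m + 1) hs') := by
        intro v r hv hvi hvb hva hav har
        have hyi : v.1 i = (y * swap (e m) (e m + 1) hs).1 i := by
          rw [mul_apply, hi, hvi, hxy.apply_eq]
        by_cases hle : BruhatLE v (y * swap (e m) (e m + 1) hs)
        · exact ih he hv (hmul hy) ⟨hle, hyi, by rw [hvb, iy.1, hxy.invBelow_eq],
            by rw [hva, iy.2, hxy.invAbove_eq]⟩ (by omega)
        · rw [rPoly_eq_zero hd (by rw [a_mul_swap, hav, hxy.le.1]) hle, rPoly_eq_zero hn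
            (by rw [a_mul_swap, har, hx.a_eq hd hn he hf hy hxy])
            fun hc => hle (hv.le_of_le hd hn he hf (hmul hy) hyi hc)]
      have ix := inv_mul_simple_of_fixed x hs hi
      have k1 := key (hmul hx) (by rw [mul_apply, hi]) ix.1 ix.2 (a_mul_swap _ _) (a_mul_swap _ _)
      rcases lt_or_gt_apply_succ x (e m) with hx1 | hx1
      · rw [rPoly_of_ascent hd hd2 hs hk hx1, rPoly_of_ascent hn hn2 hs' hz'k ((hgt hx).2 hx1), k1,
          key hx rfl rfl rfl rfl rfl]
      · rw [rPoly_of_descent hd hd2 hs hk hx1, rPoly_of_descent hn hn2 hs' hz'k ((hlt hx).2 hx1),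
          k1]

/-! ### Kazhdan-Lusztig polynomials -/

theorem finite_bruhatLE (hd : 1 ≤ d) (v : ExtAffSymm d) : {x | BruhatLE x v}.Finite := by
  refine Set.Finite.of_finite_image (f := affPart)
    (((isCoxeterPair hd).finite_bruhatLE (finite_gens hd) (affPart v)).subset ?_) ?_
  · rintro _ ⟨x, hx, rfl⟩
    exact hx.2
  · intro x hx y hy hxy
    exact eq_of_affPart_eq (hx.1.trans hy.1.symm) hxy

/-- The identity `∑ R_{u,x} P_{x,v} = q^{ℓ(v)-ℓ(u)} P_{u,v}(q⁻¹)`, where `x` runs over a finite set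
that contains the interval from `u` to `v`. -/
theorem sum_rPoly_mul_klPoly (hd : 1 ≤ d) (u v : ExtAffSymm d) (ha : a u = a v)
    (s : Finset (ExtAffSymm d)) (hs : interval u v ⊆ s) (hsa : ∀ x ∈ s, a x = a v) :
    ∑ x ∈ s, rPoly hd u x * Polynomial.toLaurent (klPoly x v) =
      LaurentPolynomial.T ((length v : ℤ) - length u) *
        LaurentPolynomial.invert (Polynomial.toLaurent (klPoly u v)) := by
  classical
  have h := (isCoxeterPair hd).sum_rPoly_mul_klPoly (finite_gens hd) (affPart u) (affPart v)
    (s.image affPart) (fun y hy1 hy2 => by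
      -- An element between the two affine parts is translated back by τ^{a(v)} to an element of
      -- [u,v].
      refine Finset.mem_image.2 ⟨tau d ^ a v * y.1, hs ⟨⟨?_, ?_⟩, ?_, ?_⟩,
        affPart_tau_zpow_mul hd _ _⟩
      · rw [a_tau_zpow_mul hd, ha]
      · rwa [affPart_tau_zpow_mul hd]
      · rw [a_tau_zpow_mul hd]
      · rwa [affPart_tau_zpow_mul hd])
  rw [Finset.sum_image fun x hx y hy hxy => eq_of_affPart_eq ((hsa x hx).trans (hsa y hy).symm) hxy]
    at h
  rw [klPoly, if_pos ha, length, length, ← h]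
  refine Finset.sum_congr rfl fun x hx => ?_
  rw [klPoly, if_pos (hsa x hx), rPoly]

theorem klPoly_self (hd : 1 ≤ d) (v : ExtAffSymm d) : klPoly v v = 1 := by
  rw [klPoly, if_pos rfl, (isCoxeterPair hd).klPoly_self (finite_gens hd)]

theorem klPoly_eq_zero (hd : 1 ≤ d) {u v : ExtAffSymm d} (huv : ¬ BruhatLE u v) :
    klPoly u v = 0 := by
  rw [klPoly]
  split_ifs with ha
  · exact (isCoxeterPair hd).klPoly_eq_zero (finite_gens hd) fun h => huv ⟨ha, h⟩
  · rfl

theorem klPoly_degree (hd : 1 ≤ d) {u v : ExtAffSymm d} (huv : BruhatLE u v) (hne : u ≠ v) :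
    length u + (2 * (klPoly u v).natDegree + 1) ≤ length v := by
  rw [klPoly, if_pos huv.1]
  exact (isCoxeterPair hd).klPoly_degree (finite_gens hd) huv.2
    fun h => hne (eq_of_affPart_eq huv.1 h)

/-- Cancelling a cancellable position does not change the Kazhdan-Lusztig polynomial. -/
theorem IsCancel.klPoly_eq (hd : 1 ≤ d) (hn : 1 ≤ n) (he : Skip d n i e) (hf : Skip d n j f)
    {u v : ExtAffSymm d} {z z' : ExtAffSymm n} (hu : IsCancel e f u z) (hv : IsCancel e f v z')
    (huv : Cancellable i u v) : klPoly u v = klPoly z z' := by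
  classical
  induction hN : length v - length u using Nat.strong_induction_on generalizing u z with
  | _ N ih =>
    by_cases hne : u = v
    · subst hne
      obtain rfl := hu.unique hf hv
      rw [klPoly_self hd, klPoly_self hn]
    have hzz' := hu.le hd hn he hf hv huv
    have hlt := huv.le.length_lt hne
    have hzne : z ≠ z' := by
      rintro rfl
      exact hne (hu.eq_of_apply_eq he hv huv.apply_eq)
    have hlen : (length z' : ℤ) - length z = length v - length u := by
      have h1 := hu.length_eq hd hn hf he
      have h2 := hv.length_eq hd hn hf he
      have h3 := huv.invBelow_eq
      have h4 := huv.invAbove_eq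
      omega
    have hfin : (interval u v).Finite := (finite_bruhatLE hd v).subset fun x hx => hx.2
    let s := hfin.toFinset
    have hs : ∀ x, x ∈ s ↔ x ∈ interval u v := fun x => hfin.mem_toFinset
    have hus : u ∈ s := (hs u).2 ⟨BruhatLE.refl u, huv.le⟩
    have hux : ∀ x ∈ s, Cancellable i u x := fun x hx =>
      huv.of_mem hd ((hs u).1 hus) ((hs x).1 hx) ((hs x).1 hx).1
    have hxv : ∀ x ∈ s, Cancellable i x v := fun x hx =>
      huv.of_mem hd ((hs x).1 hx) ⟨huv.le, BruhatLE.refl v⟩ ((hs x).1 hx).2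
    have hex : ∀ x ∈ s, ∃ r : ExtAffSymm n, IsCancel e f x r := fun x hx =>
      (hu.exists_of_le hd hn he hf (hux x hx)).imp fun _ h => h.1
    choose! c hc using hex
    have hcu : c u = z := (hc u hus).unique hf hu
    have hcinj : ∀ x ∈ s, ∀ y ∈ s, c x = c y → x = y := fun x hx y hy hxy =>
      (hc x hx).eq_of_apply_eq he (hxy ▸ hc y hy)
        ((hux x hx).apply_eq.symm.trans (hux y hy).apply_eq)
    have h1 := sum_rPoly_mul_klPoly hd u v huv.le.1 s (fun x hx => (hs x).2 hx)
      fun x hx => ((hs x).1 hx).2.1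
    -- The image of `s` contains all of [z,z'], as each of its elements lifts to [u,v].
    have h2 := sum_rPoly_mul_klPoly hn z z' hzz'.1 (s.image c) (fun r hr => by
      obtain ⟨x, hux, hx, hxi⟩ := hu.exists_le hd hn he hf hr.1
      have hxs : x ∈ s := (hs x).2
        ⟨hux, hx.le_of_le hd hn he hf hv (hxi.trans huv.apply_eq) hr.2⟩
      exact Finset.mem_coe.2 (Finset.mem_image.2 ⟨x, hxs, (hc x hxs).unique hf hx⟩)) (fun r hr => by
      obtain ⟨x, hx, rfl⟩ := Finset.mem_image.1 hr
      exact (hc x hx).a_eq hd hn he hf hv (hxv x hx))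
    rw [Finset.sum_image hcinj, ← Finset.add_sum_erase s _ hus, hcu, rPoly_self, one_mul, hlen]
      at h2
    rw [← Finset.add_sum_erase s _ hus, rPoly_self, one_mul] at h1
    have h3 : ∑ x ∈ s.erase u, rPoly hd u x * Polynomial.toLaurent (klPoly x v) =
        ∑ x ∈ s.erase u, rPoly hn z (c x) * Polynomial.toLaurent (klPoly (c x) z') := by
      refine Finset.sum_congr rfl fun x hx => ?_
      obtain ⟨hxu, hxs⟩ := Finset.mem_erase.1 hx
      have h4 := (hux x hxs).le.length_lt (Ne.symm hxu)
      rw [hu.rPoly_eq hd hn hf he (hc x hxs) (hux x hxs),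
        ih _ (by omega) (hc x hxs) (hxv x hxs) rfl]
    -- The terms other than x = u agree by induction and the equality of R-polynomials. The
    -- difference of the two P is thus symmetric, with degree below half of ℓ(v) - ℓ(u), and
    -- therefore zero.
    have h4 : LaurentPolynomial.T ((length v - length u : ℕ) : ℤ) * LaurentPolynomial.invert
        (Polynomial.toLaurent (klPoly u v - klPoly z z')) =
        Polynomial.toLaurent (klPoly u v - klPoly z z') := by
      rw [map_sub, map_sub, mul_sub, Nat.cast_sub hlt.le, ← h1, ← h2, h3]
      ring
    have d1 := klPoly_degree hd huv.le hne
    have d2 := klPoly_degree hn hzz' hzne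
    refine sub_eq_zero.1 (CoxeterPair.eq_zero_of_T_mul_invert_eq (fun k hk => ?_) h4)
    rw [Polynomial.coeff_sub, Polynomial.coeff_eq_zero_of_natDegree_lt (by omega),
      Polynomial.coeff_eq_zero_of_natDegree_lt (by omega), sub_zero]

end

/-! ### Relabellings -/

/-- For d = 1 the complement of the only class is empty and cannot be in bijection with ℤ. -/
theorem two_le_of_relabelling (hd : 1 ≤ d) (σ : Relabelling d) : 2 ≤ d := by
  rcases Nat.lt_or_ge d 2 with h | h
  · obtain rfl : d = 1 := by omega
    exact absurd (Subsingleton.elim _ _) ((σ 0).symm 0).2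
  · exact h

theorem skip_relabelling (σ : Relabelling d) (i : ℤ) :
    Skip d (d - 1) i (fun k => ((σ (i : ZMod d)).symm k).1) where
  mono := fun _ _ h => (σ (i : ZMod d)).symm.strictMono h
  range := by
    intro k
    rw [← ZMod.intCast_eq_intCast_iff]
    constructor
    · rintro ⟨m, rfl⟩
      exact ((σ (i : ZMod d)).symm m).2
    · intro hk
      exact ⟨σ (i : ZMod d) ⟨k, hk⟩, by rw [OrderIso.symm_apply_apply]⟩
  shift := by
    intro k
    let x : {x : ℤ // (x : ZMod d) ≠ (i : ZMod d)} := (σ (i : ZMod d)).symm k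
    let x' : {x : ℤ // (x : ZMod d) ≠ (i : ZMod d)} := ⟨x.1 + d, by simpa using x.2⟩
    have hx : (σ (i : ZMod d)).symm (k + ((d - 1 : ℕ) : ℤ)) = x' := by
      rw [OrderIso.symm_apply_eq, relabel_add σ _ x x' rfl]
      simp [x]
    rw [hx]

theorem isCancel_cancel (σ : Relabelling d) (i : ℤ) (x : ExtAffSymm d) :
    IsCancel (fun k => ((σ (i : ZMod d)).symm k).1) (fun k => ((σ (x.1 i : ZMod d)).symm k).1) x
      (cancel σ i x) := by
  intro k
  dsimp only [cancel, cancelPerm]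
  simp

end ExtAffSymm

end

theorem mainTheorem4 (d : ℕ) (hd : 1 ≤ d) (y w : ExtAffSymm d) (i : ℤ)
    (hi : ExtAffSymm.Cancellable i y w) :
    (∀ x ∈ ExtAffSymm.interval y w,
      x.1 i = y.1 i ∧ ExtAffSymm.invBelow i x = ExtAffSymm.invBelow i y) ∧
    (∀ u ∈ ExtAffSymm.interval y w, ∀ v ∈ ExtAffSymm.interval y w,
      ExtAffSymm.BruhatLE u v → ExtAffSymm.Cancellable i u v) ∧
    ∀ σ : ExtAffSymm.Relabelling d,
      Set.BijOn (ExtAffSymm.cancel σ i) (ExtAffSymm.interval y w)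
        (ExtAffSymm.interval (ExtAffSymm.cancel σ i y) (ExtAffSymm.cancel σ i w)) ∧
      (∀ u ∈ ExtAffSymm.interval y w, ∀ v ∈ ExtAffSymm.interval y w,
        (ExtAffSymm.BruhatLE u v ↔
          ExtAffSymm.BruhatLE (ExtAffSymm.cancel σ i u) (ExtAffSymm.cancel σ i v))) ∧
      (∃ c : ℕ, ∀ x ∈ ExtAffSymm.interval y w,
        ExtAffSymm.length x = ExtAffSymm.length (ExtAffSymm.cancel σ i x) + c) ∧
      (∀ u ∈ ExtAffSymm.interval y w, ∀ v ∈ ExtAffSymm.interval y w,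
        ExtAffSymm.klPoly u v =
          ExtAffSymm.klPoly (ExtAffSymm.cancel σ i u) (ExtAffSymm.cancel σ i v)) := by
  refine ⟨fun x hx => ?_, fun u hu v hv huv => hi.of_mem hd hu hv huv, fun σ => ?_⟩
  · have h := hi.apply_eq_of_mem hd hx
    exact ⟨h.1, h.2.1⟩
  have hd2 := ExtAffSymm.two_le_of_relabelling hd σ
  have hn : 1 ≤ d - 1 := by omega
  have he := ExtAffSymm.skip_relabelling σ i
  have hf := ExtAffSymm.skip_relabelling σ (y.1 i)
  have hval : ∀ x ∈ ExtAffSymm.interval y w, x.1 i = y.1 i := fun x hx =>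
    (hi.apply_eq_of_mem hd hx).1
  -- The relabelling of values depends on the class of x(i). As x(i) is constant on [y,w], one
  -- parametrisation of values serves the whole interval.
  have hc : ∀ x : ExtAffSymm d, x.1 i = y.1 i →
      ExtAffSymm.IsCancel (fun k => ((σ (i : ZMod d)).symm k).1)
        (fun k => ((σ (y.1 i : ZMod d)).symm k).1) x (ExtAffSymm.cancel σ i x) := fun x hx => by
    have := ExtAffSymm.isCancel_cancel σ i x
    rwa [hx] at this
  have hy : y ∈ ExtAffSymm.interval y w := ⟨ExtAffSymm.BruhatLE.refl y, hi.le⟩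
  have hw : w ∈ ExtAffSymm.interval y w := ⟨hi.le, ExtAffSymm.BruhatLE.refl w⟩
  have hle : ∀ u ∈ ExtAffSymm.interval y w, ∀ v ∈ ExtAffSymm.interval y w,
      (ExtAffSymm.BruhatLE u v ↔
        ExtAffSymm.BruhatLE (ExtAffSymm.cancel σ i u) (ExtAffSymm.cancel σ i v)) := by
    intro u hu v hv
    have hcu := hc u (hval u hu)
    have hcv := hc v (hval v hv)
    exact ⟨fun huv => hcu.le hd hn he hf hcv (hi.of_mem hd hu hv huv),
      hcu.le_of_le hd hn he hf hcv ((hval u hu).trans (hval v hv).symm)⟩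
  refine ⟨⟨fun x hx => ⟨(hle y hy x hx).1 hx.1, (hle x hx w hw).1 hx.2⟩, ?_, ?_⟩, hle,
    ⟨ExtAffSymm.invBelow i y + ExtAffSymm.invAbove i y, fun x hx => ?_⟩, fun u hu v hv => ?_⟩
  · intro u hu v hv huv
    have hcu := hc u (hval u hu)
    rw [huv] at hcu
    exact hcu.eq_of_apply_eq he (hc v (hval v hv)) ((hval u hu).trans (hval v hv).symm)
  · rintro z ⟨hyz, hzw⟩
    obtain ⟨x, hyx, hx, hxi⟩ := (hc y rfl).exists_le hd hn he hf hyz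
    exact ⟨x, ⟨hyx, hx.le_of_le hd hn he hf (hc w (hval w hw)) (hxi.trans (hval w hw).symm) hzw⟩,
      (hc x hxi).unique hf hx⟩
  · have h := hi.apply_eq_of_mem hd hx
    rw [← h.2.1, ← h.2.2]
    exact (hc x (hval x hx)).length_eq hd hn hf he
  · by_cases huv : ExtAffSymm.BruhatLE u v
    · exact (hc u (hval u hu)).klPoly_eq hd hn he hf (hc v (hval v hv)) (hi.of_mem hd hu hv huv)
    · rw [ExtAffSymm.klPoly_eq_zero hd huv,
        ExtAffSymm.klPoly_eq_zero hn (mt (hle u hu v hv).2 huv)]
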